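/- All graphs are finite and simple. For a graph $G$ let $i_k(G)$ be the number of independent sets of $k$ vertices of $G$, let $\alpha(G)$ be its independence number, and let $I(G,x)=\sum_{k=0}^{\alpha(G)} i_k(G)x^k$ be its independence polynomial. Let $\mathcal I(G)$ be the class of all graphs $H$ with $I(H,x)=I(G,x)$, graphs being considered up to isomorphism. Let $C_n$ be the cycle on $n$ vertices, let $D_n$ be the graph on $n$ vertices that consists of a triangle and a path on $n-3$ vertices, one end of which is joined to one vertex of the triangle (for $n\ge 4$), and let $\cup$ denote disjoint union. Define graphs $G_a,G_b,G_c,G_d$ on the vertex set $\{0,\dots,5\}$ and $G'_a,G'_b,G'_c$ on the vertex set $\{0,\dots,6\}$ by their edge sets: - $G_a$: $01,12,13,23,34,45$ (a triangle with pendant paths of one and two vertices at two different vertices of it); - $G_b$: $01,02,13,23,34,45$ (a 4-cycle with a pendant path of two vertices); - $G_c$: $01,02,13,24,34,45$ (a 5-cycle with one pendant vertex); - $G_d$: $01,02,12,23,34,35$ (a triangle, one vertex of which is joined to a vertex with two further neighbours of degree one); - $G'_a$: $01,12,13,23,34,45,56$ (a triangle with pendant paths of one and three vertices at two different vertices of it);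 - $G'_b$: $01,02,13,23,34,45,56$ (a 4-cycle with a pendant path of three vertices); - $G'_c$: $01,02,13,24,35,45,56$ (a 6-cycle with one pendant vertex). Theorem. (i) $\mathcal I(C_3)=\{C_3\}$. (ii) $\mathcal I(C_9)=\{C_9,\ D_9,\ C_3\cup G_a,\ C_3\cup G_b,\ C_3\cup G_c,\ C_3\cup G_d\}$. (iii) $\mathcal I(C_{15})=\{C_{15},\ D_{15},\ C_3\cup C_5\cup G'_a,\ C_3\cup D_5\cup G'_a,\ C_3\cup C_5\cup G'_b,\ C_3\cup D_5\cup G'_b,\ C_3\cup C_5\cup G'_c,\ C_3\cup D_5\cup G'_c\}$. (iv) $\mathcal I(C_n)=\{C_n,D_n\}$ for every odd $n\ge 5$ with $n\ne 9$ and $n\ne 15$. In particular (the Beaton–Brown–Cameron conjecture), if $n\ge 4$ is odd and $3\nmid n$, then a graph $G$ is independence equivalent to $C_n$ if and only if $G$ is isomorphic to $C_n$ or $D_n$. -/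

import Mathlib

open SimpleGraph Polynomial

namespace OddCycleClass

/-- The independence polynomial `I(G, x) = ∑_{k=0}^{α(G)} i_k(G) x^k` of a (finite) graph, where
`i_k(G)` is the number of independent sets of vertices of cardinality `k` and `α(G)` is the
independence number. -/
noncomputable def indepPoly {V : Type*} (G : SimpleGraph V) : ℤ[X] :=
  ∑ k ∈ Finset.range (G.indepNum + 1), C ((G.indepSetSet k).ncard : ℤ) * X ^ k

/-- Two graphs are independence equivalent if they have the same independence polynomial. -/
def IndepEquiv {V W : Type*} (G : SimpleGraph V) (H : SimpleGraph W) : Prop :=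
  indepPoly G = indepPoly H

/-- The graph `D_n` (`n ≥ 3`): a triangle `0, 1, 2` with the path `2, 3, …, n - 1` hanging from
its vertex `2`. -/
def dGraph (n : ℕ) : SimpleGraph (Fin n) :=
  SimpleGraph.fromRel fun u v => u.val + 1 = v.val ∨ (u.val = 0 ∧ v.val = 2)

/-- `G_a`: a triangle with a pendant path of one vertex at one of its vertices and a pendant
path of two vertices at another one. -/
def graphA : SimpleGraph (Fin 6) :=
  SimpleGraph.fromEdgeSet {s(0, 1), s(1, 2), s(1, 3), s(2, 3), s(3, 4), s(4, 5)}

/-- `G_b`: a 4-cycle with a pendant path of two vertices. -/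
def graphB : SimpleGraph (Fin 6) :=
  SimpleGraph.fromEdgeSet {s(0, 1), s(0, 2), s(1, 3), s(2, 3), s(3, 4), s(4, 5)}

/-- `G_c`: a 5-cycle with one pendant vertex. -/
def graphC : SimpleGraph (Fin 6) :=
  SimpleGraph.fromEdgeSet {s(0, 1), s(0, 2), s(1, 3), s(2, 4), s(3, 4), s(4, 5)}

/-- `G_d`: a triangle, one vertex of which is joined to a vertex that has two further
neighbours, both of degree one. -/
def graphD : SimpleGraph (Fin 6) :=
  SimpleGraph.fromEdgeSet {s(0, 1), s(0, 2), s(1, 2), s(2, 3), s(3, 4), s(3, 5)}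

/-- `G'_a`: a triangle with a pendant path of one vertex at one of its vertices and a pendant
path of three vertices at another one. -/
def graphA' : SimpleGraph (Fin 7) :=
  SimpleGraph.fromEdgeSet {s(0, 1), s(1, 2), s(1, 3), s(2, 3), s(3, 4), s(4, 5), s(5, 6)}

/-- `G'_b`: a 4-cycle with a pendant path of three vertices. -/
def graphB' : SimpleGraph (Fin 7) :=
  SimpleGraph.fromEdgeSet {s(0, 1), s(0, 2), s(1, 3), s(2, 3), s(3, 4), s(4, 5), s(5, 6)}

/-- `G'_c`: a 6-cycle with one pendant vertex. -/
def graphC' : SimpleGraph (Fin 7) :=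
  SimpleGraph.fromEdgeSet {s(0, 1), s(0, 2), s(1, 3), s(2, 4), s(3, 5), s(4, 5), s(5, 6)}

end OddCycleClass

/-! The polynomial of `C_n` has no zero in `[-1/4, 0]`. This property passes to induced subgraphs
(`pos_of_subset`) and survives the deletion of an edge (`PositiveOn.of_sup_edge`), so every
component of a graph equivalent to `C_n` has it, and connected graphs with it can be classified by
induction on the number of vertices plus edges (`listed_of_connected`). They are trees, the diamond,
or unicyclic: `C_k`, `D_k`, `eGraph k`, eight sporadic graphs, or graphs of defect at least 12.
Graphs outside the list are excluded by the sign of `weight`, the value at `-1/4` scaled by 2 per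
vertex. There the recursion along a pendant path is `w = 2w' - w''`, with double characteristic root
1: weights are linear along pendant paths, and all `C_k` and `D_k` have weight 2.

The components of an equivalent graph are then sorted by invariants read off the polynomial. The
value at 1 is the Lucas number `L_n`. It is not divisible by 3 for odd `n`, which excludes the
diamond (value 6), and never divisible by 8, which excludes two triangles (value 4 each). Without
diamonds every component has `excess ≤ 0`; the sum is 0, so no component is a tree. The additive
`defect` is `-6` for the triangle, 0 for `C_k` and `D_k` with `k ≥ 4`, and at least 6 otherwise,
with total 0.

If no component is a triangle, all have defect 0 and weight 2; as the product of the weights is 2,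
there is one component. Otherwise there are one triangle, one component of defect 6 and weight `w`,
and `r` components `C_k` or `D_k`, with `w * 2 ^ r = 1`. The possible `w` are `3/2`, `1`, `1/2`, so
`w = 1, r = 0` or `w = 1/2, r = 1`. Any size that is still free is fixed by a Lucas equation whose
only solution is `k = 5`; this gives `n = 9` and `n = 15`. -/

namespace OddCycleClass

/-! ### Independence sums over vertex subsets and their recursions. -/

section IndepSum

variable {R : Type*} [CommRing R] {V W : Type*}

/-- The sum of `x ^ #T` over the independent sets `T ⊆ S` of `G`. -/
noncomputable def indepSum (x : R) (G : SimpleGraph V) (S : Finset V) : R := by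
  classical exact ∑ T ∈ S.powerset.filter (fun T : Finset V => G.IsIndepSet (T : Set V)), x ^ T.card

@[simp] lemma indepSum_empty (x : R) (G : SimpleGraph V) : indepSum x G ∅ = 1 := by
  classical
  simp [indepSum, Finset.filter_singleton]

/-- The independent sets are split by whether they contain `v`. The two smaller sets enter through
membership conditions, so any convenient description of them can be supplied. -/
lemma indepSum_rec (x : R) (G : SimpleGraph V) {S S' T : Finset V} {v : V} (hv : v ∈ S)
    (hS' : ∀ u, u ∈ S' ↔ u ∈ S ∧ u ≠ v) (hT : ∀ u, u ∈ T ↔ u ∈ S ∧ u ≠ v ∧ ¬ G.Adj v u) :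
    indepSum x G S = indepSum x G S' + x * indepSum x G T := by
  classical
  have hvS' : v ∉ S' := by simp [hS']
  have : Std.Symm fun a b => ¬ G.Adj a b := ⟨fun _ _ h h' => h h'.symm⟩
  obtain rfl : S = insert v S' := by
    ext u; by_cases h : u = v <;> simp [hS', h, hv]
  have hvT : v ∉ T := by simp [hT]
  unfold indepSum
  rw [Finset.powerset_insert, Finset.filter_union, Finset.sum_union]
  · congr 1
    rw [Finset.filter_image, Finset.sum_image, Finset.mul_sum]
    · refine Finset.sum_congr ?_ ?_
      · ext A
        simp only [Finset.mem_filter, Finset.mem_powerset, Finset.coe_insert]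
        constructor
        · rintro ⟨hA, hI⟩
          have hI' := (Set.pairwise_insert_of_symm
            (r := fun a b => ¬ G.Adj a b)).1 hI
          refine ⟨fun u hu => ?_, hI'.1⟩
          have huv : u ≠ v := fun h => hvS' (h ▸ hA hu)
          exact (hT u).2 ⟨Finset.mem_insert_of_mem (hA hu), huv, hI'.2 u hu huv.symm⟩
        · rintro ⟨hA, hI⟩
          refine ⟨fun u hu => ?_, (Set.pairwise_insert_of_symm
            (r := fun a b => ¬ G.Adj a b)).2
            ⟨hI, fun u hu _ => ((hT u).1 (hA hu)).2.2⟩⟩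
          have := (hT u).1 (hA hu)
          exact (Finset.mem_insert.1 this.1).resolve_left this.2.1
      · intro A hA
        have : v ∉ A := fun h => hvT ((Finset.mem_powerset.1 (Finset.mem_filter.1 hA).1) h)
        rw [Finset.card_insert_of_notMem this, pow_succ']
    · intro A hA B hB h
      have hA' : v ∉ A := fun h => hvS' ((Finset.mem_powerset.1 (Finset.mem_filter.1 hA).1) h)
      have hB' : v ∉ B := fun h => hvS' ((Finset.mem_powerset.1 (Finset.mem_filter.1 hB).1) h)
      rw [← Finset.erase_insert hA', ← Finset.erase_insert hB', h]
  · rw [Finset.disjoint_left]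
    intro A hA hB
    obtain ⟨B, _, rfl⟩ := Finset.mem_image.1 (Finset.mem_filter.1 hB).1
    exact hvS' ((Finset.mem_powerset.1 (Finset.mem_filter.1 hA).1) (Finset.mem_insert_self _ _))

/-- Formulated for bijections between finite vertex sets rather than for isomorphisms, so that
pieces of graphs on `Fin n` can be matched with intervals in an infinite graph on `ℕ`. -/
lemma indepSum_bijOn (x : R) {G : SimpleGraph V} {H : SimpleGraph W} {S : Finset V}
    {T : Finset W} (f : V → W) (hf : Set.BijOn f S T)
    (hadj : ∀ a ∈ S, ∀ b ∈ S, H.Adj (f a) (f b) ↔ G.Adj a b) :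
    indepSum x G S = indepSum x H T := by
  classical
  induction hn : S.card using Nat.strong_induction_on generalizing S T with
  | _ n ih =>
  rcases S.eq_empty_or_nonempty with rfl | ⟨v, hv⟩
  · have : T = ∅ := by simpa using hf.image_eq.symm
    subst this; simp
  · have key : ∀ (P : V → Prop) (Q : W → Prop) [DecidablePred P] [DecidablePred Q], (∀ a ∈ S, P a ↔ Q (f a)) →
        (¬ P v) → indepSum x G {a ∈ S | P a} = indepSum x H {b ∈ T | Q b} := by
      intro P Q _ _ hPQ hPv
      refine ih _ ?_ ⟨?_, ?_, ?_⟩ ?_ rfl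
      · rw [← hn]
        refine Finset.card_lt_card (Finset.filter_ssubset.2 ⟨v, hv, hPv⟩)
      · intro a ha
        simp only [Finset.coe_filter, Set.mem_ofPred_eq] at ha ⊢
        exact ⟨hf.mapsTo ha.1, (hPQ a ha.1).1 ha.2⟩
      · exact hf.injOn.mono (by simp +contextual [Set.subset_def])
      · intro b hb
        simp only [Finset.coe_filter, Set.mem_ofPred_eq] at hb
        obtain ⟨a, ha, rfl⟩ := hf.surjOn hb.1
        exact ⟨a, by simpa using ⟨ha, (hPQ a ha).2 hb.2⟩, rfl⟩
      · intro a ha b hb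
        exact hadj a (Finset.mem_filter.1 ha).1 b (Finset.mem_filter.1 hb).1
    rw [indepSum_rec x G (v := v) (S' := {a ∈ S | a ≠ v})
      (T := {a ∈ S | a ≠ v ∧ ¬ G.Adj v a}) hv (by simp) (by simp),
      indepSum_rec x H (S := T) (v := f v) (S' := {a ∈ T | a ≠ f v})
      (T := {a ∈ T | a ≠ f v ∧ ¬ H.Adj (f v) a}) (hf.mapsTo hv) (by simp) (by simp),
      key (· ≠ v) (· ≠ f v) ?_ (by simp),
      key (fun a => a ≠ v ∧ ¬ G.Adj v a) (fun a => a ≠ f v ∧ ¬ H.Adj (f v) a) ?_ (by simp)]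
    · intro a ha
      rw [hadj v hv a ha, hf.injOn.ne_iff ha hv]
    · intro a ha
      rw [hf.injOn.ne_iff ha hv]

lemma indepSum_congr (x : R) {G H : SimpleGraph V} {S : Finset V}
    (hadj : ∀ a ∈ S, ∀ b ∈ S, H.Adj a b ↔ G.Adj a b) : indepSum x G S = indepSum x H S :=
  indepSum_bijOn x id (Set.bijOn_id _) hadj

lemma indepSum_iso [Fintype V] [Fintype W] (x : R) {G : SimpleGraph V} {H : SimpleGraph W}
    (e : G ≃g H) : indepSum x G Finset.univ = indepSum x H Finset.univ :=
  indepSum_bijOn x e (by simpa using e.bijective.bijOn_univ) (fun a _ b _ => e.map_rel_iff)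

lemma indepSum_union [DecidableEq V] (x : R) {G : SimpleGraph V} {S T : Finset V}
    (hd : Disjoint S T) (h : ∀ a ∈ S, ∀ b ∈ T, ¬ G.Adj a b) :
    indepSum x G (S ∪ T) = indepSum x G S * indepSum x G T := by
  classical
  induction hn : S.card using Nat.strong_induction_on generalizing S with
  | _ n ih =>
  rcases S.eq_empty_or_nonempty with rfl | ⟨v, hv⟩
  · simp
  · have hvT : v ∉ T := Finset.disjoint_left.1 hd hv
    have key : ∀ (P : V → Prop) [DecidablePred P], ¬ P v → indepSum x G ({a ∈ S | P a} ∪ T) =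
        indepSum x G {a ∈ S | P a} * indepSum x G T := by
      intro P _ hP
      refine ih _ ?_ (hd.mono_left (Finset.filter_subset _ _))
        (fun a ha => h a (Finset.mem_filter.1 ha).1) rfl
      rw [← hn]
      exact Finset.card_lt_card (Finset.filter_ssubset.2 ⟨v, hv, hP⟩)
    rw [indepSum_rec x G (S := S) (v := v) (S' := {a ∈ S | a ≠ v})
      (T := {a ∈ S | a ≠ v ∧ ¬ G.Adj v a}) hv (by simp) (by simp),
      indepSum_rec x G (S := S ∪ T) (v := v) (S' := {a ∈ S | a ≠ v} ∪ T)
      (T := {a ∈ S | a ≠ v ∧ ¬ G.Adj v a} ∪ T) (by simp [hv]), key (· ≠ v) (by simp),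
      key (fun a => a ≠ v ∧ ¬ G.Adj v a) (by simp)]
    · ring
    · intro u
      have : u ∈ T → u ≠ v := fun hu e => hvT (e ▸ hu)
      simp only [Finset.mem_union, Finset.mem_filter]; tauto
    · intro u
      have : u ∈ T → u ≠ v := fun hu e => hvT (e ▸ hu)
      have := h v hv u
      simp only [Finset.mem_union, Finset.mem_filter]; tauto

/-- Adding an edge `ab` destroys the independent sets that contain `a` and `b`. -/
lemma indepSum_sup_edge (x : R) {G : SimpleGraph V} {S T : Finset V} {a b : V} (ha : a ∈ S)
    (hb : b ∈ S) (hab : a ≠ b) (hG : ¬ G.Adj a b)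
    (hT : ∀ u, u ∈ T ↔ u ∈ S ∧ u ≠ a ∧ u ≠ b ∧ ¬ G.Adj a u ∧ ¬ G.Adj b u) :
    indepSum x (G ⊔ edge a b) S = indepSum x G S - x ^ 2 * indepSum x G T := by
  classical
  have e1 := indepSum_rec x (G ⊔ edge a b) (S := S) (v := a) (S' := {u ∈ S | u ≠ a})
    (T := {u ∈ S | u ≠ a ∧ u ≠ b ∧ ¬ G.Adj a u}) ha (by simp) (by
      intro u
      by_cases h : u = b
      · subst h; simp [sup_adj, edge_adj, hab, hab.symm]
      · simp [sup_adj, edge_adj, h]; tauto)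
  have e2 := indepSum_rec x G (S := S) (v := a) (S' := {u ∈ S | u ≠ a})
    (T := {u ∈ S | u ≠ a ∧ ¬ G.Adj a u}) ha (by simp) (by simp)
  have e3 := indepSum_rec x G (S := {u ∈ S | u ≠ a ∧ ¬ G.Adj a u}) (v := b)
    (S' := {u ∈ S | u ≠ a ∧ u ≠ b ∧ ¬ G.Adj a u}) (T := T)
    (by simp [hb, hab.symm, hG]) (by intro u; simp; tauto) (by intro u; simp [hT]; tauto)
  have e4 := indepSum_congr x (S := {u ∈ S | u ≠ a}) (G := G) (H := G ⊔ edge a b) (by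
    simp only [Finset.mem_filter, sup_adj, edge_adj]; rintro c ⟨_, hc⟩ d ⟨_, hd⟩; tauto)
  have e5 := indepSum_congr x (S := {u ∈ S | u ≠ a ∧ u ≠ b ∧ ¬ G.Adj a u})
    (G := G) (H := G ⊔ edge a b) (by
    simp only [Finset.mem_filter, sup_adj, edge_adj]; rintro c ⟨_, hc⟩ d ⟨_, hd⟩; tauto)
  rw [e1, e2, e3, e4, e5]; ring

lemma indepSum_singleton (x : R) (G : SimpleGraph V) (v : V) : indepSum x G {v} = 1 + x := by
  rw [indepSum_rec x G (v := v) (S := {v}) (S' := ∅) (T := ∅) (by simp) (by simp)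
    (by simp)]
  simp

lemma map_indepSum {R' : Type*} [CommRing R'] (φ : R →+* R') (x : R) (G : SimpleGraph V)
    (S : Finset V) : φ (indepSum x G S) = indepSum (φ x) G S := by
  simp [indepSum]

lemma indepSum_sum [Fintype V] [Fintype W] (x : R) (G : SimpleGraph V) (H : SimpleGraph W) :
    indepSum x (G ⊕g H) Finset.univ =
      indepSum x G Finset.univ * indepSum x H Finset.univ := by
  classical
  have h : (Finset.univ : Finset (V ⊕ W)) =
      Finset.univ.image Sum.inl ∪ Finset.univ.image Sum.inr := by
    ext (a | a) <;> simp
  rw [h, indepSum_union, ← indepSum_bijOn x (G := G) (S := Finset.univ) Sum.inl,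
    ← indepSum_bijOn x (G := H) (S := Finset.univ) Sum.inr]
  · simpa using Set.injOn_univ.2 Sum.inr_injective |>.bijOn_image
  · simp
  · simpa using Set.injOn_univ.2 Sum.inl_injective |>.bijOn_image
  · simp
  · simp [Finset.disjoint_left]
  · simp

lemma indepPoly_eq_indepSum [Fintype V] (G : SimpleGraph V) :
    indepPoly G = indepSum (X : ℤ[X]) G Finset.univ := by
  classical
  unfold indepPoly indepSum
  rw [← Finset.sum_fiberwise_of_maps_to (g := Finset.card) (t := Finset.range (G.indepNum + 1))]
  · refine Finset.sum_congr rfl fun k _ => ?_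
    have : G.indepSetSet k = ↑(((Finset.univ : Finset V).powerset.filter
        (fun T : Finset V => G.IsIndepSet (T : Set V))).filter (fun T => T.card = k)) := by
      ext T
      simp [mem_indepSetSet_iff, isNIndepSet_iff]
    rw [this, Set.ncard_coe_finset, Finset.sum_congr rfl (g := fun _ => (X : ℤ[X]) ^ k)]
    · simp
    · intro T hT; rw [(Finset.mem_filter.1 hT).2]
  · intro T hT
    exact Finset.mem_range_succ_iff.2 (IsIndepSet.card_le_indepNum (Finset.mem_filter.1 hT).2)

lemma aeval_indepPoly [Fintype V] (x : R) (G : SimpleGraph V) :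
    aeval x (indepPoly G) = indepSum x G Finset.univ := by
  rw [indepPoly_eq_indepSum]
  have := map_indepSum (aeval x : ℤ[X] →ₐ[ℤ] R).toRingHom X G Finset.univ
  simpa using this

end IndepSum

/-! ### The value at `-1/4` and positivity on `[-1/4, 0]`. -/

section Weight

variable {V W : Type*}

/-- The independence polynomial at `-1/4`, rescaled by `2` per vertex. -/
noncomputable def weight (G : SimpleGraph V) (S : Finset V) : ℝ :=
  2 ^ S.card * indepSum (-1 / 4 : ℝ) G S

/-- Here `s` is the size of the closed neighbourhood of `v` in `S`; the factor `2 ^ s` is the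
scaling lost in passing to `T`. -/
lemma weight_rec (G : SimpleGraph V) {S S' T : Finset V} {v : V} (hv : v ∈ S)
    (hS' : ∀ u, u ∈ S' ↔ u ∈ S ∧ u ≠ v) (hT : ∀ u, u ∈ T ↔ u ∈ S ∧ u ≠ v ∧ ¬ G.Adj v u)
    {s : ℕ} (hs : S.card = T.card + s) :
    weight G S = 2 * weight G S' - 2 ^ s / 4 * weight G T := by
  classical
  have hc : S.card = S'.card + 1 := by
    have : S' = S.erase v := by ext u; simp [hS', and_comm]
    rw [this, Finset.card_erase_add_one hv]
  unfold weight
  rw [indepSum_rec _ G hv hS' hT]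
  have h1 : (2 : ℝ) ^ S.card = 2 * 2 ^ S'.card := by rw [hc]; ring
  have h2 : (2 : ℝ) ^ S.card = 2 ^ s * 2 ^ T.card := by rw [hs]; ring
  rw [mul_add]
  nth_rw 1 [h1]
  rw [h2]; ring

/-- For a leaf the closed neighbourhood has two vertices and the coefficient `2 ^ 2 / 4` becomes 1.
This is why `-1/4` and the scaling by 2 are chosen: weights along a pendant path form an arithmetic
progression. -/
lemma weight_leaf (G : SimpleGraph V) {S S' T : Finset V} {v u : V} (hv : v ∈ S) (hu : u ∈ S)
    (hvu : G.Adj v u) (h : ∀ w ∈ S, G.Adj v w → w = u)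
    (hS' : ∀ w, w ∈ S' ↔ w ∈ S ∧ w ≠ v) (hT : ∀ w, w ∈ T ↔ w ∈ S ∧ w ≠ v ∧ w ≠ u) :
    weight G S = 2 * weight G S' - weight G T := by
  classical
  have hT' : T = (S.erase v).erase u := by ext w; simp [hT]; tauto
  rw [weight_rec G hv hS' (T := T) (s := 2)]
  · ring
  · intro w; rw [hT]
    constructor
    · rintro ⟨h1, h2, h3⟩; exact ⟨h1, h2, fun h4 => h3 (h w h1 h4)⟩
    · rintro ⟨h1, h2, h3⟩; exact ⟨h1, h2, fun h4 => h3 (h4 ▸ hvu)⟩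
  · have h1 := Finset.card_erase_add_one hv
    have h2 := Finset.card_erase_add_one (s := S.erase v) (a := u) (by simp [hu, hvu.ne'])
    rw [hT']; omega

lemma weight_isolated (G : SimpleGraph V) {S S' : Finset V} {v : V} (hv : v ∈ S)
    (h : ∀ w ∈ S, ¬ G.Adj v w) (hS' : ∀ w, w ∈ S' ↔ w ∈ S ∧ w ≠ v) :
    weight G S = 3 / 2 * weight G S' := by
  classical
  have hT' : S' = S.erase v := by ext w; simp [hS', and_comm]
  rw [weight_rec G hv hS' (T := S') (s := 1)]
  · ring
  · intro w; rw [hS']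
    constructor
    · rintro ⟨h1, h2⟩; exact ⟨h1, h2, h w h1⟩
    · rintro ⟨h1, h2, _⟩; exact ⟨h1, h2⟩
  · rw [hT', Finset.card_erase_add_one hv]

lemma weight_sup_edge {G : SimpleGraph V} {S T : Finset V} {a b : V} (ha : a ∈ S)
    (hb : b ∈ S) (hab : a ≠ b) (hG : ¬ G.Adj a b)
    (hT : ∀ u, u ∈ T ↔ u ∈ S ∧ u ≠ a ∧ u ≠ b ∧ ¬ G.Adj a u ∧ ¬ G.Adj b u) {s : ℕ}
    (hs : S.card = T.card + s) :
    weight (G ⊔ edge a b) S = weight G S - 2 ^ s / 16 * weight G T := by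
  unfold weight
  rw [indepSum_sup_edge _ ha hb hab hG hT, mul_sub]
  have h2 : (2 : ℝ) ^ S.card = 2 ^ s * 2 ^ T.card := by rw [hs]; ring
  congr 1
  rw [h2]; ring

lemma weight_bijOn {G : SimpleGraph V} {H : SimpleGraph W} {S : Finset V}
    {T : Finset W} (f : V → W) (hf : Set.BijOn f S T)
    (hadj : ∀ a ∈ S, ∀ b ∈ S, H.Adj (f a) (f b) ↔ G.Adj a b) :
    weight G S = weight H T := by
  classical
  have : S.card = T.card := by
    have h : T = S.image f := by
      apply Finset.coe_injective; simpa using hf.image_eq.symm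
    rw [h, Finset.card_image_of_injOn hf.injOn]
  rw [weight, weight, indepSum_bijOn _ f hf hadj, this]

lemma weight_iso [Fintype V] [Fintype W] {G : SimpleGraph V} {H : SimpleGraph W}
    (e : G ≃g H) : weight G Finset.univ = weight H Finset.univ :=
  weight_bijOn e (by simpa using e.bijective.bijOn_univ) (fun a _ b _ => e.map_rel_iff)

lemma weight_union [DecidableEq V] {G : SimpleGraph V} {S T : Finset V}
    (hd : Disjoint S T) (h : ∀ a ∈ S, ∀ b ∈ T, ¬ G.Adj a b) :
    weight G (S ∪ T) = weight G S * weight G T := by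
  rw [weight, weight, weight, indepSum_union _ hd h, Finset.card_union_of_disjoint hd]; ring

@[simp] lemma weight_empty (G : SimpleGraph V) : weight G ∅ = 1 := by simp [weight]

/-- `I(G[S], x)` has no zero in `[-1/4, 0]`. -/
def PositiveOn (G : SimpleGraph V) (S : Finset V) : Prop :=
  ∀ y : ℝ, 0 ≤ y → y ≤ 1 / 4 → 0 < indepSum (-y) G S

lemma PositiveOn.weight_pos {G : SimpleGraph V} {S : Finset V} (h : PositiveOn G S) :
    0 < weight G S := by
  have := h (1 / 4) (by norm_num) le_rfl
  unfold weight
  rw [show (-1 / 4 : ℝ) = -(1 / 4) by ring]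
  positivity

lemma indepSum_eq_aeval {R : Type*} [CommRing R] (x : R) (G : SimpleGraph V) (S : Finset V) :
    indepSum x G S = aeval x (indepSum (X : ℤ[X]) G S) := by
  have := map_indepSum (aeval x : ℤ[X] →ₐ[ℤ] R).toRingHom X G S
  simpa using this.symm

lemma continuous_indepSum (G : SimpleGraph V) (S : Finset V) :
    Continuous fun y : ℝ => indepSum (-y) G S := by
  have : (fun y : ℝ => indepSum (-y) G S) = fun y => aeval (-y) (indepSum (X : ℤ[X]) G S) := by
    funext y; exact indepSum_eq_aeval _ _ _
  rw [this]
  exact (Polynomial.continuous_aeval _).comp continuous_neg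

@[simp] lemma indepSum_zero {R : Type*} [CommRing R] (G : SimpleGraph V) (S : Finset V) :
    indepSum (0 : R) G S = 1 := by
  classical
  induction S using Finset.induction_on with
  | empty => simp
  | insert v S hv ih =>
    rw [indepSum_rec 0 G (S := insert v S) (v := v) (S' := S)
      (T := {u ∈ S | ¬ G.Adj v u}) (by simp), ih]
    · ring
    · intro u; have : u ∈ S → u ≠ v := fun h e => hv (e ▸ h)
      simp; tauto
    · intro u; have : u ∈ S → u ≠ v := fun h e => hv (e ▸ h)
      simp; tauto

/-- A continuous function, positive at the left end, that is positive wherever it is positive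
to the left, is positive. -/
lemma pos_of_pos_prefix {f : ℝ → ℝ} (hf : Continuous f) {c : ℝ} (h0 : 0 < f 0)
    (h : ∀ y, 0 ≤ y → y ≤ c → (∀ z, 0 ≤ z → z < y → 0 < f z) → f y ≠ 0) :
    ∀ y, 0 ≤ y → y ≤ c → 0 < f y := by
  by_contra! hcon
  obtain ⟨y, hy0, hyc, hfy⟩ := hcon
  set Z := {z : ℝ | z ∈ Set.Icc 0 y ∧ f z ≤ 0}
  have hZc : IsClosed Z := isClosed_Icc.inter (isClosed_le hf continuous_const)
  have hZn : Z.Nonempty := ⟨y, ⟨hy0, le_rfl⟩, hfy⟩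
  have hZb : BddBelow Z := ⟨0, fun z hz => hz.1.1⟩
  have hm := hZc.csInf_mem hZn hZb
  set m := sInf Z
  have hlt : ∀ z, 0 ≤ z → z < m → 0 < f z := by
    intro z hz hzm
    by_contra! hfz
    exact absurd (csInf_le hZb ⟨⟨hz, hzm.le.trans hm.1.2⟩, hfz⟩) (not_le.2 hzm)
  have hne := h m hm.1.1 (hm.1.2.trans hyc) hlt
  have hneg : f m < 0 := lt_of_le_of_ne hm.2 hne
  have hm0 : 0 < m := lt_of_le_of_ne hm.1.1 (fun e => by rw [← e] at hneg; linarith)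
  obtain ⟨z, hz, hfz⟩ := intermediate_value_Icc' hm.1.1 hf.continuousOn ⟨hneg.le, h0.le⟩
  rcases hz.2.lt_or_eq with hlt' | rfl
  · exact absurd hfz (hlt z hz.1 hlt').ne'
  · exact hne hfz

/-- Vertices are removed one at a time. At a first zero `-y` of the polynomial of `S.erase v`, the
recursion at `v` gives `I(S, -y) = -y * I(N, -y)`, where `N` consists of the non-neighbours of `v`.
The right side is at most 0, contradicting positivity on `S`. The bound `c` is quantified inside the
induction because the hypothesis is used on shorter intervals. -/
lemma pos_of_subset (G : SimpleGraph V) : ∀ (n : ℕ) (S : Finset V), S.card = n →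
    ∀ c : ℝ, (∀ y, 0 ≤ y → y ≤ c → 0 < indepSum (-y) G S) → ∀ T ⊆ S,
    ∀ y, 0 ≤ y → y ≤ c → 0 < indepSum (-y) G T := by
  classical
  intro n
  induction n with
  | zero =>
    intro S hS c h T hT
    rw [Finset.card_eq_zero] at hS
    subst hS
    rwa [Finset.subset_empty.1 hT]
  | succ n ih =>
    intro S hS c h T hT
    rcases eq_or_ne T S with rfl | hne
    · exact h
    obtain ⟨v, hvS, hvT⟩ := Finset.exists_of_ssubset (lt_of_le_of_ne hT hne)
    have hcard : (S.erase v).card = n := by rw [Finset.card_erase_of_mem hvS, hS]; rfl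
    refine ih (S.erase v) hcard c ?_ T (Finset.subset_erase.2 ⟨hT, hvT⟩)
    refine pos_of_pos_prefix (continuous_indepSum _ _) (by simp) ?_
    intro y hy0 hyc hpre hzero
    set N : Finset V := {u ∈ S.erase v | ¬ G.Adj v u}
    have hrec : ∀ z : ℝ, indepSum (-z) G S =
        indepSum (-z) G (S.erase v) + -z * indepSum (-z) G N := fun z =>
      indepSum_rec _ G hvS (by simp [and_comm]) (by intro u; simp [N]; tauto)
    -- Before `y` the set `S.erase v` is positive, so the induction hypothesis with bound `z < y`
    -- applies to `N`; continuity gives the weak inequality at `y` itself.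
    have hN : 0 ≤ y * indepSum (-y) G N := by
      rcases hy0.eq_or_lt with rfl | hy
      · simp
      refine mul_nonneg hy0 ?_
      have hlt : ∀ z ∈ Set.Ico 0 y, 0 ≤ indepSum (-z) G N := by
        intro z hz
        refine (ih (S.erase v) hcard z (fun w hw hwz => hpre w hw (hwz.trans_lt hz.2)) N
          (Finset.filter_subset _ _) z hz.1 le_rfl).le
      have hcl : IsClosed {z : ℝ | 0 ≤ indepSum (-z) G N} :=
        isClosed_le continuous_const (continuous_indepSum G N)
      have hsub : Set.Icc 0 y ⊆ {z : ℝ | 0 ≤ indepSum (-z) G N} := by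
        rw [← closure_Ico hy.ne]
        exact hcl.closure_subset_iff.2 hlt
      exact hsub ⟨hy0, le_rfl⟩
    have h1 := h y hy0 hyc
    rw [hrec, hzero] at h1
    linarith

lemma PositiveOn.mono {G : SimpleGraph V} {S T : Finset V} (h : PositiveOn G S) (hT : T ⊆ S) :
    PositiveOn G T :=
  pos_of_subset G _ S rfl (1 / 4) h T hT

/-- The polynomial of `G` exceeds that of `G ⊔ edge a b` by `x ^ 2` times the polynomial of `T`. On
`T` both graphs agree, so that term is nonnegative by monotonicity in the vertex set. -/
lemma PositiveOn.of_sup_edge {G : SimpleGraph V} {S : Finset V} {a b : V} (ha : a ∈ S)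
    (hb : b ∈ S) (hab : a ≠ b) (hG : ¬ G.Adj a b) (h : PositiveOn (G ⊔ edge a b) S) :
    PositiveOn G S := by
  classical
  intro y hy0 hy
  set T : Finset V := {u ∈ S | u ≠ a ∧ u ≠ b ∧ ¬ G.Adj a u ∧ ¬ G.Adj b u}
  have h1 := indepSum_sup_edge (-y) ha hb hab hG (T := T) (by simp [T])
  have h2 := h.mono (T := T) (Finset.filter_subset _ _) y hy0 hy
  have h3 := h y hy0 hy
  rw [← indepSum_congr (-y) (S := T) (G := G) (H := G ⊔ edge a b)] at h2
  · rw [h1] at h3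
    nlinarith [sq_nonneg y]
  · simp only [T, Finset.mem_filter, sup_adj, edge_adj]; rintro c ⟨_, hc⟩ d ⟨_, hd⟩; tauto

lemma PositiveOn.bijOn {G : SimpleGraph V} {H : SimpleGraph W} {S : Finset V}
    {T : Finset W} (h : PositiveOn H T) (f : V → W) (hf : Set.BijOn f S T)
    (hadj : ∀ a ∈ S, ∀ b ∈ S, H.Adj (f a) (f b) ↔ G.Adj a b) : PositiveOn G S := by
  intro y h0 h1
  rw [indepSum_bijOn _ f hf hadj]; exact h y h0 h1

lemma PositiveOn.embedding [Fintype V] [Fintype W] {G : SimpleGraph V} {H : SimpleGraph W}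
    (h : PositiveOn H Finset.univ) (f : G ↪g H) : PositiveOn G Finset.univ := by
  classical
  refine (h.mono (Finset.subset_univ (Finset.univ.image f))).bijOn f ?_ ?_
  · simpa using Set.injOn_univ.2 f.injective |>.bijOn_image
  · intro a _ b _; exact f.map_rel_iff

end Weight

/-! ### Additive invariants from the first coefficients. -/

section Coeff

variable {V W : Type*}

/-- Coefficient `k` of the independence polynomial of `G[S]`. -/
noncomputable def indepCoeff (G : SimpleGraph V) (S : Finset V) (k : ℕ) : ℤ :=
  (indepSum (X : ℤ[X]) G S).coeff k

@[simp] lemma indepCoeff_zero (G : SimpleGraph V) (S : Finset V) : indepCoeff G S 0 = 1 := by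
  have := indepSum_eq_aeval (0 : ℤ) G S
  rw [indepSum_zero] at this
  rw [indepCoeff, coeff_zero_eq_eval_zero, ← coe_aeval_eq_eval]; exact this.symm

lemma indepCoeff_rec (G : SimpleGraph V) {S S' T : Finset V} {v : V} (hv : v ∈ S)
    (hS' : ∀ u, u ∈ S' ↔ u ∈ S ∧ u ≠ v) (hT : ∀ u, u ∈ T ↔ u ∈ S ∧ u ≠ v ∧ ¬ G.Adj v u)
    (k : ℕ) : indepCoeff G S (k + 1) = indepCoeff G S' (k + 1) + indepCoeff G T k := by
  rw [indepCoeff, indepSum_rec _ G hv hS' hT, coeff_add, coeff_X_mul]; rfl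

@[simp] lemma indepCoeff_one (G : SimpleGraph V) (S : Finset V) : indepCoeff G S 1 = S.card := by
  classical
  induction S using Finset.induction_on with
  | empty => simp [indepCoeff, coeff_one]
  | insert v S hv ih =>
    rw [indepCoeff_rec G (S := insert v S) (v := v) (S' := S)
      (T := {u ∈ S | ¬ G.Adj v u}) (by simp), ih]
    · simp [hv]
    · intro u; have : u ∈ S → u ≠ v := fun h e => hv (e ▸ h)
      simp; tauto
    · intro u; have : u ∈ S → u ≠ v := fun h e => hv (e ▸ h)
      simp; tauto

/-- For an independence polynomial: twice the number of edges minus twice the number of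
vertices. -/
def excess (p : ℤ[X]) : ℤ := p.coeff 1 ^ 2 - 3 * p.coeff 1 - 2 * p.coeff 2

/-- For the independence polynomial of a graph with as many edges as vertices: six times
the difference of `∑ (d(v) - 2) ^ 2 / 2` and the number of triangles. -/
def defect (p : ℤ[X]) : ℤ :=
  6 * p.coeff 3 - p.coeff 1 * (p.coeff 1 - 1) * (p.coeff 1 - 2)
    + 3 * (p.coeff 1 ^ 2 - p.coeff 1 - 2 * p.coeff 2) * (p.coeff 1 - 5) + 12 * p.coeff 1

lemma coeff_mul_of_coeff_zero {p q : ℤ[X]} (hp : p.coeff 0 = 1) (hq : q.coeff 0 = 1) :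
    (p * q).coeff 1 = p.coeff 1 + q.coeff 1 ∧
    (p * q).coeff 2 = p.coeff 2 + p.coeff 1 * q.coeff 1 + q.coeff 2 ∧
    (p * q).coeff 3 = p.coeff 3 + p.coeff 2 * q.coeff 1 + p.coeff 1 * q.coeff 2 + q.coeff 3 := by
  simp only [coeff_mul, Finset.Nat.antidiagonal_succ, Finset.Nat.antidiagonal_zero]
  simp [hp, hq]
  refine ⟨?_, ?_, ?_⟩ <;> ring

lemma excess_mul {p q : ℤ[X]} (hp : p.coeff 0 = 1) (hq : q.coeff 0 = 1) :
    excess (p * q) = excess p + excess q := by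
  obtain ⟨h1, h2, _⟩ := coeff_mul_of_coeff_zero hp hq
  simp only [excess, h1, h2]; ring

lemma defect_mul {p q : ℤ[X]} (hp : p.coeff 0 = 1) (hq : q.coeff 0 = 1) :
    defect (p * q) = defect p + defect q := by
  obtain ⟨h1, h2, h3⟩ := coeff_mul_of_coeff_zero hp hq
  simp only [defect, h1, h2, h3]; ring

lemma excess_eq_sum_degree [Fintype V] (G : SimpleGraph V) [DecidableRel G.Adj] :
    excess (indepPoly G) = ∑ v, ((G.degree v : ℤ) - 2) := by
  classical
  have key : ∀ S : Finset V, (indepCoeff G S 1) ^ 2 - 3 * indepCoeff G S 1 - 2 * indepCoeff G S 2 =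
      ∑ v ∈ S, ((∑ u ∈ S, if G.Adj v u then (1 : ℤ) else 0) - 2) := by
    intro S
    induction S using Finset.induction_on with
    | empty => simp [indepCoeff, coeff_one]
    | insert v S hv ih =>
      have h2 := indepCoeff_rec G (S := insert v S) (v := v) (S' := S)
        (T := {u ∈ S | ¬ G.Adj v u}) (by simp)
        (by intro u; have : u ∈ S → u ≠ v := fun h e => hv (e ▸ h)
            simp; tauto)
        (by intro u; have : u ∈ S → u ≠ v := fun h e => hv (e ▸ h)
            simp; tauto) 1
      simp only [indepCoeff_one] at ih h2 ⊢
      have h3 : (S.card : ℤ) = ({u ∈ S | ¬ G.Adj v u} : Finset V).card +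
          ∑ u ∈ S, if G.Adj v u then (1 : ℤ) else 0 := by
        rw [← Finset.card_filter_add_card_filter_not (s := S) (fun u => G.Adj v u)]
        simp [add_comm]
      have h4 : ∑ w ∈ S, ((∑ u ∈ insert v S, if G.Adj w u then (1 : ℤ) else 0) - 2) =
          ∑ w ∈ S, ((∑ u ∈ S, if G.Adj w u then (1 : ℤ) else 0) - 2) +
          ∑ u ∈ S, if G.Adj v u then (1 : ℤ) else 0 := by
        rw [← Finset.sum_add_distrib]
        refine Finset.sum_congr rfl fun w _ => ?_
        rw [Finset.sum_insert hv]; simp only [G.adj_comm w v]; ring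
      rw [Finset.sum_insert hv, h4, Finset.sum_insert hv, ← ih, h2, Finset.card_insert_of_notMem hv]
      push_cast
      rw [if_neg (G.loopless.irrefl v)]
      linear_combination 2 * h3
  have := key Finset.univ
  simp only [indepCoeff, ← indepPoly_eq_indepSum] at this
  rw [excess, this]
  refine Finset.sum_congr rfl fun v _ => ?_
  rw [← G.card_neighborFinset_eq_degree, neighborFinset_eq_filter]
  simp

end Coeff

/-! ### The common polynomial of `C_n` and `D_n`. -/

section Tail

/-- The infinite graph with a triangle `0, 1, 2` and the ray `2, 3, 4, …`. -/
def tailGraph : SimpleGraph ℕ :=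
  SimpleGraph.fromRel fun u v => u + 1 = v ∨ (u = 0 ∧ v = 2)

lemma tailGraph_adj {u v : ℕ} : tailGraph.Adj u v ↔
    u + 1 = v ∨ v + 1 = u ∨ (u = 0 ∧ v = 2) ∨ (v = 0 ∧ u = 2) := by
  simp only [tailGraph, fromRel_adj]; omega

lemma dGraph_adj {n : ℕ} {u v : Fin n} : (dGraph n).Adj u v ↔ tailGraph.Adj u v := by
  simp only [dGraph, fromRel_adj, tailGraph_adj, Fin.ext_iff, ne_eq]; omega

variable {R : Type*} [CommRing R]

lemma indepSum_dGraph (x : R) {n : ℕ} {S : Finset (Fin n)} {T : Finset ℕ}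
    (h : ∀ i : ℕ, i ∈ T ↔ ∃ hi : i < n, (⟨i, hi⟩ : Fin n) ∈ S) :
    indepSum x (dGraph n) S = indepSum x tailGraph T := by
  refine indepSum_bijOn x Fin.val ⟨?_, Fin.val_injective.injOn, ?_⟩ (fun a _ b _ => dGraph_adj.symm)
  · intro a ha; exact (h _).2 ⟨a.2, ha⟩
  · intro i hi; obtain ⟨h1, h2⟩ := (h i).1 hi; exact ⟨_, h2, rfl⟩

lemma weight_dGraph {n : ℕ} {S : Finset (Fin n)} {T : Finset ℕ}
    (h : ∀ i : ℕ, i ∈ T ↔ ∃ hi : i < n, (⟨i, hi⟩ : Fin n) ∈ S) :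
    weight (dGraph n) S = weight tailGraph T := by
  refine weight_bijOn Fin.val ⟨?_, Fin.val_injective.injOn, ?_⟩ (fun a _ b _ => dGraph_adj.symm)
  · intro a ha; exact (h _).2 ⟨a.2, ha⟩
  · intro i hi; obtain ⟨h1, h2⟩ := (h i).1 hi; exact ⟨_, h2, rfl⟩

/-- The common independence polynomial of `cycleGraph n` and `dGraph n`. -/
noncomputable def cyclePoly (x : R) (n : ℕ) : R := indepSum x tailGraph (Finset.range n)

lemma indepSum_dGraph_univ (x : R) (n : ℕ) :
    indepSum x (dGraph n) Finset.univ = cyclePoly x n :=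
  indepSum_dGraph x (by simp)

lemma cyclePoly_two (x : R) : cyclePoly x 2 = 1 + 2 * x := by
  rw [cyclePoly, indepSum_rec x tailGraph (v := 0) (S' := {1}) (T := ∅) (by simp)
    (by intro u; simp; omega) (by intro u; simp [tailGraph_adj]; omega)]
  simp [indepSum_singleton]; ring

lemma cyclePoly_three (x : R) : cyclePoly x 3 = 1 + 3 * x := by
  rw [cyclePoly, indepSum_rec x tailGraph (v := 2) (S' := Finset.range 2) (T := ∅) (by simp)
    (by intro u; simp; omega) (by intro u; simp [tailGraph_adj]; omega), ← cyclePoly, cyclePoly_two]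
  simp; ring

/-- The recursion at the end vertex `n + 1` of the tail. The bound is needed: vertex 2 lies in the
triangle, so the end vertex is a leaf only from 3 on. -/
lemma cyclePoly_add_two (x : R) {n : ℕ} (hn : 2 ≤ n) :
    cyclePoly x (n + 2) = cyclePoly x (n + 1) + x * cyclePoly x n := by
  rw [cyclePoly, indepSum_rec x tailGraph (v := n + 1) (S' := Finset.range (n + 1))
    (T := Finset.range n) (by simp)
    (by intro u; simp; omega) (by intro u; simp [tailGraph_adj]; omega)]; rfl

lemma indepSum_tail_shift (x : R) {a b c d : ℕ} (ha : 1 ≤ a) (hc : 1 ≤ c) (h : a + d = b + c) :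
    indepSum x tailGraph (Finset.Ico a b) = indepSum x tailGraph (Finset.Ico c d) := by
  refine indepSum_bijOn x (fun i => i + c - a) ⟨?_, ?_, ?_⟩ ?_
  · intro i hi; simp at hi ⊢; omega
  · intro i hi j hj hij; simp at hi hj hij; omega
  · intro j hj; simp at hj; exact ⟨j + a - c, by simp; omega, by simp; omega⟩
  · intro i hi j hj; simp at hi hj; simp only [tailGraph_adj]; omega

lemma cyclePoly_eq (x : R) {n : ℕ} (hn : 3 ≤ n) :
    cyclePoly x n = indepSum x tailGraph (Finset.Ico 1 n) +
      x * indepSum x tailGraph (Finset.Ico 3 n) := by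
  rw [cyclePoly]
  exact indepSum_rec x tailGraph (v := 0) (by simp; omega) (by intro u; simp; omega)
    (by intro u; simp [tailGraph_adj]; omega)

lemma cycleGraph_adj_val {n : ℕ} {u v : Fin n} : (cycleGraph n).Adj u v ↔
    1 < n ∧ (u.val + 1 = v.val ∨ v.val + 1 = u.val ∨ (u.val = 0 ∧ v.val + 1 = n) ∨
      (v.val = 0 ∧ u.val + 1 = n)) := by
  rw [cycleGraph_adj']
  have h1 := u.2
  have h2 := v.2
  simp only [Fin.sub_def]
  rcases lt_or_ge u.val v.val with h | h
  · rw [Nat.mod_eq_of_lt (a := n - v.val + u.val) (by omega)]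
    rw [show n - u.val + v.val = (v.val - u.val) + n by omega, Nat.add_mod_right,
      Nat.mod_eq_of_lt (by omega)]
    omega
  · rw [show n - v.val + u.val = (u.val - v.val) + n by omega, Nat.add_mod_right,
      Nat.mod_eq_of_lt (a := u.val - v.val) (by omega)]
    rcases h.eq_or_lt with h | h
    · rw [show n - u.val + v.val = 0 + n by omega, Nat.add_mod_right, Nat.zero_mod]; omega
    · rw [Nat.mod_eq_of_lt (by omega)]; omega

lemma bijOn_cycle_tail {n a b : ℕ} {S : Finset (Fin n)}
    (hS : ∀ i : Fin n, i ∈ S ↔ a ≤ i.val ∧ i.val < b) (hb : b ≤ n) :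
    Set.BijOn (Fin.val : Fin n → ℕ) S (Finset.Ico a b) := by
  refine ⟨?_, Fin.val_injective.injOn, ?_⟩
  · intro i hi; simpa using (hS i).1 hi
  · intro i hi
    simp at hi
    exact ⟨⟨i, by omega⟩, (hS _).2 hi, rfl⟩

/-- Deleting vertex 0 leaves a path on `n - 1` vertices in both `C_n` and `D_n`, and deleting its
closed neighbourhood leaves a path on `n - 3` vertices in both. Hence the polynomials agree. -/
lemma indepSum_cycleGraph (x : R) {n : ℕ} (hn : 3 ≤ n) :
    indepSum x (cycleGraph n) Finset.univ = cyclePoly x n := by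
  classical
  rw [cyclePoly_eq x hn, indepSum_rec x (cycleGraph n) (v := ⟨0, by omega⟩)
    (S' := {i | 1 ≤ i.val ∧ i.val < n}) (T := {i | 2 ≤ i.val ∧ i.val < n - 1}) (by simp)
    (by intro u; simp [Fin.ext_iff]; omega)
    (by intro u; simp [Fin.ext_iff, cycleGraph_adj_val]; omega),
    indepSum_tail_shift x (a := 3) (c := 2) (b := n) (d := n - 1) (by omega) (by omega) (by omega)]
  congr 1
  · refine indepSum_bijOn x _ (bijOn_cycle_tail (by simp) le_rfl) ?_
    intro i hi j hj; simp at hi hj; simp only [tailGraph_adj, cycleGraph_adj_val]; omega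
  · congr 1
    refine indepSum_bijOn x _ (bijOn_cycle_tail (by simp) (by omega)) ?_
    intro i hi j hj; simp at hi hj; simp only [tailGraph_adj, cycleGraph_adj_val]; omega

lemma indepPoly_cycleGraph {n : ℕ} (hn : 3 ≤ n) : indepPoly (cycleGraph n) = cyclePoly X n := by
  rw [indepPoly_eq_indepSum, indepSum_cycleGraph _ hn]

lemma indepPoly_dGraph (n : ℕ) : indepPoly (dGraph n) = cyclePoly X n := by
  rw [indepPoly_eq_indepSum, indepSum_dGraph_univ]

/-! ### Weights -/

/-- The recursion `w = 2w' - w''` starts with the values 2 and 2 at `n = 2, 3` and therefore stays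
constant. -/
lemma weight_tail_range {n : ℕ} (hn : 2 ≤ n) : weight tailGraph (Finset.range n) = 2 := by
  have key : ∀ m, 2 ^ (m + 2) * cyclePoly (-1 / 4 : ℝ) (m + 2) = 2 ∧
      2 ^ (m + 3) * cyclePoly (-1 / 4 : ℝ) (m + 3) = 2 := by
    intro m
    induction m with
    | zero => simp only [zero_add, cyclePoly_two, cyclePoly_three]; norm_num
    | succ m ih =>
      refine ⟨ih.2, ?_⟩
      rw [show m + 1 + 3 = (m + 2) + 2 by ring, cyclePoly_add_two _ (by omega)]
      rw [show m + 2 + 2 = m + 4 by ring, show m + 2 + 1 = m + 3 by ring]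
      ring_nf at ih ⊢
      linarith
  obtain ⟨m, rfl⟩ := Nat.exists_eq_add_of_le' hn
  rw [weight, Finset.card_range]
  exact (key m).1

/-- A path on `l` vertices. The linear growth is what rules out attaching a leaf to a vertex whose
removal leaves a long path. -/
lemma weight_tail_Ico {a : ℕ} (ha : 1 ≤ a) (l : ℕ) :
    weight tailGraph (Finset.Ico a (a + l)) = (l + 2) / 2 := by
  induction l using Nat.strong_induction_on with
  | _ l ih =>
  match l with
  | 0 => simp
  | 1 =>
    rw [weight_isolated tailGraph (v := a) (S' := ∅) (by simp)
      (by intro w hw; simp at hw; simp [tailGraph_adj]; omega) (by intro w; simp)]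
    simp; norm_num
  | l + 2 =>
    rw [weight_leaf tailGraph (v := a + l + 1) (u := a + l) (S' := Finset.Ico a (a + (l + 1)))
      (T := Finset.Ico a (a + l)) (by simp; omega) (by simp)
      (by simp [tailGraph_adj])
      (by intro w hw; simp at hw; simp [tailGraph_adj]; omega)
      (by intro w; simp; omega) (by intro w; simp; omega),
      ih (l + 1) (by omega), ih l (by omega)]
    push_cast; ring

/-- Removing the largest vertex never increases the weight. If that vertex is a leaf, then `w(S) = 2
w(S') - w(T)` with `w(T) ≤ w(S')` by induction, so `w(S) ≥ w(S')`; an isolated vertex multiplies by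
`3/2`. The induction therefore carries the monotonicity along with the bound. -/
lemma one_le_weight_tail (S : Finset ℕ) : 1 ≤ weight tailGraph S := by
  have key : ∀ n, ∀ S : Finset ℕ, (∀ i ∈ S, i < n) → 1 ≤ weight tailGraph S ∧
      weight tailGraph (S.filter (· + 1 < n)) ≤ weight tailGraph S := by
    intro n
    induction n with
    | zero =>
      intro S hS
      obtain rfl : S = ∅ := Finset.eq_empty_of_forall_notMem fun i hi => by simpa using hS i hi
      simp
    | succ n ih =>
      intro S hS
      simp only [Nat.add_lt_add_iff_right]
      by_cases hn : n ∈ S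
      swap
      · have hS' : ∀ i ∈ S, i < n := fun i hi =>
          lt_of_le_of_ne (Nat.lt_succ_iff.1 (hS i hi)) (fun h => hn (h ▸ hi))
        rw [Finset.filter_true_of_mem hS']
        exact ⟨(ih S hS').1, le_rfl⟩
      set S' := S.filter (· < n)
      have hS' : ∀ w, w ∈ S' ↔ w ∈ S ∧ w ≠ n := by
        intro w; simp only [S', Finset.mem_filter]
        constructor
        · rintro ⟨h, h'⟩; exact ⟨h, by omega⟩
        · rintro ⟨h, h'⟩; have := hS w h; exact ⟨h, by omega⟩
      obtain ⟨h1, h2⟩ := ih S' (fun i hi => (Finset.mem_filter.1 hi).2)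
      suffices weight tailGraph S' ≤ weight tailGraph S from ⟨h1.trans this, this⟩
      by_cases hn2 : n = 2
      · subst hn2
        by_cases h0 : 0 ∈ S <;> by_cases h1' : 1 ∈ S
        · have e2 : S' = Finset.range 2 := by
            ext w; rw [hS', Finset.mem_range]
            constructor
            · rintro ⟨h, h'⟩; have := hS w h; omega
            · intro h; interval_cases w <;> simp [h0, h1']
          have e3 : S = Finset.range 3 := by
            ext w; rw [Finset.mem_range]
            constructor
            · exact hS w
            · intro h; interval_cases w <;> assumption
          rw [e2, e3, weight_tail_range le_rfl, weight_tail_range (by norm_num)]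
        all_goals
          have hle : weight tailGraph (S'.filter (· + 1 < 1)) ≤ weight tailGraph S' := by
            simp; linarith
        · have hSe : ∀ w, w ∈ S' ↔ w = 0 := by
            intro w; rw [hS']
            constructor
            · rintro ⟨h, h'⟩; have := hS w h
              interval_cases w <;> simp_all
            · rintro rfl; simp [h0]
          rw [weight_leaf tailGraph hn h0 (by simp [tailGraph_adj]) (S' := S') (T := ∅) ?_ hS' ?_]
          · simp; linarith
          · intro w hw _
            by_contra h
            exact h ((hSe w).1 ((hS' w).2 ⟨hw, by rintro rfl; simp_all⟩))
          · intro w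
            have := hSe w
            have := hS' w
            simp; tauto
        · have hSe : ∀ w, w ∈ S' ↔ w = 1 := by
            intro w; rw [hS']
            constructor
            · rintro ⟨h, h'⟩; have := hS w h
              interval_cases w <;> simp_all
            · rintro rfl; simp [h1']
          rw [weight_leaf tailGraph hn h1' (by simp [tailGraph_adj]) (S' := S') (T := ∅) ?_ hS' ?_]
          · simp; linarith
          · intro w hw _
            by_contra h
            exact h ((hSe w).1 ((hS' w).2 ⟨hw, by rintro rfl; simp_all⟩))
          · intro w
            have := hSe w
            have := hS' w
            simp; tauto
        · rw [weight_isolated tailGraph hn (S' := S') ?_ hS']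
          · linarith
          · intro w hw
            have := hS w hw
            interval_cases w <;> simp_all
      · by_cases hp : ∃ m ∈ S, m + 1 = n
        · obtain ⟨m, hm, rfl⟩ := hp
          rw [weight_leaf tailGraph hn hm (by simp [tailGraph_adj]) (S' := S')
            (T := S'.filter (· + 1 < m + 1)) ?_ hS' ?_]
          · linarith
          · intro w hw; have := hS w hw; simp [tailGraph_adj]; omega
          · intro w
            have := hS' w
            have h3 := hS w
            simp only [Finset.mem_filter, this]
            constructor
            · rintro ⟨⟨h, _⟩, _⟩; exact ⟨h, by omega, by omega⟩
            · rintro ⟨h, _, _⟩; have := h3 h; exact ⟨⟨h, by omega⟩, by omega⟩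
        · rw [weight_isolated tailGraph hn (S' := S') ?_ hS']
          · linarith
          · intro w hw h
            have := hS w hw
            rw [tailGraph_adj] at h
            exact hp ⟨w, hw, by omega⟩
  exact (key (S.sup id + 1) S fun i hi => Nat.lt_succ_of_le (Finset.le_sup (f := id) hi)).1

/-- Consecutive values keep a ratio of at least `1/2`: from `c' ≥ c / 2` and `y ≤ 1/4` follows `c' -
y c ≥ c' - c' / 2 = c' / 2`. -/
lemma positiveOn_tail_range {n : ℕ} (hn : 2 ≤ n) : PositiveOn tailGraph (Finset.range n) := by
  intro y h0 h1
  have key : ∀ m, 0 < cyclePoly (-y) (m + 2) ∧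
      1 / 2 * cyclePoly (-y) (m + 2) ≤ cyclePoly (-y) (m + 3) := by
    intro m
    induction m with
    | zero => simp only [zero_add, cyclePoly_two, cyclePoly_three]; constructor <;> linarith
    | succ m ih =>
      have hpos : 0 < cyclePoly (-y) (m + 3) := by linarith [ih.1]
      refine ⟨hpos, ?_⟩
      have h4 := cyclePoly_add_two (-y) (n := m + 2) (by omega)
      have h5 : 0 ≤ (1 / 4 - y) * cyclePoly (-y) (m + 2) := mul_nonneg (by linarith) ih.1.le
      have e1 : m + 1 + 3 = m + 2 + 2 := by ring
      have e2 : m + 1 + 2 = m + 3 := by ring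
      rw [e1, e2, h4, show m + 2 + 1 = m + 3 by ring]
      linarith [ih.2]
  obtain ⟨m, rfl⟩ := Nat.exists_eq_add_of_le' hn
  exact (key m).1

/-! ### Coefficients -/

lemma cyclePoly_coeff {n : ℕ} (hn : 4 ≤ n) :
    (cyclePoly (X : ℤ[X]) n).coeff 0 = 1 ∧ (cyclePoly (X : ℤ[X]) n).coeff 1 = n ∧
    2 * (cyclePoly (X : ℤ[X]) n).coeff 2 = n * (n - 3) ∧
    6 * (cyclePoly (X : ℤ[X]) n).coeff 3 = n * (n - 4) * (n - 5) := by
  have key : ∀ m : ℕ, ∀ n : ℕ, (n = m + 4 ∨ n = m + 5) →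
    (cyclePoly (X : ℤ[X]) n).coeff 0 = 1 ∧ (cyclePoly (X : ℤ[X]) n).coeff 1 = n ∧
    2 * (cyclePoly (X : ℤ[X]) n).coeff 2 = n * (n - 3) ∧
    6 * (cyclePoly (X : ℤ[X]) n).coeff 3 = n * (n - 4) * (n - 5) := by
    intro m
    induction m with
    | zero =>
      have e4 : cyclePoly (X : ℤ[X]) 4 = C 1 + C 4 * X + C 2 * X ^ 2 := by
        rw [cyclePoly_add_two _ le_rfl, cyclePoly_two, cyclePoly_three]
        simp only [map_ofNat, map_one]; ring
      have e5 : cyclePoly (X : ℤ[X]) 5 = C 1 + C 5 * X + C 5 * X ^ 2 := by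
        rw [cyclePoly_add_two _ (by norm_num), e4, cyclePoly_three]
        simp only [map_ofNat, map_one]; ring
      rintro n (rfl | rfl)
      · simp only [zero_add, e4, coeff_add, coeff_C_mul, coeff_X_pow, coeff_X, coeff_C]
        norm_num
      · simp only [zero_add, e5, coeff_add, coeff_C_mul, coeff_X_pow, coeff_X, coeff_C]
        norm_num
    | succ m ih =>
      rintro n (rfl | rfl)
      · exact ih _ (Or.inr (by ring))
      · obtain ⟨a0, a1, a2, a3⟩ := ih (m + 4) (Or.inl rfl)
        obtain ⟨b0, b1, b2, b3⟩ := ih (m + 5) (Or.inr rfl)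
        rw [show m + 1 + 5 = m + 4 + 2 by ring, cyclePoly_add_two _ (by omega)]
        simp only [coeff_add, coeff_X_mul, mul_coeff_zero, coeff_X_zero]
        rw [show m + 4 + 1 = m + 5 by ring]
        push_cast at *
        refine ⟨by rw [b0]; ring, by rw [a0, b1]; ring, ?_, ?_⟩
        · rw [mul_add, b2, a1]; ring
        · rw [mul_add, b3]; linear_combination 3 * a2
  exact key (n - 4) n (Or.inl (by omega))

lemma excess_cyclePoly {n : ℕ} (hn : 3 ≤ n) : excess (cyclePoly X n) = 0 := by
  rcases hn.eq_or_lt with rfl | hn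
  · have e3 : cyclePoly (X : ℤ[X]) 3 = C 1 + C 3 * X := by
      rw [cyclePoly_three]; simp only [map_ofNat, map_one]
    simp [excess, e3, coeff_C, -eq_intCast, -map_one]
  · obtain ⟨_, h1, h2, h3⟩ := cyclePoly_coeff hn
    rw [excess, h1, h2]; ring

lemma defect_cyclePoly_three : defect (cyclePoly X 3) = -6 := by
  have e3 : cyclePoly (X : ℤ[X]) 3 = C 1 + C 3 * X := by
    rw [cyclePoly_three]; simp only [map_ofNat, map_one]
  simp [defect, e3, coeff_C, -eq_intCast, -map_one]

lemma defect_cyclePoly {n : ℕ} (hn : 4 ≤ n) : defect (cyclePoly X n) = 0 := by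
  obtain ⟨_, h1, h2, h3⟩ := cyclePoly_coeff hn
  rw [defect, h1, h2, h3]; ring

end Tail

/-! ### Kernel-computable polynomials of concrete graphs. -/

section Compute

/-- Coefficients of the independence polynomial of the graph with the given adjacency test on
the vertices in a list, for a list of length at most the first argument. -/
def coeffList {α : Type*} (adj : α → α → Bool) : ℕ → List α → List ℤ
  | 0, _ => [1]
  | _ + 1, [] => [1]
  | k + 1, v :: l => addCoeffs (coeffList adj k l)
      (0 :: coeffList adj k (l.filter fun u => !adj v u))
where
  /-- Coefficientwise sum of two lists. -/
  addCoeffs : List ℤ → List ℤ → List ℤ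
    | [], l => l
    | a :: l, [] => a :: l
    | a :: l, b :: m => (a + b) :: addCoeffs l m

/-- The polynomial with the given list of coefficients, evaluated at `x`. -/
def evalCoeffs {R : Type*} [CommRing R] (x : R) : List ℤ → R
  | [] => 0
  | a :: l => a + x * evalCoeffs x l

lemma evalCoeffs_add {R : Type*} [CommRing R] (x : R) (l m : List ℤ) :
    evalCoeffs x (coeffList.addCoeffs l m) = evalCoeffs x l + evalCoeffs x m := by
  induction l generalizing m with
  | nil => simp [coeffList.addCoeffs, evalCoeffs]
  | cons a l ih =>
    cases m with
    | nil => simp [coeffList.addCoeffs, evalCoeffs]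
    | cons b m => simp only [coeffList.addCoeffs, evalCoeffs, ih]; push_cast; ring

lemma evalCoeffs_coeffList {α R : Type*} [CommRing R] [DecidableEq α] (x : R)
    {G : SimpleGraph α} {adj : α → α → Bool} (h : ∀ a b, G.Adj a b ↔ adj a b = true) (k : ℕ)
    (l : List α) (hl : l.Nodup) (hk : l.length ≤ k) :
    indepSum x G l.toFinset = evalCoeffs x (coeffList adj k l) := by
  induction k generalizing l with
  | zero =>
    obtain rfl : l = [] := by simpa using hk
    simp [coeffList, evalCoeffs]
  | succ k ih =>
    cases l with
    | nil => simp [coeffList, evalCoeffs]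
    | cons v l =>
      rw [List.nodup_cons] at hl
      simp only [List.length_cons, Nat.add_le_add_iff_right] at hk
      have hne : ∀ u, u ∈ l → u ≠ v := fun u hu e => hl.1 (e ▸ hu)
      rw [indepSum_rec x G (v := v) (S' := l.toFinset)
        (T := (l.filter fun u => !adj v u).toFinset) (by simp), ih l hl.2 hk,
        ih _ (hl.2.filter _) ((List.length_filter_le _ _).trans hk)]
      · simp [coeffList, evalCoeffs_add, evalCoeffs]
      · intro u; have := hne u; simp; tauto
      · intro u; have := hne u; have := h v u; simp only [List.mem_toFinset, List.mem_filter]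
        rw [this]; simp; tauto

/-- `weight` computed from a list of the vertices. -/
def weightList {α : Type*} (G : SimpleGraph α) [DecidableRel G.Adj] (l : List α) : ℚ :=
  2 ^ l.length * evalCoeffs (-1 / 4 : ℚ) (coeffList (fun a b => decide (G.Adj a b)) l.length l)

lemma weight_eq_weightList {α : Type*} [DecidableEq α]
    {G : SimpleGraph α} [DecidableRel G.Adj] (l : List α) (hl : l.Nodup) {S : Finset α}
    (hS : l.toFinset = S) : weight G S = (weightList G l : ℝ) := by
  have h := evalCoeffs_coeffList (-1 / 4 : ℚ) (G := G)
    (adj := fun a b => decide (G.Adj a b)) (by simp) l.length l hl le_rfl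
  rw [weightList, ← h, weight, ← hS, List.toFinset_card_of_nodup hl]
  have := map_indepSum (algebraMap ℚ ℝ) (-1 / 4) G l.toFinset
  simp only [eq_ratCast] at this
  push_cast at this ⊢
  rw [this]

lemma weight_univ_eq_weightList {n : ℕ} (G : SimpleGraph (Fin n)) [DecidableRel G.Adj] :
    weight G Finset.univ = (weightList G (List.finRange n) : ℝ) :=
  weight_eq_weightList _ (List.nodup_finRange n) (by ext; simp)

lemma weight_erase_eq_weightList {n : ℕ} (G : SimpleGraph (Fin n)) [DecidableRel G.Adj]
    (w : Fin n) : weight G (Finset.univ.erase w) =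
      (weightList G ((List.finRange n).filter (· ≠ w)) : ℝ) :=
  weight_eq_weightList _ ((List.nodup_finRange n).filter _) (by ext; simp)

lemma indepPoly_eq_coeffList {n : ℕ} (G : SimpleGraph (Fin n)) [DecidableRel G.Adj] :
    indepPoly G = evalCoeffs X
      (coeffList (fun a b => decide (G.Adj a b)) n (List.finRange n)) := by
  rw [indepPoly_eq_indepSum, ← evalCoeffs_coeffList X (G := G)
    (adj := fun a b => decide (G.Adj a b)) (by simp) n _ (List.nodup_finRange n) (by simp)]
  congr 1; ext; simp

end Compute

/-! ### Concrete graphs and decidability of their adjacency. -/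

section Graphs

/-- The graph on `Fin n` with the given list of edges. -/
def listGraph (n : ℕ) (l : List (ℕ × ℕ)) : SimpleGraph (Fin n) :=
  SimpleGraph.fromRel fun u v => (u.val, v.val) ∈ l

instance (n : ℕ) (l : List (ℕ × ℕ)) : DecidableRel (listGraph n l).Adj :=
  fun a b => inferInstanceAs (Decidable (a ≠ b ∧ (_ ∈ l ∨ _ ∈ l)))

/-- The complete graph on four vertices without an edge. -/
def diamond : SimpleGraph (Fin 4) := listGraph 4 [(0, 1), (1, 2), (2, 3), (0, 3), (0, 2)]

/-- A triangle with pendant vertices at two of its vertices. -/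
def bull : SimpleGraph (Fin 5) := listGraph 5 [(0, 1), (1, 2), (1, 3), (2, 3), (3, 4)]

/-- A 4-cycle with a pendant vertex. -/
def banner : SimpleGraph (Fin 5) := listGraph 5 [(0, 1), (0, 2), (1, 3), (2, 3), (3, 4)]

instance : DecidableRel diamond.Adj := inferInstanceAs (DecidableRel (listGraph _ _).Adj)
instance : DecidableRel bull.Adj := inferInstanceAs (DecidableRel (listGraph _ _).Adj)
instance : DecidableRel banner.Adj := inferInstanceAs (DecidableRel (listGraph _ _).Adj)

instance (n : ℕ) : DecidableRel (dGraph n).Adj :=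
  fun a b => inferInstanceAs (Decidable (a ≠ b ∧ ((_ ∨ _ ∧ _) ∨ (_ ∨ _ ∧ _))))

lemma graphA_eq : graphA = listGraph 6 [(0, 1), (1, 2), (1, 3), (2, 3), (3, 4), (4, 5)] := by
  ext a b; simp only [graphA, listGraph, fromEdgeSet_adj, fromRel_adj, Set.mem_insert_iff,
    Set.mem_singleton_iff, Sym2.eq_iff]
  revert a b; decide +kernel
lemma graphB_eq : graphB = listGraph 6 [(0, 1), (0, 2), (1, 3), (2, 3), (3, 4), (4, 5)] := by
  ext a b; simp only [graphB, listGraph, fromEdgeSet_adj, fromRel_adj, Set.mem_insert_iff,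
    Set.mem_singleton_iff, Sym2.eq_iff]
  revert a b; decide +kernel
lemma graphC_eq : graphC = listGraph 6 [(0, 1), (0, 2), (1, 3), (2, 4), (3, 4), (4, 5)] := by
  ext a b; simp only [graphC, listGraph, fromEdgeSet_adj, fromRel_adj, Set.mem_insert_iff,
    Set.mem_singleton_iff, Sym2.eq_iff]
  revert a b; decide +kernel
lemma graphD_eq : graphD = listGraph 6 [(0, 1), (0, 2), (1, 2), (2, 3), (3, 4), (3, 5)] := by
  ext a b; simp only [graphD, listGraph, fromEdgeSet_adj, fromRel_adj, Set.mem_insert_iff,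
    Set.mem_singleton_iff, Sym2.eq_iff]
  revert a b; decide +kernel
lemma graphA'_eq :
    graphA' = listGraph 7 [(0, 1), (1, 2), (1, 3), (2, 3), (3, 4), (4, 5), (5, 6)] := by
  ext a b; simp only [graphA', listGraph, fromEdgeSet_adj, fromRel_adj, Set.mem_insert_iff,
    Set.mem_singleton_iff, Sym2.eq_iff]
  revert a b; decide +kernel
lemma graphB'_eq :
    graphB' = listGraph 7 [(0, 1), (0, 2), (1, 3), (2, 3), (3, 4), (4, 5), (5, 6)] := by
  ext a b; simp only [graphB', listGraph, fromEdgeSet_adj, fromRel_adj, Set.mem_insert_iff,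
    Set.mem_singleton_iff, Sym2.eq_iff]
  revert a b; decide +kernel
lemma graphC'_eq :
    graphC' = listGraph 7 [(0, 1), (0, 2), (1, 3), (2, 4), (3, 5), (4, 5), (5, 6)] := by
  ext a b; simp only [graphC', listGraph, fromEdgeSet_adj, fromRel_adj, Set.mem_insert_iff,
    Set.mem_singleton_iff, Sym2.eq_iff]
  revert a b; decide +kernel

instance : DecidableRel graphA.Adj := fun a b =>
  decidable_of_iff _ (by rw [graphA_eq] : (listGraph _ _).Adj a b ↔ graphA.Adj a b)
instance : DecidableRel graphB.Adj := fun a b =>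
  decidable_of_iff _ (by rw [graphB_eq] : (listGraph _ _).Adj a b ↔ graphB.Adj a b)
instance : DecidableRel graphC.Adj := fun a b =>
  decidable_of_iff _ (by rw [graphC_eq] : (listGraph _ _).Adj a b ↔ graphC.Adj a b)
instance : DecidableRel graphD.Adj := fun a b =>
  decidable_of_iff _ (by rw [graphD_eq] : (listGraph _ _).Adj a b ↔ graphD.Adj a b)
instance : DecidableRel graphA'.Adj := fun a b =>
  decidable_of_iff _ (by rw [graphA'_eq] : (listGraph _ _).Adj a b ↔ graphA'.Adj a b)
instance : DecidableRel graphB'.Adj := fun a b =>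
  decidable_of_iff _ (by rw [graphB'_eq] : (listGraph _ _).Adj a b ↔ graphB'.Adj a b)
instance : DecidableRel graphC'.Adj := fun a b =>
  decidable_of_iff _ (by rw [graphC'_eq] : (listGraph _ _).Adj a b ↔ graphC'.Adj a b)

instance {V : Type*} [DecidableEq V] (G : SimpleGraph V) [DecidableRel G.Adj] (a b : V) :
    DecidableRel (G ⊔ edge a b).Adj := fun x y =>
  decidable_of_iff (G.Adj x y ∨ ((x = a ∧ y = b ∨ x = b ∧ y = a) ∧ x ≠ y))
    (by simp [sup_adj, edge_adj])

/-- `dGraph k` with another vertex hanging from the neighbour `k - 2` of its last vertex. -/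
def eGraph (k : ℕ) : SimpleGraph (Fin (k + 1)) :=
  SimpleGraph.fromRel fun u v => ((u.val + 1 = v.val ∨ (u.val = 0 ∧ v.val = 2)) ∧ v.val < k) ∨
    (u.val + 2 = k ∧ v.val = k)

lemma eGraph_adj {k : ℕ} (hk : 5 ≤ k) {u v : Fin (k + 1)} : (eGraph k).Adj u v ↔
    (u.val < k ∧ v.val < k ∧ tailGraph.Adj u v) ∨ (u.val + 2 = k ∧ v.val = k) ∨
    (v.val + 2 = k ∧ u.val = k) := by
  simp only [eGraph, fromRel_adj, tailGraph_adj, Fin.ext_iff, ne_eq]; omega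

end Graphs

/-! ### Adding a pendant vertex. -/

section LeafExt

variable {V W W' : Type*}

/-- `G` arises from `F` by adding a vertex with the only neighbour `w`. -/
def IsLeafExt (F : SimpleGraph W) (w : W) (G : SimpleGraph V) : Prop :=
  ∃ (f : F ↪g G) (z : V), z ∉ Set.range f ∧ (∀ x, x ≠ z → x ∈ Set.range f) ∧
    ∀ a, G.Adj z (f a) ↔ a = w

/-- `z` has exactly one neighbour. -/
def IsLeaf (G : SimpleGraph V) (z : V) : Prop := ∃ u, ∀ w, G.Adj z w ↔ w = u

lemma IsLeaf.iso {G : SimpleGraph V} {H : SimpleGraph W} {z : V} (h : IsLeaf G z) (e : G ≃g H) :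
    IsLeaf H (e z) := by
  obtain ⟨u, hu⟩ := h
  refine ⟨e u, fun w => ?_⟩
  obtain ⟨w, rfl⟩ := e.surjective w
  rw [e.map_adj_iff, hu, e.injective.eq_iff]

lemma IsLeafExt.congr_iso {F : SimpleGraph W} {F' : SimpleGraph W'} {w : W} {G : SimpleGraph V}
    (h : IsLeafExt F w G) (e : F ≃g F') : IsLeafExt F' (e w) G := by
  obtain ⟨f, z, hz, hr, ha⟩ := h
  have hf : Set.range (f.comp e.symm.toEmbedding) = Set.range f := by
    ext x; constructor
    · rintro ⟨a, rfl⟩; exact ⟨_, rfl⟩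
    · rintro ⟨a, rfl⟩; exact ⟨e a, by simp⟩
  refine ⟨f.comp e.symm.toEmbedding, z, by rwa [hf], by rwa [hf], fun a => ?_⟩
  have := ha (e.symm a)
  rw [show (f.comp e.symm.toEmbedding) a = f (e.symm a) from rfl, this]
  constructor
  · rintro rfl; simp
  · rintro rfl; simp

/-- A leaf extension is determined by `F` and `w`. An unknown `G` is thus identified by exhibiting a
known graph as a leaf extension of the same `F` at the same vertex. -/
lemma IsLeafExt.nonempty_iso {V' : Type*} {F : SimpleGraph W} {w : W} {G : SimpleGraph V}
    {G' : SimpleGraph V'} (h : IsLeafExt F w G) (h' : IsLeafExt F w G') : Nonempty (G ≃g G') := by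
  classical
  obtain ⟨f, z, hz, hr, ha⟩ := h
  obtain ⟨f', z', hz', hr', ha'⟩ := h'
  choose g hg using hr
  have hgf : ∀ a, ∀ h : f a ≠ z, g (f a) h = a := fun a h => f.injective (hg _ h)
  have hfz : ∀ a, f a ≠ z := fun a e => hz ⟨a, e⟩
  have hfz' : ∀ a, f' a ≠ z' := fun a e => hz' ⟨a, e⟩
  have cases_x : ∀ x, x = z ∨ ∃ a, x = f a := fun x =>
    (em (x = z)).imp id fun h => ⟨g x h, (hg x h).symm⟩
  let φ : V → V' := fun x => if h : x = z then z' else f' (g x h)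
  have φz : φ z = z' := by simp [φ]
  have φf : ∀ a, φ (f a) = f' a := fun a => by simp only [φ, dif_neg (hfz a), hgf]
  have hbij : Function.Bijective φ := by
    constructor
    · intro x y hxy
      rcases cases_x x with rfl | ⟨a, rfl⟩ <;> rcases cases_x y with rfl | ⟨b, rfl⟩
      · rfl
      · rw [φz, φf] at hxy; exact absurd hxy.symm (hfz' b)
      · rw [φz, φf] at hxy; exact absurd hxy (hfz' a)
      · rw [φf, φf] at hxy; rw [f'.injective hxy]
    · intro y
      by_cases h : y = z'
      · exact ⟨z, by rw [φz, h]⟩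
      · obtain ⟨a, rfl⟩ := hr' y h
        exact ⟨f a, φf a⟩
  refine ⟨⟨Equiv.ofBijective φ hbij, ?_⟩⟩
  intro x y
  change G'.Adj (φ x) (φ y) ↔ G.Adj x y
  rcases cases_x x with rfl | ⟨a, rfl⟩ <;> rcases cases_x y with rfl | ⟨b, rfl⟩
  · simp
  · rw [φz, φf, ha, ha']
  · rw [φz, φf, G.adj_comm, G'.adj_comm, ha, ha']
  · rw [φf, φf, f.map_adj_iff, f'.map_adj_iff]

lemma IsLeafExt.isLeaf {F : SimpleGraph W} {w : W} {G : SimpleGraph V} (h : IsLeafExt F w G) :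
    ∃ (f : F ↪g G) (z : V), (∀ a, f a ≠ z) ∧ IsLeaf G z ∧ G.Adj (f w) z ∧
      ∀ a, a ≠ w → IsLeaf F a → IsLeaf G (f a) := by
  obtain ⟨f, z, hz, hr, ha⟩ := h
  refine ⟨f, z, fun a e => hz ⟨a, e⟩, ⟨f w, fun x => ?_⟩, ((ha w).2 rfl).symm, ?_⟩
  · by_cases h : x = z
    · subst h
      simp only [SimpleGraph.irrefl, false_iff]
      rintro rfl; exact hz ⟨w, rfl⟩
    · obtain ⟨a, rfl⟩ := hr x h
      rw [ha, f.injective.eq_iff]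
  · rintro a haw ⟨u, hu⟩
    refine ⟨f u, fun x => ?_⟩
    by_cases h : x = z
    · subst h
      rw [G.adj_comm, ha]
      constructor
      · intro e; exact absurd e haw
      · rintro rfl; exact absurd ⟨u, rfl⟩ hz
    · obtain ⟨b, rfl⟩ := hr x h
      rw [f.map_adj_iff, hu, f.injective.eq_iff]

lemma isLeafExt_induce {G : SimpleGraph V} {v u : V} (h : ∀ w, G.Adj v w ↔ w = u) :
    ∃ w, IsLeafExt (G.induce {v}ᶜ) w G := by
  have huv : u ≠ v := (((h u).2 rfl).ne).symm
  refine ⟨⟨u, by simpa using huv⟩, Embedding.induce _, v, by simp, by simp, ?_⟩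
  rintro ⟨a, ha⟩
  simp [h, Embedding.induce, Subtype.ext_iff]

variable [Fintype V] [Fintype W]

lemma IsLeafExt.indepSum_eq [DecidableEq W] {R : Type*} [CommRing R] (x : R) {F : SimpleGraph W}
    {w : W} {G : SimpleGraph V} (h : IsLeafExt F w G) :
    indepSum x G Finset.univ =
      indepSum x F Finset.univ + x * indepSum x F (Finset.univ.erase w) := by
  classical
  obtain ⟨f, z, hz, hr, ha⟩ := h
  have hfz : ∀ a, f a ≠ z := fun a e => hz ⟨a, e⟩
  rw [indepSum_rec x G (v := z) (S' := Finset.univ.image f) (T := (Finset.univ.erase w).image f)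
    (by simp),
    ← indepSum_bijOn x (G := F) (S := Finset.univ) f, ← indepSum_bijOn x (G := F)
    (S := Finset.univ.erase w) f]
  · rw [Finset.coe_image]; exact (f.injective.injOn).bijOn_image
  · intro a _ b _; exact f.map_rel_iff
  · rw [Finset.coe_image]; exact (f.injective.injOn).bijOn_image
  · intro a _ b _; exact f.map_rel_iff
  · intro u
    by_cases h : u = z
    · subst h; simpa using hfz
    · obtain ⟨a, rfl⟩ := hr u h; simp [h]
  · intro u
    by_cases h : u = z
    · subst h; simp [hfz]
    · obtain ⟨a, rfl⟩ := hr u h; simp [h, ha]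

lemma IsLeafExt.card_eq {F : SimpleGraph W} {w : W} {G : SimpleGraph V} (h : IsLeafExt F w G) :
    Fintype.card V = Fintype.card W + 1 := by
  classical
  have h1 := congrArg (fun p : ℤ[X] => p.coeff 1) (h.indepSum_eq (X : ℤ[X]))
  simp only [coeff_add, coeff_X_mul] at h1
  have h2 := indepCoeff_one G Finset.univ
  have h3 := indepCoeff_one F Finset.univ
  have h4 := indepCoeff_zero F (Finset.univ.erase w)
  rw [indepCoeff] at h2 h3 h4
  rw [h2, h3, h4] at h1
  simp only [Finset.card_univ] at h1
  exact_mod_cast h1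

lemma IsLeafExt.weight_eq [DecidableEq W] {F : SimpleGraph W} {w : W} {G : SimpleGraph V}
    (h : IsLeafExt F w G) : weight G Finset.univ =
      2 * weight F Finset.univ - weight F (Finset.univ.erase w) := by
  unfold weight
  rw [h.indepSum_eq, Finset.card_univ, h.card_eq, Finset.card_univ,
    Finset.card_erase_of_mem (Finset.mem_univ w), Finset.card_univ]
  have : 0 < Fintype.card W := Fintype.card_pos_iff.2 ⟨w⟩
  obtain ⟨k, hk⟩ := Nat.exists_eq_add_of_lt this
  rw [hk]; simp only [zero_add, Nat.add_sub_cancel]; ring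

/-- One vertex and one edge are added, and no triangle. In `∑ (d - 2) ^ 2 / 2` the new leaf
contributes `1/2`, and the term of `w` grows by `d(w) - 3/2`, which makes `d(w) - 1` together. -/
lemma IsLeafExt.excess_defect {F : SimpleGraph W} {w : W} {G : SimpleGraph V}
    (h : IsLeafExt F w G) : excess (indepPoly G) = excess (indepPoly F) ∧
      defect (indepPoly G) = defect (indepPoly F) + 6 * ((F.neighborSet w).ncard - 1) := by
  classical
  have hc := h.card_eq
  have h1 := congrArg (fun p : ℤ[X] => p.coeff 1) (h.indepSum_eq (X : ℤ[X]))
  have h2 := congrArg (fun p : ℤ[X] => p.coeff 2) (h.indepSum_eq (X : ℤ[X]))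
  have h3 := congrArg (fun p : ℤ[X] => p.coeff 3) (h.indepSum_eq (X : ℤ[X]))
  simp only [coeff_add, coeff_X_mul] at h1 h2 h3
  have f1 := indepCoeff_one F Finset.univ
  have e0 := indepCoeff_zero F (Finset.univ.erase w)
  have e1 := indepCoeff_one F (Finset.univ.erase w)
  have e2 := indepCoeff_rec F (S := Finset.univ) (v := w) (S' := Finset.univ.erase w)
    (T := {u | u ≠ w ∧ ¬ F.Adj w u}) (by simp) (by simp) (by simp) 1
  have hcount : Finset.card {u | u ≠ w ∧ ¬ F.Adj w u} + (F.neighborSet w).ncard + 1 =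
      Fintype.card W := by
    rw [Set.ncard_eq_toFinset_card' (F.neighborSet w), ← Finset.card_univ,
      ← Finset.card_erase_add_one (Finset.mem_univ w),
      ← Finset.card_filter_add_card_filter_not (s := Finset.univ.erase w) (fun u => F.Adj w u)]
    have a1 : (Finset.univ.erase w).filter (fun u => F.Adj w u) =
        (F.neighborSet w).toFinset := by
      ext u; simp; intro hu; exact hu.ne'
    have a2 : (Finset.univ.erase w).filter (fun u => ¬ F.Adj w u) =
        ({u | u ≠ w ∧ ¬ F.Adj w u} : Finset W) := by
      ext u; simp
    rw [a1, a2]; omega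
  have hcw : (Finset.univ.erase w).card + 1 = Fintype.card W := by
    rw [Finset.card_erase_add_one (Finset.mem_univ w), Finset.card_univ]
  rw [indepCoeff_one] at e2
  have hcount' : ((Finset.card {u | u ≠ w ∧ ¬ F.Adj w u} : ℕ) : ℤ) + (F.neighborSet w).ncard + 1 =
      Fintype.card W := by exact_mod_cast hcount
  have hcw' : ((Finset.univ.erase w).card : ℤ) + 1 = Fintype.card W := by exact_mod_cast hcw
  simp only [indepCoeff] at f1 e0 e1 e2
  rw [Finset.card_univ] at f1
  rw [excess, excess, defect, defect, indepPoly_eq_indepSum, indepPoly_eq_indepSum, h1, h2, h3,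
    e0, e1, f1]
  have i1 : ((Finset.univ.erase w).card : ℤ) = Fintype.card W - 1 := by linarith
  have i2 : (indepSum (X : ℤ[X]) F (Finset.univ.erase w)).coeff 2 =
      (indepSum (X : ℤ[X]) F Finset.univ).coeff 2 -
        (Fintype.card W - 1 - (F.neighborSet w).ncard) := by
    rw [e2]; linarith
  rw [i1, i2]
  constructor <;> ring

end LeafExt

/-! ### Pendant vertices added to listed graphs. -/

section LeafSteps

variable {V W : Type*}

/-- `G` has a vertex with at least three neighbours. -/
def HasBranch (G : SimpleGraph V) : Prop :=
  ∃ v a b c, a ≠ b ∧ a ≠ c ∧ b ≠ c ∧ G.Adj v a ∧ G.Adj v b ∧ G.Adj v c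

/-- The sporadic unicyclic graphs that occur as components. -/
def Sporadic (G : SimpleGraph V) : Prop :=
  Nonempty (G ≃g bull) ∨ Nonempty (G ≃g graphA) ∨ Nonempty (G ≃g graphA') ∨
  Nonempty (G ≃g banner) ∨ Nonempty (G ≃g graphB) ∨ Nonempty (G ≃g graphB') ∨
  Nonempty (G ≃g graphC) ∨ Nonempty (G ≃g graphC')

/-- The list of unicyclic graphs without zeros of the independence polynomial in `[-1/4, 0]`,
coarse for those of large defect. -/
def UnicyclicListed (G : SimpleGraph V) : Prop :=
  (12 ≤ defect (indepPoly G) ∧ ∃ u v, u ≠ v ∧ IsLeaf G u ∧ IsLeaf G v) ∨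
  Nonempty (G ≃g cycleGraph 3) ∨
  (∃ k, 4 ≤ k ∧ (Nonempty (G ≃g cycleGraph k) ∨ Nonempty (G ≃g dGraph k))) ∨
  (defect (indepPoly G) = 6 ∧ ((∃ k, 5 ≤ k ∧ Nonempty (G ≃g eGraph k)) ∨ Sporadic G))

/-- The list of connected graphs without zeros of the independence polynomial in `[-1/4, 0]`. -/
def Listed (G : SimpleGraph V) : Prop :=
  (excess (indepPoly G) < 0 ∧ ((∃ k, Nonempty (G ≃g pathGraph k)) ∨ HasBranch G)) ∨
  Nonempty (G ≃g diamond) ∨ (excess (indepPoly G) = 0 ∧ UnicyclicListed G)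

lemma indepPoly_iso [Fintype V] [Fintype W] {G : SimpleGraph V} {H : SimpleGraph W}
    (e : G ≃g H) : indepPoly G = indepPoly H := by
  rw [indepPoly_eq_indepSum, indepPoly_eq_indepSum, indepSum_iso _ e]

lemma IsLeaf.ncard {G : SimpleGraph V} {v : V} (h : IsLeaf G v) :
    (G.neighborSet v).ncard = 1 := by
  obtain ⟨u, hu⟩ := h
  rw [show G.neighborSet v = {u} by ext x; simp [hu], Set.ncard_singleton]

lemma two_le_ncard [Finite V] {G : SimpleGraph V} {v a b : V} (hab : a ≠ b) (ha : G.Adj v a)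
    (hb : G.Adj v b) : 2 ≤ (G.neighborSet v).ncard := by
  rw [← Set.ncard_pair hab]
  refine Set.ncard_le_ncard ?_ (Set.toFinite _)
  rintro x (rfl | rfl) <;> assumption

lemma three_le_ncard [Finite V] {G : SimpleGraph V} {v a b c : V} (hab : a ≠ b) (hac : a ≠ c)
    (hbc : b ≠ c) (ha : G.Adj v a) (hb : G.Adj v b) (hc : G.Adj v c) :
    3 ≤ (G.neighborSet v).ncard := by
  rw [← Set.ncard_eq_three.2 ⟨a, b, c, hab, hac, hbc, rfl⟩]
  refine Set.ncard_le_ncard ?_ (Set.toFinite _)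
  rintro x (rfl | rfl | rfl) <;> assumption

lemma ncard_neighborSet_eq_two {G : SimpleGraph V} {v a b : V} (hab : a ≠ b)
    (h : ∀ x, G.Adj v x ↔ x = a ∨ x = b) : (G.neighborSet v).ncard = 2 := by
  rw [show G.neighborSet v = {a, b} by ext x; simp [h], Set.ncard_pair hab]

lemma isLeafExt_mk {n : ℕ} {F : SimpleGraph (Fin n)} {w : Fin n} {G : SimpleGraph (Fin (n + 1))}
    (f : Fin n → Fin (n + 1)) (z : Fin (n + 1)) (hinj : Function.Injective f)
    (hz : ∀ a, f a ≠ z) (hadj : ∀ a b, G.Adj (f a) (f b) ↔ F.Adj a b)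
    (ha : ∀ a, G.Adj z (f a) ↔ a = w) : IsLeafExt F w G := by
  refine ⟨⟨⟨f, hinj⟩, hadj _ _⟩, z, ?_, ?_, ha⟩
  · rintro ⟨a, e⟩; exact hz a e
  · intro x hx
    have h1 : Finset.univ.image f = Finset.univ.erase z := by
      refine Finset.eq_of_subset_of_card_le ?_ ?_
      · intro y hy
        obtain ⟨a, _, rfl⟩ := Finset.mem_image.1 hy
        simpa using hz a
      · rw [Finset.card_image_of_injective _ hinj]; simp
    have : x ∈ Finset.univ.image f := by rw [h1]; simpa using hx
    obtain ⟨a, _, rfl⟩ := Finset.mem_image.1 this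
    exact ⟨a, rfl⟩

lemma isLeafExt_castSucc {n : ℕ} {F : SimpleGraph (Fin n)} {w : Fin n}
    {G : SimpleGraph (Fin (n + 1))} (hadj : ∀ a b : Fin n, G.Adj a.castSucc b.castSucc ↔ F.Adj a b)
    (ha : ∀ a : Fin n, G.Adj (Fin.last n) a.castSucc ↔ a = w) : IsLeafExt F w G :=
  isLeafExt_mk Fin.castSucc (Fin.last n) (Fin.castSucc_injective n)
    (fun a => (Fin.castSucc_lt_last a).ne) hadj ha

variable [Fintype V] [Fintype W]

/-- A leaf of `F` other than `w` remains a leaf; with the new vertex it makes the two leaves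
demanded of graphs of defect at least 12. -/
lemma IsLeafExt.listed_of_large {F : SimpleGraph W} {w : W} {G : SimpleGraph V}
    (h : IsLeafExt F w G) (he : excess (indepPoly F) = 0)
    (hd : 12 ≤ defect (indepPoly F) + 6 * ((F.neighborSet w).ncard - 1))
    (hl : ∃ z, z ≠ w ∧ IsLeaf F z) : Listed G := by
  obtain ⟨h1, h2⟩ := h.excess_defect
  obtain ⟨f, z, hfz, hz, _, hf⟩ := h.isLeaf
  obtain ⟨y, hyw, hy⟩ := hl
  exact Or.inr (Or.inr ⟨h1.trans he, Or.inl ⟨by omega, f y, z, hfz y, hf y hyw hy, hz⟩⟩)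

lemma IsLeafExt.listed_of_exceptional {F : SimpleGraph W} {w : W} {G : SimpleGraph V}
    (h : IsLeafExt F w G) (he : excess (indepPoly F) = 0)
    (hd : defect (indepPoly F) + 6 * ((F.neighborSet w).ncard - 1) = 6)
    (hG : (∃ k, 5 ≤ k ∧ Nonempty (G ≃g eGraph k)) ∨ Sporadic G) : Listed G := by
  obtain ⟨h1, h2⟩ := h.excess_defect
  exact Or.inr (Or.inr ⟨h1.trans he, Or.inr (Or.inr (Or.inr ⟨by omega, hG⟩))⟩)

/-- In a connected graph `w` has a neighbour, so the defect cannot drop, and of two leaves at least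
one differs from `w`. -/
lemma IsLeafExt.listed_of_large_defect {F : SimpleGraph W} {w : W} {G : SimpleGraph V}
    (h : IsLeafExt F w G) (hF : F.Connected) (he : excess (indepPoly F) = 0)
    (hd : 12 ≤ defect (indepPoly F)) (hl : ∃ u v, u ≠ v ∧ IsLeaf F u ∧ IsLeaf F v) : Listed G := by
  classical
  obtain ⟨u, v, huv, hu, hv⟩ := hl
  have : Nontrivial W := ⟨u, v, huv⟩
  have h1 := hF.preconnected.degree_pos_of_nontrivial w
  rw [← card_neighborSet_eq_degree, ← Nat.card_eq_fintype_card] at h1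
  change 0 < (F.neighborSet w).ncard at h1
  rcases eq_or_ne u w with rfl | hu'
  · exact h.listed_of_large he (by omega) ⟨v, huv.symm, hv⟩
  · exact h.listed_of_large he (by omega) ⟨u, hu', hu⟩

lemma indepPoly_cycle_excess {k : ℕ} (hk : 3 ≤ k) : excess (indepPoly (cycleGraph k)) = 0 := by
  rw [indepPoly_cycleGraph hk, excess_cyclePoly hk]

lemma weight_cycleGraph {k : ℕ} (hk : 3 ≤ k) : weight (cycleGraph k) Finset.univ = 2 := by
  have := weight_tail_range (show 2 ≤ k by omega)
  rw [weight, Finset.card_range] at this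
  rw [weight, indepSum_cycleGraph _ hk, cyclePoly, Finset.card_univ, Fintype.card_fin, this]

lemma cycleGraph_adj_add {k : ℕ} [NeZero k] (u v w : Fin k) :
    (cycleGraph k).Adj (u + w) (v + w) ↔ (cycleGraph k).Adj u v := by
  simp only [cycleGraph_adj', add_sub_add_right_eq_sub]

/-- Rotation of a cycle. -/
def cycleRotate {k : ℕ} [NeZero k] (w : Fin k) : cycleGraph k ≃g cycleGraph k :=
  ⟨Equiv.addRight w, by intro u v; exact cycleGraph_adj_add u v w⟩

lemma exists_cycle_iso_zero {k : ℕ} (hk : 0 < k) (w : Fin k) :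
    ∃ e : cycleGraph k ≃g cycleGraph k, e w = ⟨0, hk⟩ := by
  have : NeZero k := ⟨by omega⟩
  exact ⟨cycleRotate (-w), add_neg_cancel w⟩

lemma weight_cycleGraph_erase {k : ℕ} (hk : 3 ≤ k) :
    weight (cycleGraph k) (Finset.univ.erase ⟨0, by omega⟩) = (k + 1) / 2 := by
  have h := weight_tail_Ico le_rfl (k - 1)
  rw [show 1 + (k - 1) = k by omega, Nat.cast_sub (show 1 ≤ k by omega)] at h
  rw [weight_bijOn Fin.val (bijOn_cycle_tail (n := k) (a := 1) (b := k) ?_ le_rfl)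
    (H := tailGraph), h]
  · push_cast; ring
  · intro i hi j hj
    simp [Fin.ext_iff] at hi hj; simp only [tailGraph_adj, cycleGraph_adj_val]; omega
  · intro i; simp [Fin.ext_iff]; omega

/-- The new weight is `2 * 2 - (k + 1) / 2`, positive only for `k ≤ 6`. The four remaining cycles
give `D_4`, `banner`, `graphC` and `graphC'`. -/
lemma IsLeafExt.listed_cycleGraph {k : ℕ} (hk : 3 ≤ k) {w : Fin k} {G : SimpleGraph V}
    (hpos : PositiveOn G Finset.univ) (h : IsLeafExt (cycleGraph k) w G) : Listed G := by
  obtain ⟨e, he⟩ := exists_cycle_iso_zero (show 0 < k by omega) w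
  replace h := h.congr_iso e
  rw [he] at h
  have hw := hpos.weight_pos
  rw [h.weight_eq, weight_cycleGraph hk, weight_cycleGraph_erase hk] at hw
  have hk7 : k < 7 := by
    have : (k : ℝ) < 7 := by linarith
    exact_mod_cast this
  have hdeg : ((cycleGraph k).neighborSet ⟨0, by omega⟩).ncard = 2 := by
    refine ncard_neighborSet_eq_two (a := ⟨1, by omega⟩) (b := ⟨k - 1, by omega⟩) ?_ ?_
    · simp [Fin.ext_iff]; omega
    · intro x; simp [cycleGraph_adj_val, Fin.ext_iff]; omega
  have hex := indepPoly_cycle_excess hk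
  rcases hk.eq_or_lt with rfl | hk4
  · replace h : IsLeafExt (cycleGraph 3) 0 G := h
    have h' : IsLeafExt (cycleGraph 3) 0 (dGraph 4) :=
      isLeafExt_mk ![2, 0, 1] 3 (by decide) (by decide) (by decide) (by decide)
    refine Or.inr (Or.inr ⟨h.excess_defect.1.trans hex, Or.inr (Or.inr (Or.inl
      ⟨4, le_rfl, Or.inr (h.nonempty_iso h')⟩))⟩)
  · refine h.listed_of_exceptional hex ?_ (Or.inr ?_)
    · rw [hdeg, indepPoly_cycleGraph hk, defect_cyclePoly hk4]; norm_num
    · have : k = 4 ∨ k = 5 ∨ k = 6 := by omega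
      rcases this with rfl | rfl | rfl
      · replace h : IsLeafExt (cycleGraph 4) 0 G := h
        have h' : IsLeafExt (cycleGraph 4) 0 banner :=
          isLeafExt_mk ![3, 2, 0, 1] 4 (by decide) (by decide) (by decide) (by decide)
        exact Or.inr (Or.inr (Or.inr (Or.inl (h.nonempty_iso h'))))
      · replace h : IsLeafExt (cycleGraph 5) 0 G := h
        have h' : IsLeafExt (cycleGraph 5) 0 graphC :=
          isLeafExt_mk ![4, 3, 1, 0, 2] 5 (by decide) (by decide) (by decide +kernel)
            (by decide +kernel)
        exact Or.inr (Or.inr (Or.inr (Or.inr (Or.inr (Or.inr (Or.inl (h.nonempty_iso h')))))))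
      · replace h : IsLeafExt (cycleGraph 6) 0 G := h
        have h' : IsLeafExt (cycleGraph 6) 0 graphC' :=
          isLeafExt_mk ![5, 4, 2, 0, 1, 3] 6 (by decide) (by decide) (by decide +kernel)
            (by decide +kernel)
        exact Or.inr (Or.inr (Or.inr (Or.inr (Or.inr (Or.inr (Or.inr (h.nonempty_iso h')))))))

/-! ### Triangles with a tail -/

lemma weight_dGraph_univ {k : ℕ} (hk : 2 ≤ k) : weight (dGraph k) Finset.univ = 2 := by
  rw [weight_dGraph (T := Finset.range k) (by simp), weight_tail_range hk]

/-- The reflection of `dGraph k`. -/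
def dGraphSwap {k : ℕ} (hk : 4 ≤ k) : dGraph k ≃g dGraph k :=
  ⟨Equiv.swap ⟨0, by omega⟩ ⟨1, by omega⟩, by
    intro a b
    have key : ∀ a : Fin k, ((Equiv.swap (⟨0, by omega⟩ : Fin k) ⟨1, by omega⟩ a).val =
        if a.val = 0 then 1 else if a.val = 1 then 0 else a.val) := by
      intro a
      rw [Equiv.swap_apply_def]
      simp only [Fin.ext_iff]
      split_ifs <;> simp_all
    rw [dGraph_adj, dGraph_adj, tailGraph_adj, tailGraph_adj, key, key]
    split_ifs <;> simp only [false_and, or_false, false_or, and_false, true_and, true_or, true_iff,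
      false_iff] <;> omega⟩

lemma dGraphSwap_one {k : ℕ} (hk : 4 ≤ k) :
    dGraphSwap hk ⟨1, by omega⟩ = (⟨0, by omega⟩ : Fin k) := by
  simp [dGraphSwap]

lemma isLeaf_dGraph {k : ℕ} (hk : 4 ≤ k) : IsLeaf (dGraph k) ⟨k - 1, by omega⟩ := by
  refine ⟨⟨k - 2, by omega⟩, fun w => ?_⟩
  rw [dGraph_adj, tailGraph_adj, Fin.ext_iff]
  have := w.2
  simp only; omega

lemma indepPoly_dGraph_excess {k : ℕ} (hk : 3 ≤ k) : excess (indepPoly (dGraph k)) = 0 := by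
  rw [indepPoly_dGraph, excess_cyclePoly hk]

lemma indepPoly_dGraph_defect {k : ℕ} (hk : 4 ≤ k) : defect (indepPoly (dGraph k)) = 0 := by
  rw [indepPoly_dGraph, defect_cyclePoly hk]

lemma isLeafExt_dGraph_succ {k : ℕ} (hk : 4 ≤ k) :
    IsLeafExt (dGraph k) ⟨k - 1, by omega⟩ (dGraph (k + 1)) := by
  refine isLeafExt_castSucc ?_ ?_
  · intro a b; simp [dGraph_adj]
  · intro a
    have := a.2
    rw [dGraph_adj, tailGraph_adj, Fin.ext_iff]; simp; omega

lemma isLeafExt_eGraph {k : ℕ} (hk : 5 ≤ k) :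
    IsLeafExt (dGraph k) ⟨k - 2, by omega⟩ (eGraph k) := by
  refine isLeafExt_castSucc ?_ ?_
  · intro a b
    have := a.2
    have := b.2
    rw [dGraph_adj, eGraph_adj hk]; simp; omega
  · intro a
    have := a.2
    rw [eGraph_adj hk, Fin.ext_iff]; simp; omega

lemma ncard_dGraph_zero {k : ℕ} (hk : 4 ≤ k) :
    ((dGraph k).neighborSet ⟨0, by omega⟩).ncard = 2 := by
  refine ncard_neighborSet_eq_two (a := ⟨1, by omega⟩) (b := ⟨2, by omega⟩) ?_ ?_
  · simp
  · intro x; rw [dGraph_adj, tailGraph_adj, Fin.ext_iff, Fin.ext_iff]; simp only [true_and]; omega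

/-- Deleting the triangle vertex 0 leaves a path on `k - 1` vertices, so the weight is again `4 - (k
+ 1) / 2` and `k ≤ 6`. -/
lemma IsLeafExt.listed_dGraph_zero {k : ℕ} (hk : 4 ≤ k) {G : SimpleGraph V}
    (hpos : PositiveOn G Finset.univ) (h : IsLeafExt (dGraph k) ⟨0, by omega⟩ G) : Listed G := by
  have hw := hpos.weight_pos
  rw [h.weight_eq, weight_dGraph_univ (by omega), weight_dGraph (T := Finset.Ico 1 (1 + (k - 1)))
    (by intro i; simp; omega), weight_tail_Ico le_rfl, Nat.cast_sub (show 1 ≤ k by omega)] at hw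
  have hk7 : k < 7 := by
    have : (k : ℝ) < 7 := by push_cast at hw; linarith
    exact_mod_cast this
  refine h.listed_of_exceptional (indepPoly_dGraph_excess (by omega)) ?_ (Or.inr ?_)
  · rw [ncard_dGraph_zero hk, indepPoly_dGraph_defect hk]; norm_num
  · have : k = 4 ∨ k = 5 ∨ k = 6 := by omega
    rcases this with rfl | rfl | rfl
    · replace h : IsLeafExt (dGraph 4) 0 G := h
      have h' : IsLeafExt (dGraph 4) 0 bull :=
        isLeafExt_mk ![1, 2, 3, 4] 0 (by decide) (by decide) (by decide) (by decide)
      exact Or.inl (h.nonempty_iso h')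
    · replace h : IsLeafExt (dGraph 5) 0 G := h
      have h' : IsLeafExt (dGraph 5) 0 graphA :=
        isLeafExt_mk ![1, 2, 3, 4, 5] 0 (by decide) (by decide) (by decide +kernel)
          (by decide +kernel)
      exact Or.inr (Or.inl (h.nonempty_iso h'))
    · replace h : IsLeafExt (dGraph 6) 0 G := h
      have h' : IsLeafExt (dGraph 6) 0 graphA' :=
        isLeafExt_mk ![1, 2, 3, 4, 5, 6] 0 (by decide) (by decide) (by decide +kernel)
          (by decide +kernel)
      exact Or.inr (Or.inr (Or.inl (h.nonempty_iso h')))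

lemma IsLeafExt.listed_dGraph {k : ℕ} (hk : 4 ≤ k) {w : Fin k} {G : SimpleGraph V}
    (hpos : PositiveOn G Finset.univ) (h : IsLeafExt (dGraph k) w G) : Listed G := by
  obtain ⟨i, hi⟩ := w
  have hex := indepPoly_dGraph_excess (show 3 ≤ k by omega)
  have hdf := indepPoly_dGraph_defect hk
  have hcase : i = 0 ∨ i = 1 ∨ i = 2 ∨ i = k - 1 ∨ (3 ≤ i ∧ i + 3 ≤ k) ∨ (3 ≤ i ∧ i = k - 2) := by
    omega
  rcases hcase with rfl | rfl | rfl | rfl | ⟨h3, hik⟩ | ⟨h3, rfl⟩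
  · exact h.listed_dGraph_zero hk hpos
  · have := h.congr_iso (dGraphSwap hk)
    rw [dGraphSwap_one] at this
    exact this.listed_dGraph_zero hk hpos
  · refine h.listed_of_large hex ?_ ⟨⟨k - 1, by omega⟩, by simp [Fin.ext_iff]; omega,
      isLeaf_dGraph hk⟩
    have := three_le_ncard (G := dGraph k) (v := ⟨2, hi⟩) (a := ⟨0, by omega⟩) (b := ⟨1, by omega⟩)
      (c := ⟨3, by omega⟩) (by simp) (by simp) (by simp) (by simp [dGraph_adj, tailGraph_adj])
      (by simp [dGraph_adj, tailGraph_adj]) (by simp [dGraph_adj, tailGraph_adj])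
    omega
  · refine Or.inr (Or.inr ⟨h.excess_defect.1.trans hex, Or.inr (Or.inr (Or.inl
      ⟨k + 1, by omega, Or.inr (h.nonempty_iso (isLeafExt_dGraph_succ hk))⟩))⟩)
  -- Deleting the tail vertex `i` leaves `D_i` (a triangle if `i = 3`), of weight 2, and a path on
  -- `k - 1 - i ≥ 2` vertices, of weight at least 2; hence the new weight is at most `4 - 4 = 0`.
  · exfalso
    have hw := hpos.weight_pos
    rw [h.weight_eq, weight_dGraph_univ (by omega),
      weight_dGraph (T := Finset.range i ∪ Finset.Ico (i + 1) (i + 1 + (k - 1 - i)))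
        (by intro j; simp; omega), weight_union, weight_tail_range (by omega),
      weight_tail_Ico (by omega), Nat.cast_sub (by omega), Nat.cast_sub (by omega)] at hw
    · have : (i : ℝ) + 3 ≤ k := by exact_mod_cast hik
      push_cast at hw
      linarith
    · rw [Finset.disjoint_left]; intro a; simp; omega
    · intro a ha b hb; simp at ha hb; rw [tailGraph_adj]; omega
  · refine h.listed_of_exceptional hex ?_ (Or.inl ⟨k, by omega,
      h.nonempty_iso (isLeafExt_eGraph (by omega))⟩)
    rw [hdf, ncard_neighborSet_eq_two (a := ⟨k - 3, by omega⟩) (b := ⟨k - 1, by omega⟩)]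
    · norm_num
    · simp [Fin.ext_iff]; omega
    · intro x
      have := x.2
      rw [dGraph_adj, tailGraph_adj, Fin.ext_iff, Fin.ext_iff]; simp only; omega

/-! ### Triangles with a forked tail -/

lemma isLeaf_eGraph_last {k : ℕ} (hk : 5 ≤ k) : IsLeaf (eGraph k) ⟨k, by omega⟩ := by
  refine ⟨⟨k - 2, by omega⟩, fun w => ?_⟩
  have := w.2
  rw [eGraph_adj hk, tailGraph_adj, Fin.ext_iff]; simp only [and_true]; omega

lemma isLeaf_eGraph_pred {k : ℕ} (hk : 5 ≤ k) : IsLeaf (eGraph k) ⟨k - 1, by omega⟩ := by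
  refine ⟨⟨k - 2, by omega⟩, fun w => ?_⟩
  have := w.2
  rw [eGraph_adj hk, tailGraph_adj, Fin.ext_iff]; simp only; omega

lemma weight_eGraph {k : ℕ} (hk : 5 ≤ k) : weight (eGraph k) Finset.univ = 1 := by
  rw [(isLeafExt_eGraph hk).weight_eq, weight_dGraph_univ (by omega),
    weight_dGraph (T := Finset.range (k - 2) ∪ Finset.Ico (k - 1) (k - 1 + 1))
      (by intro j; simp; omega), weight_union, weight_tail_range (by omega),
    weight_tail_Ico (by omega)]
  · norm_num
  · rw [Finset.disjoint_left]; intro a; simp; omega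
  · intro a ha b hb; simp at ha hb; rw [tailGraph_adj]; omega

/-- The vertices `k - 1` and `k` are twin leaves; without either of them the graph is `D_k`. The map
`min · (k - 1)` identifies the two cases. -/
lemma weight_eGraph_erase {k : ℕ} (hk : 5 ≤ k) {i : ℕ} (hi : i < k + 1) (hik : k ≤ i + 1) :
    weight (eGraph k) (Finset.univ.erase ⟨i, hi⟩) = 2 := by
  rw [← weight_tail_range (show 2 ≤ k by omega)]
  refine weight_bijOn (fun a => min a.val (k - 1)) ⟨?_, ?_, ?_⟩ ?_
  · intro a ha; simp; omega
  · intro a ha b hb hab; simp [Fin.ext_iff] at ha hb hab ⊢; omega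
  · intro j hj
    simp at hj
    by_cases hji : j = i
    · exact ⟨⟨k, by omega⟩, by simp [Fin.ext_iff]; omega, by simp; omega⟩
    · exact ⟨⟨j, by omega⟩, by simp [Fin.ext_iff]; omega, by simp; omega⟩
  · intro a ha b hb
    simp [Fin.ext_iff] at ha hb
    have := a.2
    have := b.2
    rw [eGraph_adj hk, tailGraph_adj, tailGraph_adj]; omega

/-- At a twin leaf the new weight is `2 * 1 - 2 = 0`. Every other vertex has degree at least two, so
the defect rises from 6 to at least 12. -/
lemma IsLeafExt.listed_eGraph {k : ℕ} (hk : 5 ≤ k) {w : Fin (k + 1)} {G : SimpleGraph V}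
    (hpos : PositiveOn G Finset.univ) (h : IsLeafExt (eGraph k) w G)
    (hex : excess (indepPoly (eGraph k)) = 0) (hdf : defect (indepPoly (eGraph k)) = 6) :
    Listed G := by
  obtain ⟨i, hi⟩ := w
  by_cases hik : k ≤ i + 1
  · exfalso
    have hw := hpos.weight_pos
    rw [h.weight_eq, weight_eGraph hk, weight_eGraph_erase hk hi hik] at hw
    norm_num at hw
  · refine h.listed_of_large hex ?_ ⟨⟨k, by omega⟩, by simp [Fin.ext_iff]; omega,
      isLeaf_eGraph_last hk⟩
    have h2 : 2 ≤ ((eGraph k).neighborSet ⟨i, hi⟩).ncard := by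
      by_cases h0 : i = 0
      · exact two_le_ncard (a := ⟨1, by omega⟩) (b := ⟨2, by omega⟩) (by simp)
          (by simp [eGraph_adj hk, tailGraph_adj]; omega)
          (by simp [eGraph_adj hk, tailGraph_adj]; omega)
      · exact two_le_ncard (a := ⟨i - 1, by omega⟩) (b := ⟨i + 1, by omega⟩)
          (by simp [Fin.ext_iff]) (by simp [eGraph_adj hk, tailGraph_adj]; omega)
          (by simp [eGraph_adj hk, tailGraph_adj]; omega)
    omega

/-! ### Sporadic graphs -/

lemma IsLeafExt.listed_of_two_adj {F : SimpleGraph W} {w : W} {G : SimpleGraph V}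
    (h : IsLeafExt F w G) (he : excess (indepPoly F) = 0) (hd : defect (indepPoly F) = 6)
    (hw : ∃ a b, a ≠ b ∧ F.Adj w a ∧ F.Adj w b) (hl : ∃ z u, z ≠ w ∧ ∀ x, F.Adj z x ↔ x = u) :
    Listed G := by
  obtain ⟨a, b, hab, ha, hb⟩ := hw
  obtain ⟨z, u, hzw, hu⟩ := hl
  have := two_le_ncard hab ha hb
  exact h.listed_of_large he (by omega) ⟨z, hzw, u, hu⟩

lemma IsLeafExt.false_of_weight {n : ℕ} {F : SimpleGraph (Fin n)} [DecidableRel F.Adj]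
    {w : Fin n} {G : SimpleGraph V} (hpos : PositiveOn G Finset.univ) (h : IsLeafExt F w G)
    (hw : 2 * weightList F (List.finRange n) ≤
      weightList F ((List.finRange n).filter (· ≠ w))) : False := by
  have := hpos.weight_pos
  rw [h.weight_eq, weight_univ_eq_weightList, weight_erase_eq_weightList] at this
  have h' : (2 * weightList F (List.finRange n) : ℝ) ≤
      weightList F ((List.finRange n).filter (· ≠ w)) := by exact_mod_cast hw
  linarith

lemma IsLeafExt.listed_of_leaf {F : SimpleGraph W} {w : W} {G : SimpleGraph V}
    (h : IsLeafExt F w G) (he : excess (indepPoly F) = 0) (hd : defect (indepPoly F) = 6)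
    (hw : ∃ u, ∀ x, F.Adj w x ↔ x = u) (hG : Sporadic G) : Listed G := by
  refine h.listed_of_exceptional he ?_ (Or.inr hG)
  rw [IsLeaf.ncard hw, hd]; norm_num

lemma IsLeafExt.listed_bull {w : Fin 5} {G : SimpleGraph V} (h : IsLeafExt bull w G)
    (he : excess (indepPoly bull) = 0) (hd : defect (indepPoly bull) = 6) : Listed G := by
  by_cases h0 : w = 0 ∨ w = 4
  · refine h.listed_of_leaf he hd (by clear h; revert w; decide +kernel) (Or.inr (Or.inl ?_))
    rcases h0 with rfl | rfl
    · exact h.nonempty_iso (isLeafExt_mk ![4, 3, 2, 1, 0] 5 (by decide) (by decide)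
        (by decide +kernel) (by decide +kernel))
    · exact h.nonempty_iso (isLeafExt_castSucc (by decide +kernel) (by decide +kernel))
  · exact h.listed_of_two_adj he hd (by clear h; revert w; decide +kernel) (by clear h; revert w; decide +kernel)

lemma IsLeafExt.listed_graphA {w : Fin 6} {G : SimpleGraph V} (hpos : PositiveOn G Finset.univ)
    (h : IsLeafExt graphA w G)
    (he : excess (indepPoly graphA) = 0) (hd : defect (indepPoly graphA) = 6) : Listed G := by
  by_cases h5 : w = 5
  · subst h5
    exact h.listed_of_leaf he hd (by decide +kernel) (Or.inr (Or.inr (Or.inl (h.nonempty_iso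
      (isLeafExt_castSucc (by decide +kernel) (by decide +kernel))))))
  by_cases h0 : w = 0
  · subst h0; exact (h.false_of_weight hpos (by decide +kernel)).elim
  · exact h.listed_of_two_adj he hd (by clear h; revert w; decide +kernel) (by clear h; revert w; decide +kernel)

/-- Lengthening the longer path would continue the weights `3/2, 1, 1/2` of `bull`, `graphA`,
`graphA'` to 0; lengthening the shorter one gives `2 * (1/2) - 2 < 0`. -/
lemma IsLeafExt.listed_graphA' {w : Fin 7} {G : SimpleGraph V} (hpos : PositiveOn G Finset.univ)
    (h : IsLeafExt graphA' w G)
    (he : excess (indepPoly graphA') = 0) (hd : defect (indepPoly graphA') = 6) : Listed G := by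
  by_cases h0 : w = 0 ∨ w = 6
  · exact (h.false_of_weight hpos (by clear h; revert w; decide +kernel)).elim
  · exact h.listed_of_two_adj he hd (by clear h; revert w; decide +kernel) (by clear h; revert w; decide +kernel)

lemma IsLeafExt.listed_banner {w : Fin 5} {G : SimpleGraph V} (h : IsLeafExt banner w G)
    (he : excess (indepPoly banner) = 0) (hd : defect (indepPoly banner) = 6) : Listed G := by
  by_cases h4 : w = 4
  · subst h4
    exact h.listed_of_leaf he hd (by decide +kernel) (Or.inr (Or.inr (Or.inr (Or.inr (Or.inl
      (h.nonempty_iso (isLeafExt_castSucc (by decide +kernel) (by decide +kernel))))))))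
  · exact h.listed_of_two_adj he hd (by clear h; revert w; decide +kernel) (by clear h; revert w; decide +kernel)

lemma IsLeafExt.listed_graphB {w : Fin 6} {G : SimpleGraph V} (h : IsLeafExt graphB w G)
    (he : excess (indepPoly graphB) = 0) (hd : defect (indepPoly graphB) = 6) : Listed G := by
  by_cases h5 : w = 5
  · subst h5
    exact h.listed_of_leaf he hd (by decide +kernel) (Or.inr (Or.inr (Or.inr (Or.inr (Or.inr
      (Or.inl (h.nonempty_iso (isLeafExt_castSucc (by decide +kernel) (by decide +kernel)))))))))
  · exact h.listed_of_two_adj he hd (by clear h; revert w; decide +kernel) (by clear h; revert w; decide +kernel)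

lemma IsLeafExt.listed_graphB' {w : Fin 7} {G : SimpleGraph V} (hpos : PositiveOn G Finset.univ)
    (h : IsLeafExt graphB' w G)
    (he : excess (indepPoly graphB') = 0) (hd : defect (indepPoly graphB') = 6) : Listed G := by
  by_cases h6 : w = 6
  · exact (h.false_of_weight hpos (by clear h; revert w; decide +kernel)).elim
  · exact h.listed_of_two_adj he hd (by clear h; revert w; decide +kernel) (by clear h; revert w; decide +kernel)

lemma IsLeafExt.listed_graphC {w : Fin 6} {G : SimpleGraph V} (hpos : PositiveOn G Finset.univ)
    (h : IsLeafExt graphC w G)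
    (he : excess (indepPoly graphC) = 0) (hd : defect (indepPoly graphC) = 6) : Listed G := by
  by_cases h5 : w = 5
  · exact (h.false_of_weight hpos (by clear h; revert w; decide +kernel)).elim
  · exact h.listed_of_two_adj he hd (by clear h; revert w; decide +kernel) (by clear h; revert w; decide +kernel)

lemma IsLeafExt.listed_graphC' {w : Fin 7} {G : SimpleGraph V} (hpos : PositiveOn G Finset.univ)
    (h : IsLeafExt graphC' w G)
    (he : excess (indepPoly graphC') = 0) (hd : defect (indepPoly graphC') = 6) : Listed G := by
  by_cases h6 : w = 6
  · exact (h.false_of_weight hpos (by clear h; revert w; decide +kernel)).elim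
  · exact h.listed_of_two_adj he hd (by clear h; revert w; decide +kernel) (by clear h; revert w; decide +kernel)

/-! ### Trees and the diamond -/

lemma IsLeafExt.listed_pathGraph {k : ℕ} {w : Fin k} {G : SimpleGraph V}
    (h : IsLeafExt (pathGraph k) w G) (he : excess (indepPoly (pathGraph k)) < 0) : Listed G := by
  refine Or.inl ⟨h.excess_defect.1.trans_lt he, ?_⟩
  obtain ⟨i, hi⟩ := w
  by_cases hl : i + 1 = k
  · refine Or.inl ⟨k + 1, h.nonempty_iso (isLeafExt_castSucc ?_ ?_)⟩
    · intro a b; simp [pathGraph_adj]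
    · intro a; simp [pathGraph_adj, Fin.ext_iff]; omega
  by_cases h0 : i = 0
  · refine Or.inl ⟨k + 1, h.nonempty_iso (isLeafExt_mk Fin.succ 0 (Fin.succ_injective k) ?_ ?_ ?_)⟩
    · intro a; exact Fin.succ_ne_zero a
    · intro a b; simp [pathGraph_adj]
    · intro a; simp [pathGraph_adj, Fin.ext_iff]; omega
  · obtain ⟨f, z, hfz, _, hz, _⟩ := h.isLeaf
    refine Or.inr ⟨f ⟨i, hi⟩, z, f ⟨i - 1, by omega⟩, f ⟨i + 1, by omega⟩, (hfz _).symm,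
      (hfz _).symm, ?_, hz, ?_, ?_⟩
    · rw [f.injective.ne_iff]; simp [Fin.ext_iff]
    · rw [f.map_adj_iff]; simp [pathGraph_adj]; omega
    · rw [f.map_adj_iff]; simp [pathGraph_adj]

/-- For trees it is enough to know whether they are paths: trees are eventually discarded by their
excess, and only paths matter when an added edge closes a cycle without creating a branch vertex. -/
lemma IsLeafExt.listed_of_hasBranch {F : SimpleGraph W} {w : W} {G : SimpleGraph V}
    (h : IsLeafExt F w G) (he : excess (indepPoly F) < 0) (hb : HasBranch F) : Listed G := by
  refine Or.inl ⟨h.excess_defect.1.trans_lt he, Or.inr ?_⟩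
  obtain ⟨f, z, _⟩ := h
  obtain ⟨v, a, b, c, hab, hac, hbc, ha, hb, hc⟩ := hb
  exact ⟨f v, f a, f b, f c, f.injective.ne hab, f.injective.ne hac, f.injective.ne hbc,
    f.map_adj_iff.2 ha, f.map_adj_iff.2 hb, f.map_adj_iff.2 hc⟩

/-- The diamond has weight 1, while deleting a vertex leaves a triangle of weight 2 or a
three-vertex path of weight `5/2`. -/
lemma IsLeafExt.not_diamond {w : Fin 4} {G : SimpleGraph V} (hpos : PositiveOn G Finset.univ)
    (h : IsLeafExt diamond w G) : False :=
  h.false_of_weight hpos (by clear h; revert w; decide +kernel)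

/-- Adding a pendant vertex to a listed graph that keeps at least one edge. -/
lemma Listed.leafExt {F : SimpleGraph W} {w : W} {G : SimpleGraph V} (hF : Listed F)
    (hw : F.Connected) (hpos : PositiveOn G Finset.univ) (h : IsLeafExt F w G) : Listed G := by
  rcases hF with ⟨he, ⟨k, ⟨e⟩⟩ | hb⟩ | ⟨⟨e⟩⟩ | ⟨he, ⟨hd, hl⟩ | ⟨⟨e⟩⟩ | ⟨k, hk, ⟨⟨e⟩⟩ | ⟨⟨e⟩⟩⟩ |
      ⟨hd, ⟨k, hk, ⟨e⟩⟩ | hs⟩⟩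
  · exact (h.congr_iso e).listed_pathGraph (by rwa [← indepPoly_iso e])
  · exact h.listed_of_hasBranch he hb
  · exact ((h.congr_iso e).not_diamond hpos).elim
  · exact h.listed_of_large_defect hw he hd hl
  · exact (h.congr_iso e).listed_cycleGraph le_rfl hpos
  · exact (h.congr_iso e).listed_cycleGraph (by omega) hpos
  · exact (h.congr_iso e).listed_dGraph hk hpos
  · rw [indepPoly_iso e] at he hd
    exact (h.congr_iso e).listed_eGraph hk hpos he hd
  · rcases hs with ⟨⟨e⟩⟩ | ⟨⟨e⟩⟩ | ⟨⟨e⟩⟩ | ⟨⟨e⟩⟩ | ⟨⟨e⟩⟩ | ⟨⟨e⟩⟩ | ⟨⟨e⟩⟩ | ⟨⟨e⟩⟩ <;>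
      rw [indepPoly_iso e] at he hd <;> replace h := h.congr_iso e
    · exact h.listed_bull he hd
    · exact h.listed_graphA hpos he hd
    · exact h.listed_graphA' hpos he hd
    · exact h.listed_banner he hd
    · exact h.listed_graphB he hd
    · exact h.listed_graphB' hpos he hd
    · exact h.listed_graphC hpos he hd
    · exact h.listed_graphC' hpos he hd

end LeafSteps

/-! ### Edges added to listed graphs. -/

section EdgeSteps

variable {V W : Type*}

lemma PositiveOn.iso [Fintype V] [Fintype W] {G : SimpleGraph V} {H : SimpleGraph W}
    (h : PositiveOn G Finset.univ) (e : G ≃g H) : PositiveOn H Finset.univ :=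
  h.embedding e.symm.toEmbedding

/-- An isomorphism extends over an added edge. -/
def supEdgeIso {F : SimpleGraph V} {H : SimpleGraph W} (e : F ≃g H) (a b : V) :
    F ⊔ edge a b ≃g H ⊔ edge (e a) (e b) :=
  ⟨e.toEquiv, by
    intro x y
    change (H ⊔ edge (e a) (e b)).Adj (e x) (e y) ↔ _
    simp [sup_adj, edge_adj, e.map_adj_iff, e.injective.eq_iff]⟩

lemma excess_sup_edge [Fintype V] {F : SimpleGraph V} {a b : V} (hab : a ≠ b)
    (hF : ¬ F.Adj a b) :
    excess (indepPoly (F ⊔ edge a b)) = excess (indepPoly F) + 2 := by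
  classical
  have h := indepSum_sup_edge (X : ℤ[X]) (Finset.mem_univ a) (Finset.mem_univ b) hab hF
    (T := {u | u ≠ a ∧ u ≠ b ∧ ¬ F.Adj a u ∧ ¬ F.Adj b u}) (by simp)
  set T : Finset V := {u | u ≠ a ∧ u ≠ b ∧ ¬ F.Adj a u ∧ ¬ F.Adj b u}
  have h0 := indepCoeff_zero F T
  rw [indepCoeff] at h0
  have h1 := congrArg (fun p : ℤ[X] => p.coeff 1) h
  have h2 := congrArg (fun p : ℤ[X] => p.coeff 2) h
  simp only [coeff_sub, coeff_X_pow_mul'] at h1 h2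
  norm_num at h1 h2
  rw [h0] at h2
  rw [excess, excess, indepPoly_eq_indepSum, indepPoly_eq_indepSum, h1, h2]
  ring

/-- The new weight is `2 - 2 ^ s / 16 * weight F T`, where `s` is the number of vertices in the
closed neighbourhoods of `a` and `b`. It is nonpositive once `2 ^ s * weight F T ≥ 32`; `l` lists
enough of those vertices, so five suffice if the weight of `T` is at least 1, and four if it is 2.
-/
lemma weight_sup_edge_nonpos [Fintype W] {F : SimpleGraph W} (hF : weight F Finset.univ = 2)
    {a b : W} (hab : a ≠ b) (hG : ¬ F.Adj a b) {T : Finset W}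
    (hT : ∀ u, u ∈ T ↔ u ≠ a ∧ u ≠ b ∧ ¬ F.Adj a u ∧ ¬ F.Adj b u) {l : List W} (hl : l.Nodup)
    (hlT : ∀ u ∈ l, u = a ∨ u = b ∨ F.Adj a u ∨ F.Adj b u)
    (hw : 0 < weight F T) (hlw : 32 ≤ 2 ^ l.length * weight F T) :
    weight (F ⊔ edge a b) Finset.univ ≤ 0 := by
  classical
  have hdis : Disjoint l.toFinset T := by
    rw [Finset.disjoint_left]
    intro u hu hu'
    have := hlT u (by simpa using hu)
    have := (hT u).1 hu'
    tauto
  have hcard : l.length + T.card ≤ (Finset.univ : Finset W).card := by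
    rw [← List.toFinset_card_of_nodup hl, ← Finset.card_union_of_disjoint hdis]
    exact Finset.card_le_card (Finset.subset_univ _)
  rw [weight_sup_edge (Finset.mem_univ a) (Finset.mem_univ b) hab hG (T := T) (by simpa using hT)
    (s := (Finset.univ : Finset W).card - T.card) (by omega), hF]
  have h1 : (2 : ℝ) ^ l.length ≤ 2 ^ ((Finset.univ : Finset W).card - T.card) :=
    pow_le_pow_right₀ (by norm_num) (by omega)
  have h2 := mul_le_mul_of_nonneg_right h1 hw.le
  linarith

lemma one_le_weight_of_tail {n : ℕ} {F : SimpleGraph (Fin n)} {T : Finset (Fin n)}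
    (h : ∀ a ∈ T, ∀ b ∈ T, tailGraph.Adj a.val b.val ↔ F.Adj a b) : 1 ≤ weight F T := by
  classical
  rw [weight_bijOn (T := T.image Fin.val) Fin.val (by
    rw [Finset.coe_image]; exact Fin.val_injective.injOn.bijOn_image) h]
  exact one_le_weight_tail _

/-- After a rotation the chord starts at 0. The set `T` then avoids 0, so it lies in a path of the
tail graph and has weight at least 1, and the closed neighbourhoods of the ends contain five
vertices. -/
lemma not_positiveOn_chord {k : ℕ} (hk : 5 ≤ k) {a b : Fin k} (hab : a ≠ b)
    (hadj : ¬ (cycleGraph k).Adj a b)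
    (hpos : PositiveOn (cycleGraph k ⊔ edge a b) Finset.univ) : False := by
  classical
  obtain ⟨e, he⟩ := exists_cycle_iso_zero (show 0 < k by omega) a
  replace hpos := (hpos.iso (supEdgeIso e a b)).weight_pos
  rw [← e.injective.ne_iff, he] at hab
  rw [← e.map_adj_iff, he] at hadj
  rw [he] at hpos
  generalize e b = c at *
  obtain ⟨i, hi⟩ := c
  have hi' : 2 ≤ i ∧ i + 2 ≤ k := by
    simp only [cycleGraph_adj_val, ne_eq, Fin.ext_iff, true_and] at hab hadj; omega
  set T : Finset (Fin k) := {u | u ≠ ⟨0, by omega⟩ ∧ u ≠ ⟨i, hi⟩ ∧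
    ¬ (cycleGraph k).Adj ⟨0, by omega⟩ u ∧ ¬ (cycleGraph k).Adj ⟨i, hi⟩ u} with hTdef
  have hT1 : 1 ≤ weight (cycleGraph k) T := by
    refine one_le_weight_of_tail fun x hx y hy => ?_
    simp only [hTdef, Finset.mem_filter, cycleGraph_adj_val, ne_eq, Fin.ext_iff] at hx hy
    simp only [tailGraph_adj, cycleGraph_adj_val]
    omega
  -- The two ends may share one neighbour of `i`; `j` is a neighbour of `i` that is not adjacent to
  -- 0.
  obtain ⟨j, hj, hj'⟩ : ∃ j, j + 2 ≤ k ∧ (2 ≤ j ∧ (j = i + 1 ∨ j + 1 = i)) := by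
    by_cases h : i + 3 ≤ k
    · exact ⟨i + 1, by omega, by omega, Or.inl rfl⟩
    · exact ⟨i - 1, by omega, by omega, Or.inr (by omega)⟩
  refine absurd hpos (not_lt.2 (weight_sup_edge_nonpos (weight_cycleGraph (by omega)) hab hadj
    (T := T) (by simp [hTdef]) (l := [⟨0, by omega⟩, ⟨1, by omega⟩, ⟨k - 1, by omega⟩, ⟨i, hi⟩,
      ⟨j, by omega⟩]) ?_ ?_ (by linarith) ?_))
  · simp only [List.nodup_cons, List.mem_cons, List.not_mem_nil, Fin.mk.injEq, or_false,
      not_false_eq_true, List.nodup_nil, and_true]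
    omega
  · simp only [List.mem_cons, List.not_mem_nil, or_false, cycleGraph_adj_val]
    rintro u (rfl | rfl | rfl | rfl | rfl) <;>
        simp only [Fin.mk.injEq, true_or, or_true, true_and,
          and_true] <;> omega
  · simp only [List.length_cons, List.length_nil]; norm_num; linarith

lemma not_positiveOn_dGraph_edge {k : ℕ} (hk : 5 ≤ k) {a b : Fin k} (ha : a.val + 2 < k)
    (hb : b.val + 1 = k) (hpos : PositiveOn (dGraph k ⊔ edge a b) Finset.univ) : False := by
  classical
  replace hpos := hpos.weight_pos
  obtain ⟨i, hi⟩ := a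
  obtain ⟨j, hj⟩ := b
  simp only at ha hb
  have hab : (⟨i, hi⟩ : Fin k) ≠ ⟨j, hj⟩ := by simp [Fin.ext_iff]; omega
  have hadj : ¬ (dGraph k).Adj ⟨i, hi⟩ ⟨j, hj⟩ := by
    simp only [dGraph_adj, tailGraph_adj]; omega
  set T : Finset (Fin k) := {u | u ≠ ⟨i, hi⟩ ∧ u ≠ ⟨j, hj⟩ ∧
    ¬ (dGraph k).Adj ⟨i, hi⟩ u ∧ ¬ (dGraph k).Adj ⟨j, hj⟩ u} with hTdef
  have hT1 : 1 ≤ weight (dGraph k) T :=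
    one_le_weight_of_tail fun x hx y hy => dGraph_adj.symm
  have key : ∀ l : List (Fin k), l.Nodup →
      (∀ u ∈ l, u = ⟨i, hi⟩ ∨ u = ⟨j, hj⟩ ∨ (dGraph k).Adj ⟨i, hi⟩ u ∨
        (dGraph k).Adj ⟨j, hj⟩ u) → 32 ≤ 2 ^ l.length * weight (dGraph k) T → False := by
    intro l h1 h2 h3
    exact absurd hpos (not_lt.2 (weight_sup_edge_nonpos (weight_dGraph_univ (by omega)) hab hadj
      (T := T) (by simp [hTdef]) h1 h2 (by linarith) h3))
  have hcase : i ≤ 1 ∨ i = 2 ∨ (3 ≤ i ∧ i + 4 ≤ k) ∨ (3 ≤ i ∧ i + 3 = k) := by omega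
  rcases hcase with h | h | h | h
  · refine key [⟨0, by omega⟩, ⟨1, by omega⟩, ⟨2, by omega⟩, ⟨k - 2, by omega⟩, ⟨j, hj⟩] ?_ ?_ ?_
    · simp only [List.nodup_cons, List.mem_cons, List.not_mem_nil, Fin.mk.injEq, or_false,
        not_false_eq_true, List.nodup_nil, and_true]
      omega
    · simp only [List.mem_cons, List.not_mem_nil, or_false, dGraph_adj, tailGraph_adj]
      rintro u (rfl | rfl | rfl | rfl | rfl) <;>
        simp only [Fin.mk.injEq, true_or, or_true, true_and,
          and_true] <;> omega
    · simp only [List.length_cons, List.length_nil]; norm_num; linarith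
  · refine key [⟨0, by omega⟩, ⟨1, by omega⟩, ⟨2, by omega⟩, ⟨3, by omega⟩, ⟨j, hj⟩] ?_ ?_ ?_
    · simp only [List.nodup_cons, List.mem_cons, List.not_mem_nil, Fin.mk.injEq, or_false,
        not_false_eq_true, List.nodup_nil, and_true]
      omega
    · simp only [List.mem_cons, List.not_mem_nil, or_false, dGraph_adj, tailGraph_adj]
      rintro u (rfl | rfl | rfl | rfl | rfl) <;>
        simp only [Fin.mk.injEq, true_or, or_true, true_and,
          and_true] <;> omega
    · simp only [List.length_cons, List.length_nil]; norm_num; linarith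
  · refine key [⟨i - 1, by omega⟩, ⟨i, by omega⟩, ⟨i + 1, by omega⟩, ⟨k - 2, by omega⟩,
      ⟨j, hj⟩] ?_ ?_ ?_
    · simp only [List.nodup_cons, List.mem_cons, List.not_mem_nil, Fin.mk.injEq, or_false,
        not_false_eq_true, List.nodup_nil, and_true]
      omega
    · simp only [List.mem_cons, List.not_mem_nil, or_false, dGraph_adj, tailGraph_adj]
      rintro u (rfl | rfl | rfl | rfl | rfl) <;>
        simp only [Fin.mk.injEq, true_or, or_true] <;> omega
    · simp only [List.length_cons, List.length_nil]; norm_num; linarith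
  -- For `i = k - 3` the ends share the neighbour `k - 2`, and only four vertices are covered. In
  -- return `T` is `range (i - 1)`, of weight exactly 2, so the product is still 32.
  · have hT2 : weight (dGraph k) T = 2 := by
      rw [weight_dGraph (T := Finset.range (i - 1)), weight_tail_range (by omega)]
      intro m
      simp only [hTdef, Finset.mem_range, Finset.mem_filter, Finset.mem_univ, true_and,
        dGraph_adj, tailGraph_adj, ne_eq, Fin.mk.injEq]
      constructor
      · intro hm; exact ⟨by omega, by omega⟩
      · rintro ⟨h1, h2⟩; omega
    refine key [⟨i - 1, by omega⟩, ⟨i, by omega⟩, ⟨i + 1, by omega⟩, ⟨j, hj⟩] ?_ ?_ ?_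
    · simp only [List.nodup_cons, List.mem_cons, List.not_mem_nil, Fin.mk.injEq, or_false,
        not_false_eq_true, List.nodup_nil, and_true]
      omega
    · simp only [List.mem_cons, List.not_mem_nil, or_false, dGraph_adj, tailGraph_adj]
      rintro u (rfl | rfl | rfl | rfl) <;>
        simp only [Fin.mk.injEq, true_or, or_true]
      omega
    · simp only [List.length_cons, List.length_nil]; norm_num; linarith

lemma not_positiveOn_of_weightList {n : ℕ} {F : SimpleGraph (Fin n)} [DecidableRel F.Adj]
    (h : weightList F (List.finRange n) ≤ 0) (hpos : PositiveOn F Finset.univ) : False := by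
  have := hpos.weight_pos
  rw [weight_univ_eq_weightList] at this
  exact absurd (by exact_mod_cast this) (not_lt.2 h)

lemma nonempty_iso_of_perm {n : ℕ} {F H : SimpleGraph (Fin n)} (f : Fin n → Fin n)
    (hf : Function.Injective f) (h : ∀ a b, H.Adj (f a) (f b) ↔ F.Adj a b) :
    Nonempty (F ≃g H) :=
  ⟨⟨Equiv.ofBijective f (Finite.injective_iff_bijective.1 hf), h _ _⟩⟩

lemma cycle_four_chord {a b : Fin 4} (hab : a ≠ b) (h : ¬ (cycleGraph 4).Adj a b) :
    Nonempty (cycleGraph 4 ⊔ edge a b ≃g diamond) := by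
  refine nonempty_iso_of_perm (fun i => i - a) (sub_left_injective) ?_
  revert a b
  decide +kernel

lemma dGraph_four_edge {a : Fin 4} (ha : a.val < 2) :
    Nonempty (dGraph 4 ⊔ edge a 3 ≃g diamond) := by
  refine nonempty_iso_of_perm (fun i => if i = a then 0 else if i = 2 then 2
    else if i = 3 then 3 else 1) ?_ ?_
  · revert a; decide +kernel
  · revert a; decide +kernel

/-- An end of the path that is not an end of the new edge would remain a leaf, so the edge joins
both ends of the path. -/
lemma pathGraph_edge_eq {k : ℕ} {a b : Fin k} (hab : a ≠ b) (hadj : ¬ (pathGraph k).Adj a b)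
    (hl : ∀ z, ¬ IsLeaf (pathGraph k ⊔ edge a b) z) :
    3 ≤ k ∧ pathGraph k ⊔ edge a b = cycleGraph k := by
  obtain ⟨i, hi⟩ := a
  obtain ⟨j, hj⟩ := b
  simp only [pathGraph_adj, ne_eq, Fin.mk.injEq] at hab hadj
  have hk : 3 ≤ k := by omega
  have h0 : i = 0 ∨ j = 0 := by
    by_contra h
    refine hl ⟨0, by omega⟩ ⟨⟨1, by omega⟩, fun w => ?_⟩
    simp only [sup_adj, edge_adj, pathGraph_adj, Fin.ext_iff]; omega
  have h1 : i + 1 = k ∨ j + 1 = k := by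
    by_contra h
    refine hl ⟨k - 1, by omega⟩ ⟨⟨k - 2, by omega⟩, fun w => ?_⟩
    have := w.2
    simp only [sup_adj, edge_adj, pathGraph_adj, Fin.ext_iff]; omega
  refine ⟨hk, ?_⟩
  ext x y
  have := x.2
  have := y.2
  simp only [sup_adj, edge_adj, pathGraph_adj, cycleGraph_adj_val, Fin.ext_iff, ne_eq]; omega

/-- Joining the only leaf of a listed unicyclic graph to another vertex yields the diamond. -/
lemma UnicyclicListed.sup_edge [Fintype V] {F : SimpleGraph V} (hF : UnicyclicListed F) {a b : V}
    (hab : a ≠ b) (hadj : ¬ F.Adj a b) (hl : ∀ z, IsLeaf F z → z = b)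
    (hpos : PositiveOn (F ⊔ edge a b) Finset.univ) :
    Nonempty (F ⊔ edge a b ≃g diamond) := by
  -- The only possible leaf of `F` is `b`. Graphs with two leaves are excluded by `two`; for graphs
  -- with one leaf, `one` says that it is an end of the new edge.
  have two : ∀ {n : ℕ} {H : SimpleGraph (Fin n)} (e : F ≃g H) (x y : Fin n), x ≠ y →
      (∃ u, ∀ w, H.Adj x w ↔ w = u) → (∃ u, ∀ w, H.Adj y w ↔ w = u) → False := by
    intro n H e x y hxy hx hy
    have h1 := hl _ (IsLeaf.iso hx e.symm)
    have h2 := hl _ (IsLeaf.iso hy e.symm)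
    exact hxy (e.symm.injective (h1.trans h2.symm))
  have one : ∀ {n : ℕ} {H : SimpleGraph (Fin n)} (e : F ≃g H) (x : Fin n),
      (∃ u, ∀ w, H.Adj x w ↔ w = u) → ∃ y : Fin n, y ≠ x ∧ ¬ H.Adj y x ∧
        PositiveOn (H ⊔ edge y x) Finset.univ ∧ Nonempty (F ⊔ edge a b ≃g H ⊔ edge y x) := by
    intro n H e x hx
    have h1 := hl _ (IsLeaf.iso hx e.symm)
    have h2 : e b = x := by rw [← h1]; simp
    refine ⟨e a, ?_, ?_, ?_, ?_⟩
    · rw [← h2, e.injective.ne_iff]; exact hab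
    · rwa [← h2, e.map_adj_iff]
    · rw [← h2]; exact hpos.iso (supEdgeIso e a b)
    · rw [← h2]; exact ⟨supEdgeIso e a b⟩
  rcases hF with ⟨hd, u, v, huv, hu, hv⟩ | ⟨⟨e⟩⟩ | ⟨k, hk, ⟨⟨e⟩⟩ | ⟨⟨e⟩⟩⟩ |
      ⟨hd, ⟨k, hk, ⟨e⟩⟩ | hs⟩
  · exact absurd ((hl u hu).trans (hl v hv).symm) huv
  · refine absurd (e.map_adj_iff.1 ?_) hadj
    have : ∀ x y : Fin 3, x ≠ y → (cycleGraph 3).Adj x y := by decide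
    exact this _ _ (e.injective.ne hab)
  · rcases hk.eq_or_lt with rfl | hk
    · obtain ⟨e'⟩ := cycle_four_chord (e.injective.ne hab) (by rwa [e.map_adj_iff])
      exact ⟨(supEdgeIso e a b).trans e'⟩
    · exact (not_positiveOn_chord hk (e.injective.ne hab) (by rwa [e.map_adj_iff])
        (hpos.iso (supEdgeIso e a b))).elim
  · obtain ⟨y, hy, hya, hyp, ⟨e'⟩⟩ := one e ⟨k - 1, by omega⟩ (isLeaf_dGraph hk)
    have h2 : y.val + 2 < k := by
      simp only [dGraph_adj, tailGraph_adj, ne_eq, Fin.ext_iff] at hy hya; omega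
    rcases hk.eq_or_lt with rfl | hk
    · obtain ⟨e''⟩ := dGraph_four_edge (a := y) (by omega)
      exact ⟨e'.trans e''⟩
    · exact (not_positiveOn_dGraph_edge hk h2 (by simp; omega) hyp).elim
  · exact (two e _ _ (by simp [Fin.ext_iff]; omega) (isLeaf_eGraph_last hk)
      (isLeaf_eGraph_pred hk)).elim
  · exfalso
    rcases hs with ⟨⟨e⟩⟩ | ⟨⟨e⟩⟩ | ⟨⟨e⟩⟩ | ⟨⟨e⟩⟩ | ⟨⟨e⟩⟩ | ⟨⟨e⟩⟩ | ⟨⟨e⟩⟩ | ⟨⟨e⟩⟩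
    · exact two e 0 4 (by decide) (by decide +kernel) (by decide +kernel)
    · exact two e 0 5 (by decide) (by decide +kernel) (by decide +kernel)
    · exact two e 0 6 (by decide) (by decide +kernel) (by decide +kernel)
    · obtain ⟨y, hy, hya, hyp, hiso⟩ := one e 4 (by decide +kernel)
      exact not_positiveOn_of_weightList (by clear hyp hiso; revert y; decide +kernel) hyp
    · obtain ⟨y, hy, hya, hyp, hiso⟩ := one e 5 (by decide +kernel)
      exact not_positiveOn_of_weightList (by clear hyp hiso; revert y; decide +kernel) hyp
    · obtain ⟨y, hy, hya, hyp, hiso⟩ := one e 6 (by decide +kernel)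
      exact not_positiveOn_of_weightList (by clear hyp hiso; revert y; decide +kernel) hyp
    · obtain ⟨y, hy, hya, hyp, hiso⟩ := one e 5 (by decide +kernel)
      exact not_positiveOn_of_weightList (by clear hyp hiso; revert y; decide +kernel) hyp
    · obtain ⟨y, hy, hya, hyp, hiso⟩ := one e 6 (by decide +kernel)
      exact not_positiveOn_of_weightList (by clear hyp hiso; revert y; decide +kernel) hyp

lemma not_positiveOn_diamond_edge {a b : Fin 4} (hab : a ≠ b) (hadj : ¬ diamond.Adj a b)
    (hpos : PositiveOn (diamond ⊔ edge a b) Finset.univ) : False :=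
  not_positiveOn_of_weightList (by clear hpos; revert a b; decide +kernel) hpos

end EdgeSteps

/-! ### Classification of connected graphs positive on `[-1/4, 0]`. -/

section Classification

variable {V : Type*}

lemma exists_two_adj_of_not_isLeaf [Nontrivial V] {G : SimpleGraph V} (hG : G.Connected) {v : V}
    (h : ¬ IsLeaf G v) : ∃ x y, x ≠ y ∧ G.Adj v x ∧ G.Adj v y := by
  obtain ⟨x, hx⟩ := hG.preconnected.exists_adj_of_nontrivial v
  by_contra! hcon
  refine h ⟨x, fun w => ⟨fun hw => ?_, fun e => e ▸ hx⟩⟩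
  by_contra hne
  exact hcon w x hne hw hx

/-- In a connected leafless graph with a branch vertex, some edge at a branch vertex lies on a
cycle. -/
lemma exists_not_isBridge [Fintype V] [Nontrivial V] {G : SimpleGraph V} (hG : G.Connected)
    (hl : ∀ v, ¬ IsLeaf G v) (hb : HasBranch G) :
    ∃ a b, G.Adj a b ∧ ¬ G.IsBridge s(a, b) ∧ ∃ x y, x ≠ y ∧ x ≠ b ∧ y ≠ b ∧
      G.Adj a x ∧ G.Adj a y := by
  classical
  by_contra! hcon
  have hna : ¬ G.IsAcyclic := by
    intro hac
    have hT : G.IsTree := ⟨hG, hac⟩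
    obtain ⟨v, hv⟩ := hT.exists_vert_degree_one_of_nontrivial
    obtain ⟨u, hu, huu⟩ := degree_eq_one_iff_existsUnique_adj.1 hv
    exact hl v ⟨u, fun w => ⟨fun hw => huu w hw, fun e => e ▸ hu⟩⟩
  rw [isAcyclic_iff_forall_isBridge] at hna
  push Not at hna
  obtain ⟨e, he, hnb⟩ := hna
  induction e with | h p q =>
  have he' : G.Adj p q := he
  -- Under `hcon` the end `x` of a non-bridge `xy` has at most one further neighbour `z`. A cycle
  -- through `xy` uses two edges at `x`, so it also uses `xz`. By connectivity every vertex then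
  -- lies on a non-bridge, which is impossible at a branch vertex.
  have step : ∀ x y, G.Adj x y → ¬ G.IsBridge s(x, y) → ∀ z, G.Adj x z →
      ¬ G.IsBridge s(x, z) := by
    intro x y hxy hxb z hxz
    by_cases hzy : z = y
    · exact hzy ▸ hxb
    rw [isBridge_iff_forall_cycle_notMem (by simpa using hxy)] at hxb
    push Not at hxb
    obtain ⟨u, c, hc, hce⟩ := hxb
    have hx : x ∈ c.support := c.fst_mem_support_of_mem_edges hce
    have h2 := hc.ncard_neighborSet_toSubgraph_eq_two hx
    have hsub : c.toSubgraph.neighborSet x ⊆ ({y, z} : Set V) := by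
      intro w hw
      have hw' : G.Adj x w := c.toSubgraph.adj_sub hw
      by_contra hne
      simp only [Set.mem_insert_iff, Set.mem_singleton_iff, not_or] at hne
      have hxb' : ¬ G.IsBridge s(x, y) := fun hb => hb.notMem_edges_of_isCycle hc hce
      exact hcon x y hxy hxb' w z hne.2 hne.1 hzy hw' hxz
    have heq := Set.eq_of_subset_of_ncard_le hsub (by rw [h2, Set.ncard_pair (Ne.symm hzy)])
      (Set.toFinite _)
    have hz : z ∈ c.toSubgraph.neighborSet x := by rw [heq]; simp
    intro hbr
    refine hbr.notMem_edges_of_isCycle hc ?_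
    rw [← Walk.mem_edges_toSubgraph]
    exact hz
  have all : ∀ v, ∃ w, G.Adj v w ∧ ¬ G.IsBridge s(v, w) := by
    intro v
    obtain ⟨W⟩ := hG.preconnected p v
    have : ∀ u v : V, ∀ W : G.Walk u v, (∃ w, G.Adj u w ∧ ¬ G.IsBridge s(u, w)) →
        ∃ w, G.Adj v w ∧ ¬ G.IsBridge s(v, w) := by
      intro u v W
      induction W with
      | nil => exact id
      | cons h W ih =>
        rintro ⟨w, hw, hwb⟩
        refine ih ⟨_, h.symm, ?_⟩
        rw [Sym2.eq_swap]
        exact step _ w hw hwb _ h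
    exact this p v W ⟨q, he', hnb⟩
  obtain ⟨v, x, y, z, hxy, hxz, hyz, hx, hy, hz⟩ := hb
  obtain ⟨w, hw, hwb⟩ := all v
  by_cases hxw : x = w
  · subst hxw; exact hcon v x hw hwb y z hyz hxy.symm hxz.symm hy hz
  by_cases hyw : y = w
  · subst hyw; exact hcon v y hw hwb x z hxz hxy hyz.symm hx hz
  · exact hcon v w hw hwb x y hxy hxw hyw hx hy

lemma sup_edge_deleteEdges {G : SimpleGraph V} {a b : V} (h : G.Adj a b) :
    G.deleteEdges {s(a, b)} ⊔ edge a b = G := by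
  ext x y
  simp only [sup_adj, deleteEdges_adj, edge_adj, Set.mem_singleton_iff, Sym2.eq_iff]
  constructor
  · rintro (h1 | ⟨⟨rfl, rfl⟩ | ⟨rfl, rfl⟩, _⟩)
    · exact h1.1
    · exact h
    · exact h.symm
  · intro h1
    have := h1.ne
    tauto

lemma excess_even (p : ℤ[X]) : Even (excess p) := by
  have h : excess p = p.coeff 1 * (p.coeff 1 + 1) - (2 * p.coeff 1 + p.coeff 2) * 2 := by
    rw [excess]; ring
  rw [h]
  exact (Int.even_mul_succ_self _).sub (even_two.mul_left _)

/-- With a branch vertex, a non-bridge `ab` is deleted at a vertex `a` that keeps two neighbours, so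
at most `b` becomes a leaf; restoring the edge can then only give the diamond. Without a branch
vertex the graph is 2-regular, and deleting any edge leaves a path. -/
lemma listed_of_noLeaf [Fintype V] [Nontrivial V] {G : SimpleGraph V} (hG : G.Connected)
    (hpos : PositiveOn G Finset.univ) (hl : ∀ v, ¬ IsLeaf G v)
    (ih : ∀ a b, G.Adj a b → (G.deleteEdges {s(a, b)}).Connected →
      PositiveOn (G.deleteEdges {s(a, b)}) Finset.univ → Listed (G.deleteEdges {s(a, b)})) :
    Listed G := by
  classical
  have hdeg : ∀ v, ((G.degree v : ℤ) - 2) = (G.neighborSet v).ncard - 2 := by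
    intro v
    rw [← card_neighborSet_eq_degree, ← Nat.card_eq_fintype_card]; rfl
  have h2 : ∀ v, 2 ≤ (G.neighborSet v).ncard := by
    intro v
    obtain ⟨x, y, hxy, hx, hy⟩ := exists_two_adj_of_not_isLeaf hG (hl v)
    exact two_le_ncard hxy hx hy
  by_cases hb : HasBranch G
  · obtain ⟨a, b, hab, hbr, x, y, hxy, hxb, hyb, hx, hy⟩ := exists_not_isBridge hG hl hb
    have hsup := sup_edge_deleteEdges hab
    set F := G.deleteEdges {s(a, b)} with hF
    have hFadj : ¬ F.Adj a b := by simp [hF]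
    have hFc : F.Connected := hG.connected_delete_edge_of_not_isBridge hbr
    have hp' : PositiveOn (F ⊔ edge a b) Finset.univ := by rwa [hsup]
    have hFl : Listed F := ih a b hab hFc
      (hp'.of_sup_edge (Finset.mem_univ _) (Finset.mem_univ _) hab.ne hFadj)
    have hFx : ∀ z, z ≠ b → G.Adj a z → F.Adj a z := by
      intro z hz haz
      simp only [hF, deleteEdges_adj, haz, true_and, Set.mem_singleton_iff, Sym2.eq_iff]
      have := hab.ne
      tauto
    have hleaf : ∀ z, IsLeaf F z → z = b := by
      rintro z ⟨u, hu⟩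
      by_contra hzb
      by_cases hza : z = a
      · subst hza
        exact hxy (((hu x).1 (hFx x hxb hx)).trans ((hu y).1 (hFx y hyb hy)).symm)
      · refine hl z ⟨u, fun w => ?_⟩
        rw [← hu, hF, deleteEdges_adj, Set.mem_singleton_iff, Sym2.eq_iff]
        tauto
    rcases hFl with ⟨he, _⟩ | ⟨⟨e⟩⟩ | ⟨_, hu⟩
    · exfalso
      have h3 := excess_sup_edge hab.ne hFadj
      rw [hsup] at h3
      have h4 : 0 < excess (indepPoly G) := by
        rw [excess_eq_sum_degree]
        refine Finset.sum_pos' (fun v _ => ?_) ⟨a, Finset.mem_univ _, ?_⟩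
        · rw [hdeg]; have := h2 v; omega
        · have := three_le_ncard hxy hxb hyb hx hy hab
          rw [hdeg]; omega
      -- Minimum degree two and a branch vertex make the excess of `G` positive, hence at least 2 by
      -- parity; so `F`, with one edge less, has excess at least 0 and is not a tree.
      obtain ⟨m, hm⟩ := excess_even (indepPoly G)
      omega
    · have := hp'.iso (supEdgeIso e a b)
      exact (not_positiveOn_diamond_edge (e.injective.ne hab.ne) (by rwa [e.map_adj_iff])
        this).elim
    · have := hu.sup_edge hab.ne hFadj hleaf hp'
      rw [hsup] at this
      exact Or.inr (Or.inl this)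
  · have h3 : ∀ v, (G.neighborSet v).ncard = 2 := by
      intro v
      refine le_antisymm ?_ (h2 v)
      by_contra! h
      obtain ⟨x, y, z, hx, hy, hz, hxy, hxz, hyz⟩ := (Set.two_lt_ncard_iff (Set.toFinite _)).1 h
      exact hb ⟨v, x, y, z, hxy, hxz, hyz, hx, hy, hz⟩
    have hexc : excess (indepPoly G) = 0 := by
      rw [excess_eq_sum_degree]
      exact Finset.sum_eq_zero fun v _ => by rw [hdeg, h3]; norm_num
    have hcyc : G.IsCycles := fun v _ => h3 v
    obtain ⟨a⟩ := hG.nonempty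
    obtain ⟨b, hab⟩ := hG.preconnected.exists_adj_of_nontrivial a
    have hbr : ¬ G.IsBridge s(a, b) := by
      rw [isBridge_iff, not_not]; exact hcyc.reachable_deleteEdges hab
    have hsup := sup_edge_deleteEdges hab
    set F := G.deleteEdges {s(a, b)} with hF
    have hFadj : ¬ F.Adj a b := by simp [hF]
    have hFc : F.Connected := hG.connected_delete_edge_of_not_isBridge hbr
    have hp' : PositiveOn (F ⊔ edge a b) Finset.univ := by rwa [hsup]
    have hFl : Listed F := ih a b hab hFc
      (hp'.of_sup_edge (Finset.mem_univ _) (Finset.mem_univ _) hab.ne hFadj)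
    have hle : F ≤ G := deleteEdges_le _
    have hFb : ¬ HasBranch F := by
      rintro ⟨v, x, y, z, hxy, hxz, hyz, hx, hy, hz⟩
      exact hb ⟨v, x, y, z, hxy, hxz, hyz, hle hx, hle hy, hle hz⟩
    -- `F` has no branch vertex, and its excess is 2 below that of `G`, which is 0; only a path
    -- fits.
    rcases hFl with ⟨he, ⟨k, ⟨e⟩⟩ | hb'⟩ | ⟨⟨e⟩⟩ | ⟨he, _⟩
    · have e' := supEdgeIso e a b
      rw [hsup] at e'
      have hk := pathGraph_edge_eq (e.injective.ne hab.ne) (by rwa [e.map_adj_iff]) (by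
        intro z hz
        exact hl _ (hz.iso e'.symm))
      rw [hk.2] at e'
      refine Or.inr (Or.inr ⟨hexc, ?_⟩)
      rcases hk.1.eq_or_lt with rfl | hk3
      · exact Or.inr (Or.inl ⟨e'⟩)
      · exact Or.inr (Or.inr (Or.inl ⟨k, hk3, Or.inl ⟨e'⟩⟩))
    · exact absurd hb' hFb
    · refine absurd ?_ hFb
      refine ⟨e.symm 0, e.symm 1, e.symm 2, e.symm 3, ?_, ?_, ?_, ?_, ?_, ?_⟩
      all_goals first
        | (rw [e.symm.injective.ne_iff]; decide)
        | (rw [e.symm.map_adj_iff]; decide)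
    · exfalso
      have h4 := excess_sup_edge hab.ne hFadj
      rw [hsup] at h4
      omega

/-- Connected graphs without zeros of the independence polynomial in `[-1/4, 0]` are listed. -/
theorem listed_of_connected : ∀ (N : ℕ) {V : Type*} [Fintype V] (G : SimpleGraph V),
    Fintype.card V + G.edgeSet.ncard ≤ N → G.Connected → PositiveOn G Finset.univ → Listed G := by
  intro N
  induction N with
  | zero =>
    intro V _ G hN hG _
    have := hG.nonempty
    have := Fintype.card_pos (α := V)
    omega
  | succ N ih =>
    intro V _ G hN hG hpos
    classical
    rcases subsingleton_or_nontrivial V with hs | hn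
    · have := hG.nonempty
      have hc : Fintype.card V = 1 := le_antisymm (Fintype.card_le_one_iff_subsingleton.2 hs)
        Fintype.card_pos
      have hadj : ∀ x y, ¬ G.Adj x y := fun x y h => h.ne (Subsingleton.elim x y)
      refine Or.inl ⟨?_, Or.inl ⟨1, ⟨⟨Fintype.equivFinOfCardEq hc, ?_⟩⟩⟩⟩
      · rw [excess_eq_sum_degree]
        simp [Fintype.card_pos]
      · intro x y
        simp only [hadj, iff_false, pathGraph_adj]
        omega
    by_cases hl : ∃ v, IsLeaf G v
    · obtain ⟨v, u, hu⟩ := hl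
      obtain ⟨w, hw⟩ := isLeafExt_induce hu
      have hd : G.degree v = 1 :=
        degree_eq_one_iff_existsUnique_adj.2 ⟨u, (hu u).2 rfl, fun w hw => (hu w).1 hw⟩
      have hFc := hG.induce_compl_singleton_of_degree_eq_one hd
      have hFp : PositiveOn (G.induce {v}ᶜ) Finset.univ := hpos.embedding (Embedding.induce _)
      have hcard := hw.card_eq
      have hedge : (G.induce {v}ᶜ).edgeSet.ncard ≤ G.edgeSet.ncard := by
        rw [← Nat.card_coe_set_eq, ← Nat.card_coe_set_eq]
        exact Nat.card_le_card_of_injective _ (Embedding.induce {v}ᶜ).mapEdgeSet.injective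
      exact (ih (G.induce {v}ᶜ) (by omega) hFc hFp).leafExt hFc hpos hw
    · push Not at hl
      refine listed_of_noLeaf hG hpos hl fun a b hab hc hp => ih _ ?_ hc hp
      have : (G.deleteEdges {s(a, b)}).edgeSet.ncard < G.edgeSet.ncard := by
        refine Set.ncard_lt_ncard ?_ (Set.toFinite _)
        rw [edgeSet_deleteEdges]
        exact ⟨Set.sdiff_subset, fun h => (h (show s(a, b) ∈ G.edgeSet from hab)).2 rfl⟩
      omega

end Classification

/-! ### Divisibility of Lucas numbers and two equations. -/

section Lucas

lemma lucas_rec {n : ℕ} (hn : 2 ≤ n) :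
    cyclePoly (1 : ℤ) (n + 2) = cyclePoly 1 (n + 1) + cyclePoly 1 n := by
  rw [cyclePoly_add_two 1 hn, one_mul]

lemma lucas_two : cyclePoly (1 : ℤ) 2 = 3 := by rw [cyclePoly_two]; norm_num

lemma lucas_three : cyclePoly (1 : ℤ) 3 = 4 := by rw [cyclePoly_three]; norm_num

lemma lucas_pos {n : ℕ} (hn : 2 ≤ n) : 0 < cyclePoly (1 : ℤ) n := by
  induction n using Nat.strong_induction_on with | _ n ih =>
  rcases (by omega : n = 2 ∨ n = 3 ∨ 4 ≤ n) with rfl | rfl | h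
  · simp [lucas_two]
  · simp [lucas_three]
  · obtain ⟨m, rfl⟩ : ∃ m, n = m + 2 := ⟨n - 2, by omega⟩
    rw [lucas_rec (by omega)]
    have := ih m (by omega) (by omega)
    have := ih (m + 1) (by omega) (by omega)
    omega

/-- `L_{n+4} = 3 L_{n+1} + 2 L_n`, so divisibility by 3 depends only on `n` modulo 4; the odd
classes start with `L_3 = 4` and `L_5 = 11`. -/
lemma not_three_dvd_lucas {n : ℕ} (hn : 3 ≤ n) (ho : Odd n) : ¬ 3 ∣ cyclePoly (1 : ℤ) n := by
  induction n using Nat.strong_induction_on with | _ n ih =>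
  have h2 := lucas_two
  have h3 := lucas_three
  obtain ⟨m, rfl⟩ := ho
  rcases (by omega : m = 1 ∨ m = 2 ∨ 3 ≤ m) with rfl | rfl | h
  · simp only [mul_one, Nat.reduceAdd, h3]; norm_num
  · have h4 := lucas_rec (n := 2) (by omega)
    have h5 := lucas_rec (n := 3) (by omega)
    norm_num at h4 h5 ⊢
    omega
  · obtain ⟨k, rfl⟩ : ∃ k, m = k + 2 := ⟨m - 2, by omega⟩
    have := ih (2 * k + 1) (by omega) (by omega) ⟨k, rfl⟩
    have h4 := lucas_rec (n := 2 * k + 1) (by omega)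
    have h5 := lucas_rec (n := 2 * k + 1 + 1) (by omega)
    have h6 := lucas_rec (n := 2 * k + 1 + 2) (by omega)
    rw [show 2 * (k + 2) + 1 = 2 * k + 1 + 2 + 2 by ring, h6]
    simp only [add_assoc, Nat.reduceAdd] at *
    omega

/-- Modulo 8 the Lucas numbers have period 12, and 0 does not occur in a period. -/
lemma not_eight_dvd_lucas {n : ℕ} (hn : 2 ≤ n) : ¬ 8 ∣ cyclePoly (1 : ℤ) n := by
  have key : ∀ m, ∃ a b : ℤ, cyclePoly (1 : ℤ) (12 * m + 2) = 8 * a + 3 ∧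
      cyclePoly (1 : ℤ) (12 * m + 3) = 8 * b + 4 := by
    intro m
    induction m with
    | zero => exact ⟨0, 0, by simp [lucas_two], by simp [lucas_three]⟩
    | succ m ih =>
      obtain ⟨a, b, ha, hb⟩ := ih
      have r : ∀ j, cyclePoly (1 : ℤ) (12 * m + 2 + j + 2) =
          cyclePoly (1 : ℤ) (12 * m + 2 + j + 1) + cyclePoly (1 : ℤ) (12 * m + 2 + j) :=
        fun j => lucas_rec (by omega)
      have r0 := r 0; have r1 := r 1; have r2 := r 2; have r3 := r 3; have r4 := r 4
      have r5 := r 5; have r6 := r 6; have r7 := r 7; have r8 := r 8; have r9 := r 9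
      have r10 := r 10; have r11 := r 11
      simp only [add_assoc, Nat.reduceAdd] at *
      -- Twelve steps of the recurrence multiply by the Fibonacci numbers 89, 144 and 144, 233; the
      -- constants come from `89 * 3 + 144 * 4 = 8 * 105 + 3` and `144 * 3 + 233 * 4 = 8 * 170 + 4`.
      refine ⟨89 * a + 144 * b + 105, 144 * a + 233 * b + 170, ?_, ?_⟩
      · rw [show 12 * (m + 1) + 2 = 12 * m + 14 by ring]; omega
      · rw [show 12 * (m + 1) + 3 = 12 * m + 15 by ring]; omega
  obtain ⟨a, b, ha, hb⟩ := key ((n - 2) / 12)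
  set m := (n - 2) / 12 with hm
  have r : ∀ j, cyclePoly (1 : ℤ) (12 * m + 2 + j + 2) =
      cyclePoly (1 : ℤ) (12 * m + 2 + j + 1) + cyclePoly (1 : ℤ) (12 * m + 2 + j) :=
    fun j => lucas_rec (by omega)
  have r0 := r 0; have r1 := r 1; have r2 := r 2; have r3 := r 3; have r4 := r 4
  have r5 := r 5; have r6 := r 6; have r7 := r 7; have r8 := r 8; have r9 := r 9
  simp only [add_assoc, Nat.reduceAdd] at *
  have hn' : ∃ j < 12, n = 12 * m + (2 + j) := ⟨(n - 2) % 12, by omega, by omega⟩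
  obtain ⟨j, hj, hn'⟩ := hn'
  rw [hn']
  clear_value m
  interval_cases j <;> simp only [Nat.reduceAdd] <;> omega

/-- The only solution of `L_{k+4} = 4 (L_k + 2 L_{k-2})` with `k ≥ 5` is `k = 5`. -/
lemma eq_five_of_lucas_add_four {k : ℕ} (hk : 5 ≤ k)
    (h : cyclePoly (1 : ℤ) (k + 4) = 4 * (cyclePoly 1 k + 2 * cyclePoly 1 (k - 2))) : k = 5 := by
  by_contra hne
  -- With `a = L_{k-2}` and `b = L_{k-1}` the equation reads `5a + 8b = 12a + 4b`, that is `4b =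
  -- 7a`, which is `L_4 : L_3`. From index 4 on the ratio stays strictly between `4/3` and `7/4`, an
  -- interval stable under `r ↦ 1 + 1/r`.
  have key : ∀ m, 4 * cyclePoly (1 : ℤ) (m + 5) < 7 * cyclePoly 1 (m + 4) ∧
      4 * cyclePoly (1 : ℤ) (m + 4) < 3 * cyclePoly 1 (m + 5) := by
    intro m
    induction m with
    | zero =>
      have h2 := lucas_two
      have h3 := lucas_three
      have h4 := lucas_rec (n := 2) (by omega)
      have h5 := lucas_rec (n := 3) (by omega)
      norm_num at h4 h5 ⊢
      omega
    | succ m ih =>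
      have := lucas_rec (n := m + 4) (by omega)
      have := lucas_pos (n := m + 4) (by omega)
      rw [show m + 1 + 5 = m + 4 + 2 by ring, show m + 1 + 4 = m + 4 + 1 by ring]
      simp only [add_assoc, Nat.reduceAdd] at *
      omega
  obtain ⟨m, rfl⟩ : ∃ m, k = m + 6 := ⟨k - 6, by omega⟩
  have := key m
  have r : ∀ j, cyclePoly (1 : ℤ) (m + 4 + j + 2) =
      cyclePoly (1 : ℤ) (m + 4 + j + 1) + cyclePoly (1 : ℤ) (m + 4 + j) :=
    fun j => lucas_rec (by omega)
  have r0 := r 0; have r1 := r 1; have r2 := r 2; have r3 := r 3; have r4 := r 4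
  rw [show m + 6 - 2 = m + 4 by omega] at h
  simp only [add_assoc, Nat.reduceAdd] at *
  omega

/-- The only solution of `L_{k+10} = 124 L_k` with `k ≥ 4` is `k = 5`. -/
lemma eq_five_of_lucas_add_ten {k : ℕ} (hk : 4 ≤ k)
    (h : cyclePoly (1 : ℤ) (k + 10) = 124 * cyclePoly 1 k) : k = 5 := by
  by_contra hne
  have h2 := lucas_two
  have h3 := lucas_three
  have h4 := lucas_rec (n := 2) (by omega)
  have h5 := lucas_rec (n := 3) (by omega)
  have h6 := lucas_rec (n := 4) (by omega)
  have h7 := lucas_rec (n := 5) (by omega)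
  -- The equation is `34 L_k + 55 L_{k+1} = 124 L_k`, that is `11 L_{k+1} = 18 L_k`, the ratio `L_6
  -- : L_5`. From index 6 on the ratio stays strictly between `11/7` and `18/11`.
  have key : ∀ m, 11 * cyclePoly (1 : ℤ) (m + 7) < 18 * cyclePoly 1 (m + 6) ∧
      11 * cyclePoly (1 : ℤ) (m + 6) < 7 * cyclePoly 1 (m + 7) := by
    intro m
    induction m with
    | zero => norm_num at h4 h5 h6 h7 ⊢; omega
    | succ m ih =>
      have := lucas_rec (n := m + 6) (by omega)
      have := lucas_pos (n := m + 6) (by omega)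
      rw [show m + 1 + 7 = m + 6 + 2 by ring, show m + 1 + 6 = m + 6 + 1 by ring]
      simp only [add_assoc, Nat.reduceAdd] at *
      omega
  have r : ∀ j, cyclePoly (1 : ℤ) (k + j + 2) =
      cyclePoly (1 : ℤ) (k + j + 1) + cyclePoly (1 : ℤ) (k + j) :=
    fun j => lucas_rec (by omega)
  have r0 := r 0; have r1 := r 1; have r2 := r 2; have r3 := r 3; have r4 := r 4
  have r5 := r 5; have r6 := r 6; have r7 := r 7; have r8 := r 8
  rcases (by omega : k = 4 ∨ 6 ≤ k) with rfl | hk6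
  · simp only [add_assoc, Nat.reduceAdd] at *
    omega
  obtain ⟨m, rfl⟩ : ∃ m, k = m + 6 := ⟨k - 6, by omega⟩
  have := key m
  simp only [add_assoc, Nat.reduceAdd, add_zero] at *
  omega

end Lucas

/-! ### Invariants over connected components. -/

section Components

variable {V : Type*}

lemma not_adj_of_ne_component {G : SimpleGraph V} {c d : G.ConnectedComponent} (h : c ≠ d) {a b : V}
    (ha : a ∈ c.supp) (hb : b ∈ d.supp) : ¬ G.Adj a b := by
  intro hab
  rw [ConnectedComponent.mem_supp_iff] at ha hb
  exact h (ha.symm.trans ((ConnectedComponent.eq.2 hab.reachable).trans hb))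

lemma nonempty_iso_induce_union {G : SimpleGraph V} {A B : Set V} (hd : Disjoint A B)
    (h : ∀ a ∈ A, ∀ b ∈ B, ¬ G.Adj a b) :
    Nonempty (G.induce (A ∪ B) ≃g G.induce A ⊕g G.induce B) := by
  classical
  refine ⟨Iso.symm ⟨(Equiv.Set.union hd).symm, ?_⟩⟩
  rintro (⟨a, ha⟩ | ⟨a, ha⟩) (⟨b, hb⟩ | ⟨b, hb⟩)
  · simp
  · simpa using h a ha b hb
  · simpa [G.adj_comm] using h b hb a ha
  · simp

lemma nonempty_iso_induce_univ (G : SimpleGraph V) {A : Set V} (h : ∀ v, v ∈ A) :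
    Nonempty (G ≃g G.induce A) :=
  ⟨Iso.symm ⟨Equiv.subtypeUnivEquiv h, by simp⟩⟩

/-- Abstract in `f` so that it serves both `indepSum` and `weight`; the induction adds one component
at a time to a union of components. -/
lemma prod_component {M : Type*} [CommMonoid M] [Fintype V] [DecidableEq V] {G : SimpleGraph V}
    [Fintype G.ConnectedComponent] (f : Finset V → M) (h0 : f ∅ = 1)
    (hf : ∀ S T, Disjoint S T → (∀ a ∈ S, ∀ b ∈ T, ¬ G.Adj a b) → f (S ∪ T) = f S * f T) :
    f Finset.univ = ∏ c : G.ConnectedComponent, f c.supp.toFinite.toFinset := by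
  classical
  have key : ∀ s : Finset G.ConnectedComponent,
      f (s.biUnion fun c => c.supp.toFinite.toFinset) = ∏ c ∈ s, f c.supp.toFinite.toFinset := by
    intro s
    induction s using Finset.induction_on with
    | empty => simpa using h0
    | insert c s hc ih =>
      rw [Finset.biUnion_insert, Finset.prod_insert hc, ← ih]
      refine hf _ _ ?_ ?_
      · rw [Finset.disjoint_left]
        intro a ha hb
        simp only [Set.Finite.mem_toFinset, Finset.mem_biUnion,
          ConnectedComponent.mem_supp_iff] at ha hb
        obtain ⟨d, hd, hb⟩ := hb
        exact hc (ha ▸ hb ▸ hd)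
      · intro a ha b hb
        simp only [Set.Finite.mem_toFinset, Finset.mem_biUnion] at ha hb
        obtain ⟨d, hd, hb⟩ := hb
        exact not_adj_of_ne_component (by rintro rfl; exact hc hd) ha hb
  rw [← key]
  congr 1
  ext v
  simp

variable [Fintype V] {G : SimpleGraph V}

lemma bijOn_val_supp (c : G.ConnectedComponent) [Fintype c.supp] :
    Set.BijOn (Subtype.val : c.supp → V) (Finset.univ : Finset c.supp)
      c.supp.toFinite.toFinset := by
  rw [Set.Finite.coe_toFinset, Finset.coe_univ]
  exact ⟨fun a _ => a.2, Subtype.val_injective.injOn, fun a ha => ⟨⟨a, ha⟩, trivial, rfl⟩⟩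

variable [Fintype G.ConnectedComponent] [∀ c : G.ConnectedComponent, Fintype c.supp]

lemma indepSum_eq_prod_component {R : Type*} [CommRing R] (x : R) :
    indepSum x G Finset.univ = ∏ c : G.ConnectedComponent, indepSum x (G.induce c.supp) .univ := by
  classical
  rw [prod_component (fun S => indepSum x G S) (indepSum_empty x G)
    fun S T h1 h2 => indepSum_union x h1 h2]
  exact Finset.prod_congr rfl fun c _ =>
    (indepSum_bijOn x Subtype.val (bijOn_val_supp c) fun a _ b _ => Iff.rfl).symm

lemma weight_eq_prod_component :
    weight G Finset.univ = ∏ c : G.ConnectedComponent, weight (G.induce c.supp) .univ := by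
  classical
  rw [prod_component (fun S => weight G S) (weight_empty G) fun S T h1 h2 => weight_union h1 h2]
  exact Finset.prod_congr rfl fun c _ =>
    (weight_bijOn Subtype.val (bijOn_val_supp c) fun a _ b _ => Iff.rfl).symm

lemma prod_coeff_zero_eq_one {ι : Type*} (s : Finset ι) (p : ι → ℤ[X]) (h : ∀ i, (p i).coeff 0 = 1) :
    (∏ i ∈ s, p i).coeff 0 = 1 := by
  rw [coeff_zero_prod]
  exact Finset.prod_eq_one fun i _ => h i

lemma sum_of_mul_additive {ι : Type*} (f : ℤ[X] → ℤ) (h1 : f 1 = 0)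
    (hf : ∀ p q : ℤ[X], p.coeff 0 = 1 → q.coeff 0 = 1 → f (p * q) = f p + f q) (s : Finset ι)
    (p : ι → ℤ[X]) (h : ∀ i, (p i).coeff 0 = 1) : f (∏ i ∈ s, p i) = ∑ i ∈ s, f (p i) := by
  classical
  induction s using Finset.induction_on with
  | empty => simpa using h1
  | insert i s hi ih =>
    rw [Finset.prod_insert hi, Finset.sum_insert hi, hf _ _ (h i) (prod_coeff_zero_eq_one s p h), ih]

lemma indepPoly_coeff_zero {W : Type*} [Fintype W] (H : SimpleGraph W) :
    (indepPoly H).coeff 0 = 1 := by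
  rw [indepPoly_eq_indepSum]; exact indepCoeff_zero H _

lemma indepPoly_coeff_one {W : Type*} [Fintype W] (H : SimpleGraph W) :
    (indepPoly H).coeff 1 = Fintype.card W := by
  rw [indepPoly_eq_indepSum]; exact indepCoeff_one H _

lemma indepPoly_eq_prod_component :
    indepPoly G = ∏ c : G.ConnectedComponent, indepPoly (G.induce c.supp) := by
  simp only [indepPoly_eq_indepSum]; exact indepSum_eq_prod_component X

lemma excess_eq_sum_component : excess (indepPoly G) =
    ∑ c : G.ConnectedComponent, excess (indepPoly (G.induce c.supp)) := by
  rw [indepPoly_eq_prod_component]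
  exact sum_of_mul_additive _ (by simp [excess, coeff_one]) (fun _ _ => excess_mul) _ _
    fun c => indepPoly_coeff_zero _

lemma defect_eq_sum_component : defect (indepPoly G) =
    ∑ c : G.ConnectedComponent, defect (indepPoly (G.induce c.supp)) := by
  rw [indepPoly_eq_prod_component]
  exact sum_of_mul_additive _ (by simp [defect, coeff_one]) (fun _ _ => defect_mul) _ _
    fun c => indepPoly_coeff_zero _

end Components

/-! ### Values at 1 of the listed graphs. -/

section Values

lemma indepSum_one_eq {n : ℕ} {G : SimpleGraph (Fin n)} [DecidableRel G.Adj] {a : ℤ}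
    (h : evalCoeffs (1 : ℤ) (coeffList (fun a b => decide (G.Adj a b)) n (List.finRange n)) = a) :
    indepSum (1 : ℤ) G Finset.univ = a := by
  rw [← h, ← evalCoeffs_coeffList 1 (G := G) (by simp) n _ (List.nodup_finRange n) (by simp)]
  congr 1; ext; simp

lemma indepSum_one_diamond : indepSum (1 : ℤ) diamond Finset.univ = 6 :=
  indepSum_one_eq (by decide +kernel)

lemma indepSum_one_graphA' : indepSum (1 : ℤ) graphA' Finset.univ = 31 :=
  indepSum_one_eq (by decide +kernel)

lemma indepSum_one_graphB' : indepSum (1 : ℤ) graphB' Finset.univ = 31 :=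
  indepSum_one_eq (by decide +kernel)

lemma indepSum_one_graphC' : indepSum (1 : ℤ) graphC' Finset.univ = 31 :=
  indepSum_one_eq (by decide +kernel)

lemma weight_eq_of_weightList {n : ℕ} {G : SimpleGraph (Fin n)} [DecidableRel G.Adj] {q : ℚ}
    (h : weightList G (List.finRange n) = q) : weight G Finset.univ = (q : ℝ) := by
  rw [weight_univ_eq_weightList, h]

lemma indepSum_one_eGraph {k : ℕ} (hk : 5 ≤ k) :
    indepSum (1 : ℤ) (eGraph k) Finset.univ = cyclePoly 1 k + 2 * cyclePoly 1 (k - 2) := by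
  rw [(isLeafExt_eGraph hk).indepSum_eq, indepSum_dGraph_univ,
    indepSum_dGraph (T := Finset.range (k - 2) ∪ {k - 1}) 1 (by intro j; simp; omega),
    indepSum_union, indepSum_singleton, ← cyclePoly]
  · ring
  · rw [Finset.disjoint_left]; intro a; simp; omega
  · intro a ha b hb; simp at ha hb; rw [tailGraph_adj]; omega

end Values

/-! ### Comparison of invariants over the components. -/

section Classes

variable {V : Type*}

/-- The graphs listed as independence equivalent to `C_n`. -/
def EquivListed (n : ℕ) (G : SimpleGraph V) : Prop :=
  Nonempty (G ≃g cycleGraph n) ∨ Nonempty (G ≃g dGraph n) ∨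
    (n = 9 ∧ (Nonempty (G ≃g (cycleGraph 3 ⊕g graphA)) ∨
      Nonempty (G ≃g (cycleGraph 3 ⊕g graphB)) ∨
      Nonempty (G ≃g (cycleGraph 3 ⊕g graphC)) ∨
      Nonempty (G ≃g (cycleGraph 3 ⊕g graphD)))) ∨
    (n = 15 ∧ (Nonempty (G ≃g (cycleGraph 3 ⊕g cycleGraph 5 ⊕g graphA')) ∨
      Nonempty (G ≃g (cycleGraph 3 ⊕g dGraph 5 ⊕g graphA')) ∨
      Nonempty (G ≃g (cycleGraph 3 ⊕g cycleGraph 5 ⊕g graphB')) ∨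
      Nonempty (G ≃g (cycleGraph 3 ⊕g dGraph 5 ⊕g graphB')) ∨
      Nonempty (G ≃g (cycleGraph 3 ⊕g cycleGraph 5 ⊕g graphC')) ∨
      Nonempty (G ≃g (cycleGraph 3 ⊕g dGraph 5 ⊕g graphC'))))

lemma eGraph_five_iso : Nonempty (eGraph 5 ≃g graphD) := by
  refine nonempty_iso_of_perm ![0, 1, 2, 3, 4, 5] (by decide) ?_
  intro a b
  rw [eGraph_adj le_rfl, graphD_eq, tailGraph_adj]
  revert a b
  decide +kernel

lemma nonempty_iso_three {G : SimpleGraph V} {c d e : G.ConnectedComponent} (hcd : c ≠ d)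
    (hce : c ≠ e) (hde : d ≠ e) (h : ∀ x, x = c ∨ x = d ∨ x = e) :
    Nonempty (G ≃g (G.induce c.supp ⊕g G.induce d.supp ⊕g G.induce e.supp)) := by
  obtain ⟨i⟩ := nonempty_iso_induce_univ G (A := c.supp ∪ d.supp ∪ e.supp) (by
    intro v
    simpa [or_assoc] using h (G.connectedComponentMk v))
  obtain ⟨j⟩ := nonempty_iso_induce_union (G := G) (A := c.supp ∪ d.supp) (B := e.supp)
    (Set.disjoint_union_left.2 ⟨pairwise_disjoint_supp_connectedComponent G hce,
      pairwise_disjoint_supp_connectedComponent G hde⟩) (by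
    rintro a (ha | ha) b hb
    · exact not_adj_of_ne_component hce ha hb
    · exact not_adj_of_ne_component hde ha hb)
  obtain ⟨k⟩ := nonempty_iso_induce_union (G := G) (A := c.supp) (B := d.supp)
    (pairwise_disjoint_supp_connectedComponent G hcd)
    (fun a ha b hb => not_adj_of_ne_component hcd ha hb)
  exact ⟨(i.trans j).trans (k.sumCongr Iso.refl)⟩

lemma nonempty_iso_two {G : SimpleGraph V} {c d : G.ConnectedComponent} (hcd : c ≠ d)
    (h : ∀ x, x = c ∨ x = d) : Nonempty (G ≃g (G.induce c.supp ⊕g G.induce d.supp)) := by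
  obtain ⟨i⟩ := nonempty_iso_induce_univ G (A := c.supp ∪ d.supp) (by
    intro v
    simpa using h (G.connectedComponentMk v))
  obtain ⟨k⟩ := nonempty_iso_induce_union (G := G) (A := c.supp) (B := d.supp)
    (pairwise_disjoint_supp_connectedComponent G hcd)
    (fun a ha b hb => not_adj_of_ne_component hcd ha hb)
  exact ⟨i.trans k⟩

/-- The graph is a cycle `C_k` or a graph `D_k`, with `k ≥ 4`. -/
def IsCycleLike (k : ℕ) (G : SimpleGraph V) : Prop :=
  4 ≤ k ∧ (Nonempty (G ≃g cycleGraph k) ∨ Nonempty (G ≃g dGraph k))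

variable [Fintype V] {G : SimpleGraph V}

lemma IsCycleLike.weight {k : ℕ} (h : IsCycleLike k G) : weight G Finset.univ = 2 := by
  obtain ⟨hk, ⟨⟨e⟩⟩ | ⟨⟨e⟩⟩⟩ := h
  · rw [weight_iso e, weight_cycleGraph (by omega)]
  · rw [weight_iso e, weight_dGraph_univ (by omega)]

lemma IsCycleLike.indepPoly {k : ℕ} (h : IsCycleLike k G) : indepPoly G = cyclePoly X k := by
  obtain ⟨hk, ⟨⟨e⟩⟩ | ⟨⟨e⟩⟩⟩ := h
  · rw [indepPoly_iso e, indepPoly_cycleGraph (by omega)]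
  · rw [indepPoly_iso e, indepPoly_dGraph]

lemma IsCycleLike.indepSum {k : ℕ} (h : IsCycleLike k G) :
    indepSum (1 : ℤ) G Finset.univ = cyclePoly 1 k := by
  obtain ⟨hk, ⟨⟨e⟩⟩ | ⟨⟨e⟩⟩⟩ := h
  · rw [indepSum_iso 1 e, indepSum_cycleGraph 1 (by omega)]
  · rw [indepSum_iso 1 e, indepSum_dGraph_univ]

lemma IsCycleLike.card {k : ℕ} (h : IsCycleLike k G) : Fintype.card V = k := by
  obtain ⟨hk, ⟨⟨e⟩⟩ | ⟨⟨e⟩⟩⟩ := h <;> simpa using Fintype.card_congr e.toEquiv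

/-- The weights and further data of the unicyclic graphs of defect `6`. -/
lemma data_of_defect_six (hd : (∃ k, 5 ≤ k ∧ Nonempty (G ≃g eGraph k)) ∨ Sporadic G) :
    weight G Finset.univ = 3 / 2 ∨
    (weight G Finset.univ = 1 ∧ ((∃ k, 5 ≤ k ∧ Nonempty (G ≃g eGraph k)) ∨
      Nonempty (G ≃g graphA) ∨ Nonempty (G ≃g graphB) ∨ Nonempty (G ≃g graphC))) ∨
    (weight G Finset.univ = 1 / 2 ∧ Fintype.card V = 7 ∧ indepSum (1 : ℤ) G Finset.univ = 31 ∧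
      (Nonempty (G ≃g graphA') ∨ Nonempty (G ≃g graphB') ∨ Nonempty (G ≃g graphC'))) := by
  rcases hd with ⟨k, hk, ⟨e⟩⟩ | ⟨⟨e⟩⟩ | ⟨⟨e⟩⟩ | ⟨⟨e⟩⟩ | ⟨⟨e⟩⟩ | ⟨⟨e⟩⟩ | ⟨⟨e⟩⟩ | ⟨⟨e⟩⟩ | ⟨⟨e⟩⟩
  · exact Or.inr (Or.inl ⟨by rw [weight_iso e, weight_eGraph hk], Or.inl ⟨k, hk, ⟨e⟩⟩⟩)
  · left
    rw [weight_iso e, weight_eq_of_weightList (q := 3 / 2) (by decide +kernel)]; norm_num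
  · refine Or.inr (Or.inl ⟨?_, Or.inr (Or.inl ⟨e⟩)⟩)
    rw [weight_iso e, weight_eq_of_weightList (q := 1) (by decide +kernel)]; norm_num
  · refine Or.inr (Or.inr ⟨?_, by simpa using Fintype.card_congr e.toEquiv,
      by rw [indepSum_iso 1 e, indepSum_one_graphA'], Or.inl ⟨e⟩⟩)
    rw [weight_iso e, weight_eq_of_weightList (q := 1 / 2) (by decide +kernel)]; norm_num
  · left
    rw [weight_iso e, weight_eq_of_weightList (q := 3 / 2) (by decide +kernel)]; norm_num
  · refine Or.inr (Or.inl ⟨?_, Or.inr (Or.inr (Or.inl ⟨e⟩))⟩)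
    rw [weight_iso e, weight_eq_of_weightList (q := 1) (by decide +kernel)]; norm_num
  · refine Or.inr (Or.inr ⟨?_, by simpa using Fintype.card_congr e.toEquiv,
      by rw [indepSum_iso 1 e, indepSum_one_graphB'], Or.inr (Or.inl ⟨e⟩)⟩)
    rw [weight_iso e, weight_eq_of_weightList (q := 1 / 2) (by decide +kernel)]; norm_num
  · refine Or.inr (Or.inl ⟨?_, Or.inr (Or.inr (Or.inr ⟨e⟩))⟩)
    rw [weight_iso e, weight_eq_of_weightList (q := 1) (by decide +kernel)]; norm_num
  · refine Or.inr (Or.inr ⟨?_, by simpa using Fintype.card_congr e.toEquiv,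
      by rw [indepSum_iso 1 e, indepSum_one_graphC'], Or.inr (Or.inr ⟨e⟩)⟩)
    rw [weight_iso e, weight_eq_of_weightList (q := 1 / 2) (by decide +kernel)]; norm_num

lemma positiveOn_of_indepPoly {n : ℕ} (hn : 2 ≤ n) (h : indepPoly G = cyclePoly X n) :
    PositiveOn G Finset.univ := by
  intro y h0 h1
  have := positiveOn_tail_range hn y h0 h1
  rw [indepSum_eq_aeval] at this ⊢
  rwa [← indepPoly_eq_indepSum, h]

/-- A connected graph with positive independence polynomial on `[-1/4, 0]` and nonnegative
excess, other than the diamond, is `C_3`, cycle-like, or of positive defect. -/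
lemma connected_cases (hG : G.Connected) (hpos : PositiveOn G Finset.univ)
    (hdia : ¬ (6 : ℤ) ∣ indepSum (1 : ℤ) G Finset.univ) :
    excess (indepPoly G) ≤ 0 ∧ (excess (indepPoly G) = 0 → Nonempty (G ≃g cycleGraph 3) ∨
      (∃ k, IsCycleLike k G) ∨ 12 ≤ defect (indepPoly G) ∨ (defect (indepPoly G) = 6 ∧
        ((∃ k, 5 ≤ k ∧ Nonempty (G ≃g eGraph k)) ∨ Sporadic G))) := by
  rcases listed_of_connected _ G le_rfl hG hpos with ⟨h, _⟩ | ⟨⟨e⟩⟩ | ⟨h, hu⟩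
  · exact ⟨h.le, fun h' => absurd h' h.ne⟩
  · rw [indepSum_iso 1 e, indepSum_one_diamond] at hdia
    exact absurd dvd_rfl hdia
  · refine ⟨h.le, fun _ => ?_⟩
    rcases hu with h | h | h | h
    · exact Or.inr (Or.inr (Or.inl h.1))
    · exact Or.inl h
    · obtain ⟨k, hk, h⟩ := h; exact Or.inr (Or.inl ⟨k, hk, h⟩)
    · exact Or.inr (Or.inr (Or.inr h))

/-- Parity of `n` enters only through `h3`, which excludes the diamond; the rest is bookkeeping of
excess, defect, weight, value at 1 and number of vertices over the components. -/
lemma equivListed_of_indepPoly {n : ℕ} (hn : 4 ≤ n) (h3 : ¬ 3 ∣ cyclePoly (1 : ℤ) n)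
    (h : indepPoly G = cyclePoly X n) : EquivListed n G := by
  classical
  have hpos := positiveOn_of_indepPoly (by omega) h
  let H := fun c : G.ConnectedComponent => G.induce c.supp
  have hl : ∏ c, indepSum (1 : ℤ) (H c) Finset.univ = cyclePoly 1 n := by
    rw [← indepSum_eq_prod_component, ← aeval_indepPoly, h, ← indepPoly_dGraph, aeval_indepPoly,
      indepSum_dGraph_univ]
  have hw : ∏ c, weight (H c) Finset.univ = 2 := by
    rw [← weight_eq_prod_component, ← weight_dGraph_univ (k := n) (by omega), weight, weight,
      ← aeval_indepPoly, ← aeval_indepPoly, h, indepPoly_dGraph]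
    have h1 := indepPoly_coeff_one G
    rw [h, ← indepPoly_dGraph, indepPoly_coeff_one] at h1
    rw [Finset.card_univ, Finset.card_univ]
    norm_cast at h1
    rw [h1]
  have hcard : ∑ c : G.ConnectedComponent, Fintype.card c.supp = n := by
    have h1 := indepPoly_coeff_one G
    rw [h, ← indepPoly_dGraph, indepPoly_coeff_one, Fintype.card_fin] at h1
    have h2 := Fintype.card_congr (Equiv.sigmaFiberEquiv G.connectedComponentMk)
    rw [Fintype.card_sigma] at h2
    norm_cast at h1
    rw [h1, ← h2]
    exact Finset.sum_congr rfl fun c _ => Fintype.card_congr (Equiv.refl _)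
  have hconn : ∀ c, (H c).Connected := fun c => c.connected_toSimpleGraph
  have hHpos : ∀ c, PositiveOn (H c) Finset.univ := fun c => hpos.embedding (Embedding.induce _)
  have hdia : ∀ c, ¬ (6 : ℤ) ∣ indepSum (1 : ℤ) (H c) Finset.univ := by
    intro c hc
    refine h3 (hl ▸ (Dvd.dvd.trans (by norm_num) hc).trans (Finset.dvd_prod_of_mem _
      (Finset.mem_univ c)))
  have hcases := fun c => connected_cases (hconn c) (hHpos c) (hdia c)
  have hex : ∀ c, excess (indepPoly (H c)) = 0 := by
    have := excess_eq_sum_component (G := G)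
    rw [h, excess_cyclePoly (by omega), eq_comm,
      Finset.sum_eq_zero_iff_of_nonpos (fun c _ => (hcases c).1)] at this
    exact fun c => this c (Finset.mem_univ c)
  have hkind := fun c => (hcases c).2 (hex c)
  have hdef := defect_eq_sum_component (G := G)
  rw [h, defect_cyclePoly hn] at hdef
  have hlike : ∀ c k, IsCycleLike k (H c) → defect (indepPoly (H c)) = 0 := fun c k hk => by
    rw [hk.indepPoly, defect_cyclePoly hk.1]
  by_cases hT : ∃ c, Nonempty (H c ≃g cycleGraph 3)
  · obtain ⟨c, ⟨e⟩⟩ := hT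
    have hlc : indepSum (1 : ℤ) (H c) Finset.univ = 4 := by
      rw [indepSum_iso 1 e, indepSum_cycleGraph 1 le_rfl, lucas_three]
    have hdc : defect (indepPoly (H c)) = -6 := by
      rw [indepPoly_iso e, indepPoly_cycleGraph le_rfl, defect_cyclePoly_three]
    have hwc : weight (H c) Finset.univ = 2 := by rw [weight_iso e, weight_cycleGraph le_rfl]
    have hcc : Fintype.card c.supp = 3 := by simpa using Fintype.card_congr e.toEquiv
    -- Two triangles would contribute `4 * 4` to the value at 1, which is not divisible by 8.
    have honly : ∀ d, d ≠ c → ¬ Nonempty (H d ≃g cycleGraph 3) := by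
      rintro d hd ⟨e'⟩
      have hld : indepSum (1 : ℤ) (H d) Finset.univ = 4 := by
        rw [indepSum_iso 1 e', indepSum_cycleGraph 1 le_rfl, lucas_three]
      refine not_eight_dvd_lucas (n := n) (by omega) (hl ▸ ?_)
      refine Dvd.dvd.trans ?_ (Finset.prod_dvd_prod_of_subset {d, c} _ _ (Finset.subset_univ _))
      rw [Finset.prod_pair hd, hld, hlc]; norm_num
    have hnn : ∀ d, d ≠ c → 0 ≤ defect (indepPoly (H d)) := by
      intro d hd
      rcases hkind d with h | ⟨k, hk⟩ | h | h
      · exact absurd h (honly d hd)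
      · exact (hlike d k hk).ge
      · omega
      · omega
    rw [← Finset.add_sum_erase _ _ (Finset.mem_univ c), hdc] at hdef
    obtain ⟨d, hd, hd0⟩ : ∃ d ∈ Finset.univ.erase c, defect (indepPoly (H d)) ≠ 0 := by
      by_contra! hcon
      rw [Finset.sum_eq_zero hcon] at hdef
      omega
    have hdc' : d ≠ c := Finset.ne_of_mem_erase hd
    rw [← Finset.add_sum_erase _ _ hd] at hdef
    have hrest : ∀ x ∈ (Finset.univ.erase c).erase d, 0 ≤ defect (indepPoly (H x)) := by
      intro x hx; exact hnn x (by simp at hx; tauto)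
    have hsum := Finset.sum_nonneg hrest
    have hd6 : defect (indepPoly (H d)) = 6 ∧
        ((∃ k, 5 ≤ k ∧ Nonempty (H d ≃g eGraph k)) ∨ Sporadic (H d)) := by
      rcases hkind d with h | ⟨k, hk⟩ | h | h
      · exact absurd h (honly d hdc')
      · exact absurd (hlike d k hk) hd0
      · have : ∑ x ∈ (Finset.univ.erase c).erase d, defect (indepPoly (H x)) < 0 := by linarith
        omega
      · exact h
    have hothers : ∀ x, x ≠ c → x ≠ d → ∃ k, IsCycleLike k (H x) := by
      intro x hxc hxd
      have h0 : ∑ x ∈ (Finset.univ.erase c).erase d, defect (indepPoly (H x)) = 0 := by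
        have := hd6.1; linarith
      have := (Finset.sum_eq_zero_iff_of_nonneg hrest).1 h0 x (by simp [hxc, hxd])
      rcases hkind x with h | h | h | h
      · exact absurd h (honly x hxc)
      · exact h
      · omega
      · omega
    set R := (Finset.univ.erase c).erase d with hR
    have hmemR : ∀ x, x ∈ R ↔ x ≠ c ∧ x ≠ d := by intro x; simp [hR]; tauto
    -- The total weight 2 is used up by the triangle, so the other component weights multiply to 1;
    -- each component in `R` has weight 2.
    have hwR : weight (H d) Finset.univ * 2 ^ R.card = 1 := by
      rw [← Finset.mul_prod_erase _ _ (Finset.mem_univ c), ← Finset.mul_prod_erase _ _ hd, hwc,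
        Finset.prod_congr rfl (g := fun _ => (2 : ℝ)), Finset.prod_const] at hw
      · linarith
      · intro x hx
        obtain ⟨k, hk⟩ := hothers x ((hmemR x).1 hx).1 ((hmemR x).1 hx).2
        exact hk.weight
    rw [← Finset.mul_prod_erase _ _ (Finset.mem_univ c), ← Finset.mul_prod_erase _ _ hd, hlc] at hl
    rw [← Finset.add_sum_erase _ _ (Finset.mem_univ c), ← Finset.add_sum_erase _ _ hd, hcc]
      at hcard
    have hpow : (1 : ℝ) ≤ 2 ^ R.card := one_le_pow₀ (by norm_num)
    rcases data_of_defect_six hd6.2 with hwd | ⟨hwd, hcl⟩ | ⟨hwd, h7, h31, hcl⟩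
    · rw [hwd] at hwR; linarith
    · have hR0 : R.card = 0 := by
        rw [hwd, one_mul] at hwR
        exact (pow_eq_one_iff_cases.1 hwR).resolve_right (by norm_num)
      rw [Finset.card_eq_zero] at hR0
      rw [← hR, hR0] at hl hcard
      simp only [Finset.prod_empty, Finset.sum_empty, mul_one, add_zero] at hl hcard
      obtain ⟨i⟩ := nonempty_iso_two hdc'.symm (fun x => by
        by_contra! hx
        have := (hmemR x).2 hx
        simp [hR0] at this)
      have hd9 : ∀ {W : Type} [Fintype W] (F : SimpleGraph W) (hF : Fintype.card W = 6)
          (f : H d ≃g F), n = 9 ∧ Nonempty (G ≃g cycleGraph 3 ⊕g F) := by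
        intro W _ F hF f
        have := Fintype.card_congr f.toEquiv
        exact ⟨by omega, ⟨i.trans (e.sumCongr f)⟩⟩
      rcases hcl with ⟨k, hk, ⟨f⟩⟩ | ⟨⟨f⟩⟩ | ⟨⟨f⟩⟩ | ⟨⟨f⟩⟩
      · have hck := Fintype.card_congr f.toEquiv
        rw [Fintype.card_fin] at hck
        -- The components have 3 and `k + 1` vertices, so `n = k + 4`; comparing values at 1 leaves
        -- `k = 5`, where `eGraph 5` is `graphD`.
        rw [indepSum_iso 1 f, indepSum_one_eGraph hk, show n = k + 4 by omega] at hl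
        obtain rfl := eq_five_of_lucas_add_four hk hl.symm
        obtain ⟨j⟩ := eGraph_five_iso
        have := hd9 _ (by simp) (f.trans j)
        exact Or.inr (Or.inr (Or.inl ⟨this.1, Or.inr (Or.inr (Or.inr this.2))⟩))
      · have := hd9 _ (by simp) f
        exact Or.inr (Or.inr (Or.inl ⟨this.1, Or.inl this.2⟩))
      · have := hd9 _ (by simp) f
        exact Or.inr (Or.inr (Or.inl ⟨this.1, Or.inr (Or.inl this.2)⟩))
      · have := hd9 _ (by simp) f
        exact Or.inr (Or.inr (Or.inl ⟨this.1, Or.inr (Or.inr (Or.inl this.2))⟩))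
    · have hR1 : R.card = 1 := by
        have h2 : (2 : ℝ) ^ R.card = 2 ^ 1 := by rw [hwd] at hwR; linarith
        exact pow_right_injective₀ (by norm_num) (by norm_num) h2
      obtain ⟨x, hx⟩ := Finset.card_eq_one.1 hR1
      rw [← hR, hx, Finset.prod_singleton, h31] at hl
      rw [← hR, hx, Finset.sum_singleton, h7] at hcard
      obtain ⟨hxc, hxd⟩ := (hmemR x).1 (by simp [hx])
      obtain ⟨k, hk⟩ := hothers x hxc hxd
      have hck := hk.card
      -- The components have 3, 7 and `k` vertices, and the values at 1 multiply to `4 * 31 = 124`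
      -- times `L_k`.
      rw [hk.indepSum, show n = k + 10 by omega] at hl
      obtain rfl := eq_five_of_lucas_add_ten hk.1 (by linarith)
      obtain ⟨i⟩ := nonempty_iso_three hxc.symm hdc'.symm hxd (fun y => by
        by_contra! hy
        have := (hmemR y).2 ⟨hy.1, hy.2.2⟩
        simp [hx, hy.2.1] at this)
      refine Or.inr (Or.inr (Or.inr ⟨by omega, ?_⟩))
      obtain ⟨_, ⟨⟨j⟩⟩ | ⟨⟨j⟩⟩⟩ := hk <;> rcases hcl with ⟨⟨f⟩⟩ | ⟨⟨f⟩⟩ | ⟨⟨f⟩⟩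
      · exact Or.inl ⟨i.trans ((e.sumCongr j).sumCongr f)⟩
      · exact Or.inr (Or.inr (Or.inl ⟨i.trans ((e.sumCongr j).sumCongr f)⟩))
      · exact Or.inr (Or.inr (Or.inr (Or.inr (Or.inl ⟨i.trans ((e.sumCongr j).sumCongr f)⟩))))
      · exact Or.inr (Or.inl ⟨i.trans ((e.sumCongr j).sumCongr f)⟩)
      · exact Or.inr (Or.inr (Or.inr (Or.inl ⟨i.trans ((e.sumCongr j).sumCongr f)⟩)))
      · exact Or.inr (Or.inr (Or.inr (Or.inr (Or.inr ⟨i.trans ((e.sumCongr j).sumCongr f)⟩))))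
  · push Not at hT
    have hnn : ∀ d ∈ (Finset.univ : Finset G.ConnectedComponent),
        0 ≤ defect (indepPoly (H d)) := by
      intro d _
      rcases hkind d with h | ⟨k, hk⟩ | h | h
      · exact h.elim (hT d).elim
      · exact (hlike d k hk).ge
      · omega
      · omega
    have hall : ∀ d, ∃ k, IsCycleLike k (H d) := by
      intro d
      have := (Finset.sum_eq_zero_iff_of_nonneg hnn).1 hdef.symm d (Finset.mem_univ d)
      rcases hkind d with h | h | h | h
      · exact h.elim (hT d).elim
      · exact h
      · omega
      · omega
    rw [Finset.prod_congr rfl (g := fun _ => (2 : ℝ)), Finset.prod_const] at hw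
    swap
    · intro x _
      obtain ⟨k, hk⟩ := hall x
      exact hk.weight
    -- All components have weight 2 and the product is 2, so there is exactly one.
    have h1 : (Finset.univ : Finset G.ConnectedComponent).card = 1 :=
      pow_right_injective₀ (by norm_num) (by norm_num) (hw.trans (pow_one (2 : ℝ)).symm)
    obtain ⟨c, hc⟩ := Finset.card_eq_one.1 h1
    obtain ⟨i⟩ := nonempty_iso_induce_univ G (A := c.supp) (fun v => by
      have := Finset.mem_univ (G.connectedComponentMk v)
      rw [hc, Finset.mem_singleton] at this
      exact this)
    obtain ⟨k, hk⟩ := hall c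
    have hck := hk.card
    rw [hc, Finset.sum_singleton] at hcard
    obtain rfl : k = n := by omega
    obtain ⟨_, ⟨⟨j⟩⟩ | ⟨⟨j⟩⟩⟩ := hk
    · exact Or.inl ⟨i.trans j⟩
    · exact Or.inr (Or.inl ⟨i.trans j⟩)

end Classes

/-! ### The listed graphs have the right polynomial. -/

section Converse

lemma evalCoeffs_of_eq {n : ℕ} {G : SimpleGraph (Fin n)} [DecidableRel G.Adj] {l : List ℤ}
    (h : coeffList (fun a b => decide (G.Adj a b)) n (List.finRange n) = l) :
    indepPoly G = evalCoeffs X l := by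
  rw [indepPoly_eq_coeffList, h]

lemma indepPoly_sum {V W : Type*} [Fintype V] [Fintype W] (G : SimpleGraph V) (H : SimpleGraph W) :
    indepPoly (G ⊕g H) = indepPoly G * indepPoly H := by
  simp only [indepPoly_eq_indepSum, indepSum_sum]

lemma cyclePoly_five : cyclePoly (X : ℤ[X]) 5 = 1 + 5 * X + 5 * X ^ 2 := by
  rw [cyclePoly_add_two X (n := 3) (by omega), cyclePoly_add_two X (n := 2) (by omega),
    cyclePoly_three, cyclePoly_two]
  ring

lemma cyclePoly_six : cyclePoly (X : ℤ[X]) 6 = 1 + 6 * X + 9 * X ^ 2 + 2 * X ^ 3 := by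
  rw [cyclePoly_add_two X (n := 4) (by omega), cyclePoly_five,
    cyclePoly_add_two X (n := 2) (by omega), cyclePoly_three, cyclePoly_two]
  ring

/-- The first factor belongs to the triangle, the second to all four six-vertex graphs. -/
lemma cyclePoly_nine :
    cyclePoly (X : ℤ[X]) 9 = (1 + 3 * X) * (1 + 6 * X + 9 * X ^ 2 + 3 * X ^ 3) := by
  have h7 := cyclePoly_add_two (X : ℤ[X]) (n := 5) (by omega)
  have h8 := cyclePoly_add_two (X : ℤ[X]) (n := 6) (by omega)
  have h9 := cyclePoly_add_two (X : ℤ[X]) (n := 7) (by omega)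
  norm_num at h7 h8 h9
  rw [h9, h8, h7, cyclePoly_six, cyclePoly_five]
  ring

/-- The factors belong to `C_3`, to `C_5` and `D_5`, and to the three seven-vertex graphs. -/
lemma cyclePoly_fifteen :
    cyclePoly (X : ℤ[X]) 15 = (1 + 3 * X) * (1 + 5 * X + 5 * X ^ 2) *
      (1 + 7 * X + 14 * X ^ 2 + 8 * X ^ 3 + X ^ 4) := by
  have h (k : ℕ) := cyclePoly_add_two (X : ℤ[X]) (n := k + 5) (by omega)
  have h7 := h 0; have h8 := h 1; have h9 := h 2; have h10 := h 3; have h11 := h 4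
  have h12 := h 5; have h13 := h 6; have h14 := h 7; have h15 := h 8
  norm_num at h7 h8 h9 h10 h11 h12 h13 h14 h15
  rw [h15, h14, h13, h12, h11, h10, h9, h8, h7, cyclePoly_six, cyclePoly_five]
  ring

lemma indepPoly_six : indepPoly graphA = 1 + 6 * X + 9 * X ^ 2 + 3 * X ^ 3 ∧
    indepPoly graphB = 1 + 6 * X + 9 * X ^ 2 + 3 * X ^ 3 ∧
    indepPoly graphC = 1 + 6 * X + 9 * X ^ 2 + 3 * X ^ 3 ∧
    indepPoly graphD = 1 + 6 * X + 9 * X ^ 2 + 3 * X ^ 3 := by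
  refine ⟨?_, ?_, ?_, ?_⟩ <;>
    (rw [evalCoeffs_of_eq (l := [1, 6, 9, 3]) (by decide +kernel)]
     simp only [evalCoeffs]
     push_cast
     ring)

lemma indepPoly_seven : indepPoly graphA' = 1 + 7 * X + 14 * X ^ 2 + 8 * X ^ 3 + X ^ 4 ∧
    indepPoly graphB' = 1 + 7 * X + 14 * X ^ 2 + 8 * X ^ 3 + X ^ 4 ∧
    indepPoly graphC' = 1 + 7 * X + 14 * X ^ 2 + 8 * X ^ 3 + X ^ 4 := by
  refine ⟨?_, ?_, ?_⟩ <;>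
    (rw [evalCoeffs_of_eq (l := [1, 7, 14, 8, 1]) (by decide +kernel)]
     simp only [evalCoeffs]
     push_cast
     ring)

lemma EquivListed.indepPoly_eq {V : Type*} [Fintype V] {G : SimpleGraph V} {n : ℕ} (hn : 3 ≤ n)
    (h : EquivListed n G) : indepPoly G = cyclePoly X n := by
  obtain ⟨hA, hB, hC, hD⟩ := indepPoly_six
  obtain ⟨hA', hB', hC'⟩ := indepPoly_seven
  rcases h with ⟨⟨e⟩⟩ | ⟨⟨e⟩⟩ | ⟨rfl, h⟩ | ⟨rfl, h⟩
  · rw [indepPoly_iso e, indepPoly_cycleGraph hn]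
  · rw [indepPoly_iso e, indepPoly_dGraph]
  · rcases h with ⟨⟨e⟩⟩ | ⟨⟨e⟩⟩ | ⟨⟨e⟩⟩ | ⟨⟨e⟩⟩ <;>
      simp only [indepPoly_iso e, indepPoly_sum, indepPoly_cycleGraph le_rfl, cyclePoly_three,
        cyclePoly_nine, hA, hB, hC, hD]
  · rcases h with ⟨⟨e⟩⟩ | ⟨⟨e⟩⟩ | ⟨⟨e⟩⟩ | ⟨⟨e⟩⟩ | ⟨⟨e⟩⟩ | ⟨⟨e⟩⟩ <;>
      simp only [indepPoly_iso e, indepPoly_sum, indepPoly_cycleGraph le_rfl, cyclePoly_three,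
        indepPoly_cycleGraph (show 3 ≤ 5 by norm_num), indepPoly_dGraph, cyclePoly_five,
        cyclePoly_fifteen, hA', hB', hC']

end Converse

/-! ### The equivalence classes. -/

section Main

/-- The independence equivalence class of an odd cycle of length at least five. -/
theorem indepEquiv_cycleGraph_iff {V : Type*} [Finite V] (G : SimpleGraph V) {n : ℕ} (ho : Odd n)
    (hn : 4 ≤ n) : IndepEquiv G (cycleGraph n) ↔ EquivListed n G := by
  have := Fintype.ofFinite V
  rw [IndepEquiv, indepPoly_cycleGraph (by omega)]
  exact ⟨equivListed_of_indepPoly hn (not_three_dvd_lucas (by omega) ho),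
    EquivListed.indepPoly_eq (by omega)⟩

/-- A graph on three vertices without independent pairs is a triangle. -/
theorem indepEquiv_cycleGraph_three_iff {V : Type*} [Finite V] (G : SimpleGraph V) :
    IndepEquiv G (cycleGraph 3) ↔ Nonempty (G ≃g cycleGraph 3) := by
  classical
  have := Fintype.ofFinite V
  refine ⟨fun h => ?_, fun ⟨e⟩ => indepPoly_iso e⟩
  rw [IndepEquiv] at h
  have hcard := indepPoly_coeff_one G
  rw [h, indepPoly_coeff_one, Fintype.card_fin] at hcard
  have hexc := excess_eq_sum_degree G
  rw [h, indepPoly_cycleGraph le_rfl, excess_cyclePoly le_rfl, Finset.sum_sub_distrib] at hexc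
  norm_cast at hcard
  have hdeg : ∀ v, G.degree v ≤ 2 := by
    intro v; have := G.degree_lt_card_verts v; omega
  -- On three vertices every degree is at most 2, and excess 0 forces equality everywhere.
  have htop : ∀ v, (G.degree v : ℤ) = 2 := by
    have := (Finset.sum_eq_zero_iff_of_nonpos (s := Finset.univ)
      (f := fun v => (G.degree v : ℤ) - 2) (fun v _ => by have := hdeg v; simp; omega)).1
        (by rw [Finset.sum_sub_distrib]; exact hexc.symm)
    intro v
    have := this v (Finset.mem_univ v)
    omega
  have hadj : ∀ x y, x ≠ y → G.Adj x y := by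
    intro x y hxy
    have h1 : G.neighborFinset x = Finset.univ.erase x := by
      refine Finset.eq_of_subset_of_card_le (fun z hz => ?_) ?_
      · simp only [mem_neighborFinset] at hz; simp [hz.ne']
      · rw [Finset.card_erase_of_mem (Finset.mem_univ x), Finset.card_univ, card_neighborFinset_eq_degree]
        have := htop x; omega
    rw [← mem_neighborFinset, h1]; simp [hxy.symm]
  have hC : ∀ x y : Fin 3, x ≠ y → (cycleGraph 3).Adj x y := by decide
  let e := Fintype.equivFinOfCardEq hcard.symm
  exact ⟨⟨e, fun {x y} => ⟨fun h => hadj _ _ fun hxy => h.ne (congrArg e hxy),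
    fun h => hC _ _ (e.injective.ne h.ne)⟩⟩⟩

end Main

end OddCycleClass

theorem theorem1 {V : Type*} [Finite V] (G : SimpleGraph V) :
    (OddCycleClass.IndepEquiv G (cycleGraph 3) ↔ Nonempty (G ≃g cycleGraph 3)) ∧
    (OddCycleClass.IndepEquiv G (cycleGraph 9) ↔
      (Nonempty (G ≃g cycleGraph 9) ∨
        Nonempty (G ≃g OddCycleClass.dGraph 9) ∨
        Nonempty (G ≃g (cycleGraph 3 ⊕g OddCycleClass.graphA)) ∨
        Nonempty (G ≃g (cycleGraph 3 ⊕g OddCycleClass.graphB)) ∨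
        Nonempty (G ≃g (cycleGraph 3 ⊕g OddCycleClass.graphC)) ∨
        Nonempty (G ≃g (cycleGraph 3 ⊕g OddCycleClass.graphD)))) ∧
    (OddCycleClass.IndepEquiv G (cycleGraph 15) ↔
      (Nonempty (G ≃g cycleGraph 15) ∨
        Nonempty (G ≃g OddCycleClass.dGraph 15) ∨
        Nonempty (G ≃g (cycleGraph 3 ⊕g cycleGraph 5 ⊕g OddCycleClass.graphA')) ∨
        Nonempty (G ≃g (cycleGraph 3 ⊕g OddCycleClass.dGraph 5 ⊕g OddCycleClass.graphA')) ∨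
        Nonempty (G ≃g (cycleGraph 3 ⊕g cycleGraph 5 ⊕g OddCycleClass.graphB')) ∨
        Nonempty (G ≃g (cycleGraph 3 ⊕g OddCycleClass.dGraph 5 ⊕g OddCycleClass.graphB')) ∨
        Nonempty (G ≃g (cycleGraph 3 ⊕g cycleGraph 5 ⊕g OddCycleClass.graphC')) ∨
        Nonempty (G ≃g (cycleGraph 3 ⊕g OddCycleClass.dGraph 5 ⊕g OddCycleClass.graphC')))) ∧
    (∀ n : ℕ, Odd n → 5 ≤ n → n ≠ 9 → n ≠ 15 →
      (OddCycleClass.IndepEquiv G (cycleGraph n) ↔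
        (Nonempty (G ≃g cycleGraph n) ∨ Nonempty (G ≃g OddCycleClass.dGraph n)))) ∧
    (∀ n : ℕ, Odd n → 4 ≤ n → ¬ 3 ∣ n →
      (OddCycleClass.IndepEquiv G (cycleGraph n) ↔
        (Nonempty (G ≃g cycleGraph n) ∨ Nonempty (G ≃g OddCycleClass.dGraph n)))) := by
  refine ⟨OddCycleClass.indepEquiv_cycleGraph_three_iff G, ?_, ?_, ?_, ?_⟩
  · rw [OddCycleClass.indepEquiv_cycleGraph_iff G (by decide) (by norm_num),
      OddCycleClass.EquivListed]
    simp
  · rw [OddCycleClass.indepEquiv_cycleGraph_iff G (by decide) (by norm_num),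
      OddCycleClass.EquivListed]
    simp
  · intro n ho hn h9 h15
    rw [OddCycleClass.indepEquiv_cycleGraph_iff G ho (by omega), OddCycleClass.EquivListed]
    simp [h9, h15]
  · intro n ho hn h3
    rw [OddCycleClass.indepEquiv_cycleGraph_iff G ho hn, OddCycleClass.EquivListed]
    simp [show n ≠ 9 by rintro rfl; exact h3 (by norm_num),
      show n ≠ 15 by rintro rfl; exact h3 (by norm_num)]
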